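/- Let $l\ge 3$ be an integer, let $s_1>\frac12$, $s_2\ge\frac{l-3}{2(l-1)}$ and $0<\varepsilon\le\min(s_1,1)$, and write $s=(s_1,s_2,\varepsilon)$. Let $(k,\eta,\tau)$ be the Fourier variables dual to $(x,y,t)\in\mathbb R^3$, let $\mathcal F$ denote the unitary Fourier transform in $(x,y,t)$, let $\langle a\rangle^{\sigma}=(1+a^2)^{\sigma/2}$ and $\phi(k,\eta)=k^3-\frac{\eta^2}{k}$. For tempered distributions $u$ on $\mathbb R^3$ whose Fourier transform is a function, put $$\|u\|_{X_{\sigma_1,\sigma_2,\sigma_3;b}}=\big\|\langle k\rangle^{\sigma_1}\langle\eta\rangle^{\sigma_2}\langle k^{-1}\eta\rangle^{\sigma_3}\langle\tau-\phi(k,\eta)\rangle^{b}\,\mathcal Fu\big\|_{L^2_{k\eta\tau}},$$ $$\|u\|_{X_{(s),b}}=\|u\|_{X_{s_1+2s_2+\varepsilon,0,0;b}}+\|u\|_{X_{s_1,s_2,\varepsilon;b}},$$ and let $X_{(s),b}$ be the space of those $u$ for which the latter norm is finite. Then there exists $b'>-\frac12$ such that for every $b>\frac12$ there is a constant $C$,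 depending only on $l,s,b',b$, with the following property: for all $u_1,\dots,u_l\in X_{(s),b}$ supported in $\{|t|\le1\}$, the $u_j$ are functions, their pointwise product $\prod_{j=1}^l u_j$ defines a tempered distribution, and $$\Big\|\partial_x\prod_{j=1}^l u_j\Big\|_{X_{(s),b'}}\le C\prod_{j=1}^l\|u_j\|_{X_{(s),b}}.$$ -/

import Mathlib

open MeasureTheory
open scoped SchwartzMap FourierTransform LineDeriv ENNReal NNReal

noncomputable section

namespace KP

/-- Space-time `ℝ³` with coordinates `0 ↦ x`, `1 ↦ y`, `2 ↦ t`; on the Fourier side the same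
coordinates are `(k, η, τ)`. -/
abbrev SpaceTime : Type := EuclideanSpace ℝ (Fin 3)

/-- `⟨x⟩^σ = (1 + x²)^(σ/2)`. -/
def bracket (x σ : ℝ) : ℝ := (1 + x ^ 2) ^ (σ / 2)

/-- The phase function `φ(k, η) = k³ - η²/k` of the linearized KP-II equation. -/
def phase (k η : ℝ) : ℝ := k ^ 3 - η ^ 2 / k

/-- The Fourier weight `⟨k⟩^σ₁ ⟨η⟩^σ₂ ⟨k⁻¹η⟩^σ₃ ⟨τ - φ(k,η)⟩^b` (the null set `k = 0` is
irrelevant). -/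
def weight (σ₁ σ₂ σ₃ b : ℝ) (ζ : SpaceTime) : ℝ :=
  bracket (ζ 0) σ₁ * bracket (ζ 1) σ₂ * bracket ((ζ 0)⁻¹ * ζ 1) σ₃
    * bracket (ζ 2 - phase (ζ 0) (ζ 1)) b

/-- The tempered distribution `T` is given by integration against the function `f`. -/
def Represents (T : 𝓢'(SpaceTime, ℂ)) (f : SpaceTime → ℂ) : Prop :=
  ∀ ψ : 𝓢(SpaceTime, ℂ), Integrable (fun p => ψ p * f p) ∧ T ψ = ∫ p, ψ p * f p

/-- The `X_{σ₁,σ₂,σ₃;b}` norm of a tempered distribution, with value `∞` if its Fourier transform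
is not a function. The function `g` is unique up to null sets, so that the infimum ranges over one
value only. Mathlib's Fourier transform uses the kernel `exp (-2πi⟨p,w⟩)`; the frequency variables
of the kernel `exp (-i(kx + ηy + τt))` are `(k, η, τ) = 2πw`, and the value below is exactly the
weighted `L²` norm of the unitary Fourier transform in the variables `(k, η, τ)`. -/
def xNorm (σ₁ σ₂ σ₃ b : ℝ) (u : 𝓢'(SpaceTime, ℂ)) : ℝ≥0∞ :=
  ⨅ (g : SpaceTime → ℂ) (_ : Represents (𝓕 u) g),
    eLpNorm (fun w => (weight σ₁ σ₂ σ₃ b ((2 * Real.pi) • w) : ℂ) * g w) 2 volume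

/-- The norm of `X_{(s),b}` for `s = (s₁, s₂, ε)`. -/
def xsNorm (s₁ s₂ ε b : ℝ) (u : 𝓢'(SpaceTime, ℂ)) : ℝ≥0∞ :=
  xNorm (s₁ + 2 * s₂ + ε) 0 0 b u + xNorm s₁ s₂ ε b u

/-- The space `X_{(s),b}`. -/
def xsSpace (s₁ s₂ ε b : ℝ) : Set 𝓢'(SpaceTime, ℂ) := {u | xsNorm s₁ s₂ ε b u < ∞}

/-- The time slab `{|t| ≤ 1}`. -/
def timeSlab : Set SpaceTime := {p | |p 2| ≤ 1}

/-- `P` is the product of `u₁, …, u_l`: all the `u_j` are functions, and their pointwise product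
is a function that defines the tempered distribution `P`. -/
def IsProduct {l : ℕ} (u : Fin l → 𝓢'(SpaceTime, ℂ)) (P : 𝓢'(SpaceTime, ℂ)) : Prop :=
  ∃ f : Fin l → SpaceTime → ℂ,
    (∀ j, Represents (u j) (f j)) ∧ Represents P (fun p => ∏ j, f j p)

/-- The distributional derivative `∂_x`. -/
def dx (u : 𝓢'(SpaceTime, ℂ)) : 𝓢'(SpaceTime, ℂ) :=
  ∂_{(EuclideanSpace.single 0 1 : SpaceTime)} u

end KP

end

set_option linter.unusedSectionVars false

/-! Fourier side. The two parts of the norm are together comparable to one weighted `L²` norm, with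
weight `fullWeight`, that is `(1 + |k|)^s₁ (1 + k² + |η|)^s₂ (1 + |k| + |η/k|)^ε`, times a power of
the modulation `τ - φ(k, η)`. The Fourier transform of the product is dominated by the convolution
of the moduli of the transforms. By duality the claim therefore becomes a bound for a positive
multilinear form on `L²` functions, `exists_form_le`, in which no oscillation is left.

Bilinear estimates. Cauchy–Schwarz reduces an `L²` bound for a product of two factors to the
integral of a profile of `τ - φ(k₁, η₁) - φ(k₂, η₂)` over all splittings of the output frequency.
Three gains result. `exists_convSq_strichartz_le` puts half a power of `1 + |k|` on one factor and
takes slightly more than half a power from the other. `exists_convSq_transversal_le` gains half a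
power of the difference of the velocities `η/k`. `exists_convSq_fast_le` gains a full power of `|k|`
on a factor that is much faster than the other one; it relies on the KP-II sign, for which `∂φ/∂k =
3k² + η²/k²` is a sum of nonnegative terms.

Balance of weights. Let `l = n + 3`. By symmetry factor 0 has the largest `1 + |k|`, and factors 1
and 2 have the largest sizes `1 + k² + |η|` among the others. The last `n` factors are put in `L^∞`
by Sobolev, which costs slightly more than half a power in `k` and in `η` for each. The threshold
`s₂ ≥ n/(2(n+2))` is what is needed to share the half powers in `η` among the `n + 2` factors that
remain when the output has consumed the weight of one; this is `sobolev_balance`. The small excess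
is paid by the margins in `s₁` and `ε`.

Output modulation. If it is at most a fixed power of the sizes of the factors other than 0, its
exponent can be lowered from `b' > -1/2` to below `-1/2` at the cost of a small power of these
sizes. The dual function then behaves like one more factor and is paired with factor 2, while factor
0 is paired with factor 1; the two half derivatives make up `∂_x` (`pointwise_moderate`). If the
output modulation is larger, it pays for everything except one derivative on factor 0. That
derivative is either recovered by the smoothing of a fast factor or is bounded by the velocity size
of factor 1 (`pointwise_large`).

The product as a function. The same scheme without the derivative shows that the product of any `n +
2` factors lies in `L²` (`exists_power_form_le`). Hence the full product is in `L¹`, and its Fourier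
transform is the limit of convolutions of truncated transforms, which gives the required domination
(`integrable_prod_and_enorm_fourier_le`). -/

namespace KP

/-! ### Positive multilinear forms: `L²` norms of convolutions, reflections, Hölder–Young. -/

section Forms

/-- The Cauchy–Schwarz inequality for nonnegative functions. -/
theorem sq_lintegral_mul_le {α : Type*} [MeasurableSpace α] (μ : Measure α) {f g : α → ℝ≥0∞}
    (hf : AEMeasurable f μ) (hg : AEMeasurable g μ) :
    (∫⁻ a, f a * g a ∂μ) ^ 2 ≤ (∫⁻ a, f a ^ 2 ∂μ) * ∫⁻ a, g a ^ 2 ∂μ := by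
  have h := ENNReal.lintegral_mul_le_Lp_mul_Lq μ Real.HolderConjugate.two_two hf hg
  have h2 := pow_le_pow_left₀ zero_le h 2
  refine h2.trans (le_of_eq ?_)
  rw [mul_pow, ← ENNReal.rpow_natCast, ← ENNReal.rpow_natCast, ← ENNReal.rpow_mul,
    ← ENNReal.rpow_mul]
  simp

theorem ennreal_add_sq_le (a b : ℝ≥0∞) : (a + b) ^ 2 ≤ 2 * (a ^ 2 + b ^ 2) := by
  have := ENNReal.rpow_add_le_mul_rpow_add_rpow a b (p := 2) (by norm_num)
  norm_num at this
  simpa using this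

theorem ennreal_sum_sq_le {ι : Type*} (s : Finset ι) (f : ι → ℝ≥0∞) :
    (∑ i ∈ s, f i) ^ 2 ≤ 2 ^ s.card * ∑ i ∈ s, f i ^ 2 := by
  classical
  induction s using Finset.induction_on with
  | empty => simp
  | insert a s ha ih =>
    rw [Finset.sum_insert ha, Finset.sum_insert ha, Finset.card_insert_of_notMem ha]
    calc (f a + ∑ i ∈ s, f i) ^ 2 ≤ 2 * (f a ^ 2 + (∑ i ∈ s, f i) ^ 2) := ennreal_add_sq_le _ _
      _ ≤ 2 * (2 ^ s.card * f a ^ 2 + 2 ^ s.card * ∑ i ∈ s, f i ^ 2) := by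
        gcongr
        exact le_mul_of_one_le_left zero_le (one_le_pow₀ (by norm_num))
      _ = _ := by ring

theorem le_of_sq_le {a b : ℝ≥0∞} (h : a ^ 2 ≤ b ^ 2) : a ≤ b :=
  (ENNReal.pow_le_pow_left_iff two_ne_zero).1 h

theorem lintegral_fin_cons {E : Type*} [MeasureSpace E] [SigmaFinite (volume : Measure E)] {n : ℕ}
    (f : (Fin (n + 1) → E) → ℝ≥0∞) (hf : Measurable f) :
    ∫⁻ w, f w = ∫⁻ x, ∫⁻ w : Fin n → E, f (Fin.cons x w) := by
  have h := (volume_preserving_piFinSuccAbove (fun _ : Fin (n + 1) => E) 0).symm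
  rw [← h.lintegral_comp hf, Measure.volume_eq_prod, lintegral_prod]
  · simp [MeasurableEquiv.piFinSuccAbove, Fin.insertNthEquiv, Fin.insertNth_zero']
  · exact (hf.comp (MeasurableEquiv.measurable _)).aemeasurable

theorem measurable_fin_cons {E : Type*} [MeasurableSpace E] {n : ℕ} :
    Measurable fun p : E × (Fin n → E) => (Fin.cons p.1 p.2 : Fin (n + 1) → E) := by
  rw [measurable_pi_iff]
  intro i
  refine Fin.cases ?_ (fun j => ?_) i
  · simpa using measurable_fst
  · simp only [Fin.cons_succ]
    fun_prop

theorem lintegral_fin_prod {E : Type*} [MeasureSpace E] [SigmaFinite (volume : Measure E)] {n : ℕ}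
    (g : Fin n → E → ℝ≥0∞) (hg : ∀ i, Measurable (g i)) :
    ∫⁻ w : Fin n → E, ∏ i, g i (w i) = ∏ i, ∫⁻ x, g i x := by
  induction n with
  | zero => simp [volume_pi]
  | succ n ih =>
    rw [lintegral_fin_cons _ (by fun_prop), Fin.prod_univ_succ, ← ih _ fun i => hg i.succ,
      ← lintegral_mul_const _ (hg 0)]
    congr 1 with x
    simp only [Fin.prod_univ_succ, Fin.cons_zero, Fin.cons_succ]
    rw [lintegral_const_mul]
    fun_prop

theorem lintegral_comp_perm {E ι : Type*} [Fintype ι] [MeasureSpace E]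
    [SigmaFinite (volume : Measure E)] (f : (ι → E) → ℝ≥0∞) (e : Equiv.Perm ι) :
    ∫⁻ w : ι → E, f (fun i => w (e i)) = ∫⁻ w, f w := by
  have h := volume_measurePreserving_piCongrLeft (fun _ : ι => E) e.symm
  rw [← h.lintegral_comp_emb (MeasurableEquiv.measurableEmbedding _) f]
  congr 1 with w
  congr 1 with i
  obtain ⟨j, rfl⟩ := e.symm.surjective i
  rw [MeasurableEquiv.coe_piCongrLeft, Equiv.piCongrLeft_apply_apply]
  simp

variable {E : Type*} [AddCommGroup E] [MeasureSpace E]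

/-- The squared `L²` norm of `ω ↦ ∫ A (ω - ζ, ζ) dζ`. -/
noncomputable def convSq (A : E → E → ℝ≥0∞) : ℝ≥0∞ := ∫⁻ ω, (∫⁻ ζ, A (ω - ζ) ζ) ^ 2

theorem convSq_mono {A B : E → E → ℝ≥0∞} (h : ∀ x y, A x y ≤ B x y) : convSq A ≤ convSq B :=
  lintegral_mono fun _ => pow_le_pow_left₀ zero_le (lintegral_mono fun _ => h _ _) 2

variable [MeasurableAdd₂ E] [MeasurableNeg E]
  [SigmaFinite (volume : Measure E)] [(volume : Measure E).IsAddLeftInvariant]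
  [(volume : Measure E).IsNegInvariant]

/-- Cauchy–Schwarz for a bilinear convolution operator with a symbol. -/
theorem convSq_le_of_kernel {m : E → E → ℝ≥0∞} (hm : Measurable (Function.uncurry m))
    {S : ℝ≥0∞} (hS : ∀ ω, ∫⁻ ζ, m (ω - ζ) ζ ^ 2 ≤ S) {f g : E → ℝ≥0∞}
    (hf : Measurable f) (hg : Measurable g) :
    convSq (fun x y => m x y * (f x * g y)) ≤ S * ((∫⁻ x, f x ^ 2) * ∫⁻ x, g x ^ 2) := by
  have key : ∀ ω, (∫⁻ ζ, m (ω - ζ) ζ * (f (ω - ζ) * g ζ)) ^ 2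
      ≤ S * ∫⁻ ζ, f (ω - ζ) ^ 2 * g ζ ^ 2 := by
    intro ω
    have hsub : Measurable fun ζ : E => ω - ζ := by fun_prop
    have h1 : Measurable fun ζ => m (ω - ζ) ζ := hm.comp (hsub.prodMk measurable_id)
    have h2 : Measurable fun ζ => f (ω - ζ) * g ζ := by fun_prop
    refine (sq_lintegral_mul_le volume h1.aemeasurable h2.aemeasurable).trans ?_
    simp only [mul_pow]
    gcongr
    exact hS ω
  have hM : Measurable (Function.uncurry fun ω ζ : E => f (ω - ζ) ^ 2 * g ζ ^ 2) := by
    simp only [Function.uncurry_def]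
    fun_prop
  calc convSq (fun x y => m x y * (f x * g y)) ≤ ∫⁻ ω, S * ∫⁻ ζ, f (ω - ζ) ^ 2 * g ζ ^ 2 :=
        lintegral_mono key
    _ = S * ∫⁻ ω, ∫⁻ ζ, f (ω - ζ) ^ 2 * g ζ ^ 2 := lintegral_const_mul _ hM.lintegral_prod_right'
    _ = S * ∫⁻ ζ, ∫⁻ ω, f (ω - ζ) ^ 2 * g ζ ^ 2 := by
        rw [lintegral_lintegral_swap hM.aemeasurable]
    _ = _ := by
        congr 1
        rw [← lintegral_const_mul _ (hg.pow_const 2)]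
        congr 1 with ζ
        rw [lintegral_mul_const _ (by fun_prop)]
        congr 1
        exact lintegral_sub_right_eq_self (fun x => f x ^ 2) ζ

/-- Expand the square and substitute `a = ω - ζ`. What remains of `f` is its autocorrelation at `ζ -
ζ'`, which makes the effect of reflecting `g` visible. -/
theorem convSq_mul_eq {f g : E → ℝ≥0∞} (hf : Measurable f) (hg : Measurable g) :
    convSq (fun x y => f x * g y)
      = ∫⁻ ζ, ∫⁻ ζ', ∫⁻ a, f a * f (a + ζ - ζ') * (g ζ * g ζ') := by
  have h1 : ∀ ω, (∫⁻ ζ, f (ω - ζ) * g ζ) ^ 2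
      = ∫⁻ ζ, ∫⁻ ζ', f (ω - ζ) * f (ω - ζ') * (g ζ * g ζ') := by
    intro ω
    rw [sq, ← lintegral_mul_const _ (by fun_prop)]
    congr 1 with ζ
    rw [← lintegral_const_mul _ (by fun_prop)]
    congr 1 with ζ'
    ring
  rw [convSq]
  simp only [h1]
  rw [lintegral_lintegral_swap]
  · congr 1 with ζ
    rw [lintegral_lintegral_swap]
    · congr 1 with ζ'
      rw [← lintegral_add_right_eq_self _ ζ]
      simp
    · refine Measurable.aemeasurable ?_
      simp only [Function.uncurry_def]
      fun_prop
  · refine Measurable.aemeasurable ?_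
    simp only [Function.uncurry_def]
    refine Measurable.lintegral_prod_right' (f := fun p : (E × E) × E =>
      f (p.1.1 - p.1.2) * f (p.1.1 - p.2) * (g p.1.2 * g p.2)) ?_
    fun_prop

/-- The substitution `(ζ, ζ') ↦ (-ζ', -ζ)` preserves `ζ - ζ'`. This is the Fourier-side form of `|u
v| = |u v̄|`, and it permits changing the sign of the frequency of a single factor. -/
theorem convSq_reflect_right {f g : E → ℝ≥0∞} (hf : Measurable f) (hg : Measurable g) :
    convSq (fun x y => f x * g (-y)) = convSq (fun x y => f x * g y) := by
  rw [convSq_mul_eq hf hg, convSq_mul_eq hf (g := fun y => g (-y)) (by fun_prop)]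
  rw [← lintegral_neg_eq_self, lintegral_lintegral_swap]
  · rw [← lintegral_neg_eq_self]
    refine lintegral_congr fun ζ => lintegral_congr fun ζ' => lintegral_congr fun a => ?_
    rw [show a + -ζ' - -ζ = a + ζ - ζ' by abel, neg_neg, neg_neg]
    ring
  · refine Measurable.aemeasurable ?_
    simp only [Function.uncurry_def]
    refine Measurable.lintegral_prod_right' (f := fun p : (E × E) × E =>
      f p.2 * f (p.2 + -p.1.1 - p.1.2) * (g (-(-p.1.1)) * g (-p.1.2))) ?_
    fun_prop

theorem convSq_swap (A : E → E → ℝ≥0∞) : convSq (fun x y => A y x) = convSq A := by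
  rw [convSq, convSq]
  congr 1 with ω
  rw [← lintegral_sub_left_eq_self _ ω]
  simp

theorem convSq_reflect_left {f g : E → ℝ≥0∞} (hf : Measurable f) (hg : Measurable g) :
    convSq (fun x y => f (-x) * g y) = convSq (fun x y => f x * g y) := by
  rw [← convSq_swap, ← convSq_swap (fun x y => f x * g y)]
  simp only [mul_comm (f _)]
  rw [← convSq_reflect_right hg hf]

/-- Pairing the dual function with a factor produces a correlation. Reflection turns it into a
convolution, so that bilinear estimates also apply when one of the functions is the output. -/
theorem lintegral_correlation_sq {f g : E → ℝ≥0∞} (hf : Measurable f) (hg : Measurable g) :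
    ∫⁻ ω, (∫⁻ z, f (ω + z) * g z) ^ 2 = convSq (fun x y => f x * g y) := by
  rw [← convSq_reflect_right hf hg, convSq]
  congr 1 with ω
  rw [← lintegral_neg_eq_self]
  simp [sub_eq_add_neg]

theorem convSq_add_le {A B : E → E → ℝ≥0∞} (hA : Measurable (Function.uncurry A)) :
    convSq (fun x y => A x y + B x y) ≤ 2 * (convSq A + convSq B) := by
  have hs : ∀ {A : E → E → ℝ≥0∞}, Measurable (Function.uncurry A) →
      Measurable (Function.uncurry fun ω ζ : E => A (ω - ζ) ζ) := fun hA =>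
    hA.comp ((measurable_fst.sub measurable_snd).prodMk measurable_snd)
  have hA' := hs hA
  have hAm : Measurable fun ω : E => (∫⁻ ζ, A (ω - ζ) ζ) ^ 2 :=
    (hA'.lintegral_prod_right').pow_const 2
  simp only [convSq]
  rw [← lintegral_add_left hAm, ← lintegral_const_mul']
  · refine lintegral_mono fun ω => ?_
    rw [lintegral_add_left (f := fun ζ => A (ω - ζ) ζ)
      (hA'.comp (measurable_const.prodMk measurable_id))]
    exact ennreal_add_sq_le _ _
  · simp

/-- A bilinear `L²` estimate for even weights and functions living on a set `S` with
`S ∪ -S = E` extends to all functions. -/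
theorem convSq_le_of_half {S : Set E} (hS : MeasurableSet S) (hSE : ∀ x, x ∈ S ∨ -x ∈ S)
    {ρ₁ ρ₂ : E → ℝ≥0∞} (h₁ : Measurable ρ₁) (h₂ : Measurable ρ₂)
    (he₁ : ∀ x, ρ₁ (-x) = ρ₁ x) (he₂ : ∀ x, ρ₂ (-x) = ρ₂ x) {C : ℝ≥0∞}
    (H : ∀ f g : E → ℝ≥0∞, Measurable f → Measurable g →
      convSq (fun x y => S.indicator ρ₁ x * S.indicator ρ₂ y * (f x * g y))
        ≤ C * ((∫⁻ x, f x ^ 2) * ∫⁻ x, g x ^ 2))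
    {f g : E → ℝ≥0∞} (hf : Measurable f) (hg : Measurable g) :
    convSq (fun x y => (ρ₁ x * f x) * (ρ₂ y * g y))
      ≤ 16 * C * ((∫⁻ x, f x ^ 2) * ∫⁻ x, g x ^ 2) := by
  -- Each function is dominated by its part on `S` plus the reflection of a function that again
  -- lives on `S`; evenness of the weights lets both pieces carry the same cut-off weight.
  set f₁ : E → ℝ≥0∞ := fun x => S.indicator ρ₁ x * f x
  set f₂ : E → ℝ≥0∞ := fun x => S.indicator ρ₁ x * f (-x)
  set g₁ : E → ℝ≥0∞ := fun x => S.indicator ρ₂ x * g x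
  set g₂ : E → ℝ≥0∞ := fun x => S.indicator ρ₂ x * g (-x)
  have hi₁ := h₁.indicator hS
  have hi₂ := h₂.indicator hS
  have hf₁ : Measurable f₁ := by fun_prop
  have hf₂ : Measurable f₂ := by fun_prop
  have hg₁ : Measurable g₁ := by fun_prop
  have hg₂ : Measurable g₂ := by fun_prop
  have hle : ∀ (ρ f : E → ℝ≥0∞), (∀ x, ρ (-x) = ρ x) → ∀ x,
      ρ x * f x ≤ S.indicator ρ x * f x + S.indicator ρ (-x) * f (- -x) := by
    intro ρ f he x
    rcases hSE x with h | h
    · simp [h]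
    · simp [h, he]
  have hneg : ∀ f : E → ℝ≥0∞, ∫⁻ x, f (-x) ^ 2 = ∫⁻ x, f x ^ 2 := fun f =>
    lintegral_neg_eq_self (fun x => f x ^ 2)
  have hH : ∀ f g : E → ℝ≥0∞, Measurable f → Measurable g →
      convSq (fun x y => (S.indicator ρ₁ x * f x) * (S.indicator ρ₂ y * g y))
        ≤ C * ((∫⁻ x, f x ^ 2) * ∫⁻ x, g x ^ 2) := by
    intro f g hf hg
    simpa only [mul_mul_mul_comm] using H f g hf hg
  set D := C * ((∫⁻ x, f x ^ 2) * ∫⁻ x, g x ^ 2)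
  have e11 : convSq (fun x y => f₁ x * g₁ y) ≤ D := hH f g hf hg
  have e12 : convSq (fun x y => f₁ x * g₂ (-y)) ≤ D := by
    rw [convSq_reflect_right hf₁ hg₂]
    refine (hH f (fun x => g (-x)) hf (by fun_prop)).trans (le_of_eq ?_)
    rw [hneg]
  have e21 : convSq (fun x y => f₂ (-x) * g₁ y) ≤ D := by
    rw [convSq_reflect_left hf₂ hg₁]
    refine (hH (fun x => f (-x)) g (by fun_prop) hg).trans (le_of_eq ?_)
    rw [hneg]
  have e22 : convSq (fun x y => f₂ (-x) * g₂ (-y)) ≤ D := by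
    rw [convSq_reflect_left (g := fun y => g₂ (-y)) hf₂ (by fun_prop),
      convSq_reflect_right hf₂ hg₂]
    refine (hH (fun x => f (-x)) (fun x => g (-x)) (by fun_prop) (by fun_prop)).trans
      (le_of_eq ?_)
    rw [hneg, hneg]
  calc convSq (fun x y => (ρ₁ x * f x) * (ρ₂ y * g y))
      ≤ convSq (fun x y => (f₁ x * g₁ y + f₁ x * g₂ (-y))
          + (f₂ (-x) * g₁ y + f₂ (-x) * g₂ (-y))) := by
        refine convSq_mono fun x y => ?_
        rw [← mul_add, ← mul_add, ← add_mul]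
        exact mul_le_mul' (hle ρ₁ f he₁ x) (hle ρ₂ g he₂ y)
    _ ≤ 2 * (2 * (D + D) + 2 * (D + D)) := by
        refine (convSq_add_le (by simp only [Function.uncurry_def]; fun_prop)).trans ?_
        gcongr
        · exact (convSq_add_le (by simp only [Function.uncurry_def]; fun_prop)).trans (by gcongr)
        · exact (convSq_add_le (by simp only [Function.uncurry_def]; fun_prop)).trans (by gcongr)
    _ = 16 * D := by ring
    _ = _ := by rw [mul_assoc]

/-- The Hölder–Young bound for a multilinear form in which two factors are paired. -/
theorem sq_form_le {n : ℕ} {A : E → E → ℝ≥0∞} (hA : Measurable (Function.uncurry A))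
    {F : E → ℝ≥0∞} (hF : Measurable F) {g : Fin n → E → ℝ≥0∞} (hg : ∀ i, Measurable (g i)) :
    (∫⁻ x, ∫⁻ y, ∫⁻ w : Fin n → E, A x y * (F (x + (y + ∑ i, w i)) * ∏ i, g i (w i))) ^ 2
      ≤ convSq A * (∫⁻ x, F x ^ 2) * ∏ i, (∫⁻ x, g i x) ^ 2 := by
  have hAs : Measurable (Function.uncurry fun ω ζ : E => A (ω - ζ) ζ) :=
    hA.comp ((measurable_fst.sub measurable_snd).prodMk measurable_snd)
  set D : ℝ≥0∞ := (convSq A * ∫⁻ x, F x ^ 2) ^ (1 / 2 : ℝ)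
  have hD : D ^ 2 = convSq A * ∫⁻ x, F x ^ 2 := by
    rw [← ENNReal.rpow_natCast, ← ENNReal.rpow_mul]
    simp
  have hA1 : Measurable fun p : (E × E) × (Fin n → E) => A p.1.1 p.1.2 := hA.comp measurable_fst
  -- With the sum `z` of the other variables frozen, Cauchy–Schwarz in `ω = x + y` gives a bound
  -- independent of `z` by translation invariance. The integral over the other variables then
  -- factors.
  have key : ∀ z, ∫⁻ x, ∫⁻ y, A x y * F (x + (y + z)) ≤ D := by
    intro z
    apply le_of_sq_le
    rw [hD]
    have h1 : ∫⁻ x, ∫⁻ y, A x y * F (x + (y + z))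
        = ∫⁻ ω, (∫⁻ y, A (ω - y) y) * F (ω + z) := by
      rw [lintegral_lintegral_swap]
      · have : ∀ y, ∫⁻ x, A x y * F (x + (y + z)) = ∫⁻ ω, A (ω - y) y * F (ω + z) := by
          intro y
          rw [← lintegral_sub_right_eq_self _ y]
          simp [← add_assoc]
        simp only [this]
        rw [lintegral_lintegral_swap]
        · congr 1 with ω
          exact lintegral_mul_const _ (hAs.comp (measurable_const.prodMk measurable_id))
        · refine Measurable.aemeasurable (Measurable.mul ?_ ?_)
          · exact hAs.comp measurable_swap
          · fun_prop
      · refine Measurable.aemeasurable (hA.mul ?_)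
        fun_prop
    rw [h1]
    refine (sq_lintegral_mul_le volume hAs.lintegral_prod_right'.aemeasurable
      (by fun_prop)).trans (le_of_eq ?_)
    rw [lintegral_add_right_eq_self (fun ω => F ω ^ 2) z]
    rfl
  have hswap : ∫⁻ x, ∫⁻ y, ∫⁻ w : Fin n → E, A x y * (F (x + (y + ∑ i, w i)) * ∏ i, g i (w i))
      = ∫⁻ w : Fin n → E, (∫⁻ x, ∫⁻ y, A x y * F (x + (y + ∑ i, w i))) * ∏ i, g i (w i) := by
    have hmeas : Measurable fun p : (E × E) × (Fin n → E) =>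
        A p.1.1 p.1.2 * (F (p.1.1 + (p.1.2 + ∑ i, p.2 i)) * ∏ i, g i (p.2 i)) :=
      hA1.mul (by fun_prop)
    have h1 : ∀ x, ∫⁻ y, ∫⁻ w : Fin n → E, A x y * (F (x + (y + ∑ i, w i)) * ∏ i, g i (w i))
        = ∫⁻ w : Fin n → E, ∫⁻ y, A x y * (F (x + (y + ∑ i, w i)) * ∏ i, g i (w i)) := by
      intro x
      refine lintegral_lintegral_swap (Measurable.aemeasurable ?_)
      exact hmeas.comp (f := fun p : E × (Fin n → E) => ((x, p.1), p.2)) (by fun_prop)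
    simp only [h1]
    rw [lintegral_lintegral_swap]
    · congr 1 with w
      rw [← lintegral_mul_const _]
      · congr 1 with x
        rw [← lintegral_mul_const _]
        · simp only [mul_assoc]
        · exact (hA.comp (measurable_const.prodMk measurable_id)).mul (by fun_prop)
      · refine Measurable.lintegral_prod_right' (f := fun p : E × E =>
          A p.1 p.2 * F (p.1 + (p.2 + ∑ i, w i))) (hA.mul (by fun_prop))
    · refine Measurable.aemeasurable ?_
      refine Measurable.lintegral_prod_right' (f := fun p : (E × (Fin n → E)) × E =>
        A p.1.1 p.2 * (F (p.1.1 + (p.2 + ∑ i, p.1.2 i)) * ∏ i, g i (p.1.2 i))) ?_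
      exact hmeas.comp (f := fun p : (E × (Fin n → E)) × E => ((p.1.1, p.2), p.1.2))
        (by fun_prop)
  rw [hswap, Finset.prod_pow, ← hD, ← mul_pow]
  gcongr
  calc _ ≤ ∫⁻ w : Fin n → E, D * ∏ i, g i (w i) := by
        gcongr
        exact key _
    _ = _ := by rw [lintegral_const_mul _ (by fun_prop), lintegral_fin_prod g hg]

end Forms

/-! ### One-dimensional integrals of the profile `(1 + |x|)^(-p)`. -/

section Decay

/-- The decaying profile `(1 + |x|)^(-p)`. -/
noncomputable def decay (p x : ℝ) : ℝ≥0∞ := ENNReal.ofReal ((1 + |x|) ^ (-p))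

theorem measurable_decay (p : ℝ) : Measurable (decay p) := by
  unfold decay
  fun_prop

theorem decay_anti {p x y : ℝ} (hp : 0 ≤ p) (h : |x| ≤ |y|) : decay p y ≤ decay p x := by
  refine ENNReal.ofReal_le_ofReal ?_
  exact Real.rpow_le_rpow_of_nonpos (by positivity) (by linarith) (by linarith)

theorem decay_neg (p x : ℝ) : decay p (-x) = decay p x := by simp [decay]

theorem decay_le_one {p : ℝ} (hp : 0 ≤ p) (x : ℝ) : decay p x ≤ 1 := by
  rw [← ENNReal.ofReal_one]
  refine ENNReal.ofReal_le_ofReal (Real.rpow_le_one_of_one_le_of_nonpos ?_ (by linarith))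
  linarith [abs_nonneg x]

theorem lintegral_decay_lt_top {p : ℝ} (hp : 1 < p) : ∫⁻ x, decay p x < ∞ := by
  have h := integrable_one_add_norm (E := ℝ) (μ := volume) (r := p) (by simpa using hp)
  have h2 := h.lintegral_lt_top
  simpa [decay] using h2

theorem exists_lintegral_decay_le {p : ℝ} (hp : 1 < p) :
    ∃ C : ℝ≥0, ∫⁻ x, decay p x ≤ C :=
  ⟨(∫⁻ x, decay p x).toNNReal, (ENNReal.coe_toNNReal (lintegral_decay_lt_top hp).ne).ge⟩

theorem half_rpow_neg (p : ℝ) {y : ℝ} (hy : 0 ≤ y) : (y / 2) ^ (-p) = 2 ^ p * y ^ (-p) := by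
  rw [Real.div_rpow hy (by norm_num), Real.rpow_neg (by norm_num : (0 : ℝ) ≤ 2) p, div_inv_eq_mul,
    mul_comm]

/-- One of `|a|`, `|b|` is at least `|a + b| / 2`, and the profile at that point is controlled by
the profile at `a + b`. -/
theorem decay_mul_decay_le {p : ℝ} (hp : 0 ≤ p) (a b : ℝ) :
    decay p a * decay p b ≤ ENNReal.ofReal (2 ^ p) * decay p (a + b) * (decay p a + decay p b) := by
  wlog h : |b| ≤ |a| generalizing a b
  · have := this b a (by linarith)
    rwa [mul_comm, add_comm a, add_comm (decay p a)]
  have h1 : decay p a ≤ ENNReal.ofReal (2 ^ p) * decay p (a + b) := by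
    rw [decay, decay, ← ENNReal.ofReal_mul (by positivity)]
    refine ENNReal.ofReal_le_ofReal ?_
    have h2 : (1 + |a + b|) / 2 ≤ 1 + |a| := by
      have := abs_add_le a b
      linarith [abs_nonneg a]
    calc (1 + |a|) ^ (-p) ≤ ((1 + |a + b|) / 2) ^ (-p) :=
          Real.rpow_le_rpow_of_nonpos (by positivity) h2 (by linarith)
      _ = 2 ^ p * (1 + |a + b|) ^ (-p) := half_rpow_neg p (by positivity)
  gcongr
  exact le_add_self

/-- Used to eliminate the `τ` integral: the profiles of two modulations merge into one profile at
their sum, with no loss in the exponent. -/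
theorem exists_lintegral_decay_mul_le {p : ℝ} (hp : 1 < p) :
    ∃ C : ℝ≥0, ∀ x y : ℝ, ∫⁻ t, decay p (x - t) * decay p (t - y) ≤ C * decay p (x - y) := by
  obtain ⟨C, hC⟩ := exists_lintegral_decay_le hp
  have hm := measurable_decay p
  refine ⟨Real.toNNReal (2 ^ p) * (C + C), fun x y => ?_⟩
  calc ∫⁻ t, decay p (x - t) * decay p (t - y)
      ≤ ∫⁻ t, ENNReal.ofReal (2 ^ p) * decay p (x - y) * (decay p (x - t) + decay p (t - y)) := by
        refine lintegral_mono fun t => ?_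
        simpa using decay_mul_decay_le (by linarith : 0 ≤ p) (x - t) (t - y)
    _ = ENNReal.ofReal (2 ^ p) * decay p (x - y) * ((∫⁻ t, decay p t) + ∫⁻ t, decay p t) := by
        rw [lintegral_const_mul _ (by fun_prop), lintegral_add_left (by fun_prop),
          lintegral_sub_left_eq_self, lintegral_sub_right_eq_self]
    _ ≤ ENNReal.ofReal (2 ^ p) * decay p (x - y) * (C + C) := by gcongr
    _ = _ := by
      push_cast
      rw [ENNReal.ofReal]
      ring

/-- Change of variables for an injective substitution. -/
theorem lintegral_decay_comp_le {p c : ℝ} {S : Set ℝ} (hS : MeasurableSet S) {ψ ψ' : ℝ → ℝ}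
    (hψ : ∀ x ∈ S, HasDerivWithinAt ψ (ψ' x) S x) (hinj : Set.InjOn ψ S) :
    ∫⁻ x in S, ENNReal.ofReal |ψ' x| * decay p (c - ψ x) ≤ ∫⁻ x, decay p x := by
  rw [← lintegral_image_eq_lintegral_abs_deriv_mul hS hψ hinj (fun y => decay p (c - y))]
  refine (setLIntegral_le_lintegral _ _).trans (le_of_eq ?_)
  exact lintegral_sub_left_eq_self (decay p) c

theorem lintegral_comp_mul_sub (f : ℝ → ℝ≥0∞) {a : ℝ} (ha : 0 < a) (b : ℝ) :
    ∫⁻ x, f (a * (x - b)) = ENNReal.ofReal a⁻¹ * ∫⁻ x, f x := by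
  have h := lintegral_image_eq_lintegral_abs_deriv_mul (s := Set.univ) (f := fun x => a * (x - b))
    (f' := fun _ => a) MeasurableSet.univ
    (fun x _ => by simpa using ((hasDerivAt_id x).sub_const b).const_mul a)
    (fun x _ y _ hxy => by simpa using mul_left_cancel₀ ha.ne' hxy) f
  have himg : (fun x => a * (x - b)) '' Set.univ = Set.univ := by
    rw [Set.image_univ, Set.range_eq_univ]
    intro y
    exact ⟨y / a + b, by field_simp; ring⟩
  simp only [himg, Measure.restrict_univ, abs_of_pos ha] at h
  rw [h, lintegral_const_mul' _ _ ENNReal.ofReal_ne_top, ← mul_assoc,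
    ← ENNReal.ofReal_mul (by positivity), inv_mul_cancel₀ ha.ne', ENNReal.ofReal_one, one_mul]

/-- For `T ≥ 0` one factors `T - x² = (√T - |x|)(√T + |x|)`; the second factor dominates each of
`||x| - √T|`, `√T` and `|x|`, which yields this bound and the next two. For `T ≤ 0` the root has the
default value `0`, and `|T - x²| = |T| + x²` is bounded below directly. -/
theorem abs_sub_sq_ge_sq (T x : ℝ) : (|x| - √T) ^ 2 ≤ |T - x ^ 2| := by
  rcases le_total 0 T with h | h
  · have h1 : T - x ^ 2 = (√T - |x|) * (√T + |x|) := by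
      nlinarith [Real.sq_sqrt h, sq_abs x]
    rw [h1, abs_mul, ← sq_abs, abs_sub_comm, sq]
    refine mul_le_mul_of_nonneg_left ?_ (abs_nonneg _)
    rw [abs_of_nonneg (by positivity : 0 ≤ √T + |x|), abs_le]
    constructor <;> nlinarith [abs_nonneg x, Real.sqrt_nonneg T]
  · rw [Real.sqrt_eq_zero_of_nonpos h, sub_zero, sq_abs, abs_of_nonpos (by nlinarith [sq_nonneg x])]
    linarith

theorem abs_sub_sq_ge_mul (T x : ℝ) : √|T| * |(|x| - √T)| ≤ |T - x ^ 2| := by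
  rcases le_total 0 T with h | h
  · have h1 : T - x ^ 2 = (√T - |x|) * (√T + |x|) := by
      nlinarith [Real.sq_sqrt h, sq_abs x]
    rw [h1, abs_mul, abs_of_nonneg h, abs_sub_comm, mul_comm]
    refine mul_le_mul_of_nonneg_left ?_ (abs_nonneg _)
    rw [abs_of_nonneg (by positivity : 0 ≤ √T + |x|)]
    linarith [abs_nonneg x]
  · rw [Real.sqrt_eq_zero_of_nonpos h, sub_zero, abs_abs,
      abs_of_nonpos (by nlinarith [sq_nonneg x] : T - x ^ 2 ≤ 0), abs_of_nonpos h]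
    have := Real.sq_sqrt (by linarith : 0 ≤ -T)
    nlinarith [sq_nonneg (√(-T) - |x|), sq_abs x, Real.sqrt_nonneg (-T), abs_nonneg x]

theorem abs_sub_sq_ge_abs_mul (T x : ℝ) : |x| * |(|x| - √T)| ≤ |T - x ^ 2| := by
  rcases le_total 0 T with h | h
  · have h1 : T - x ^ 2 = (√T - |x|) * (√T + |x|) := by
      nlinarith [Real.sq_sqrt h, sq_abs x]
    rw [h1, abs_mul, abs_sub_comm, mul_comm]
    refine mul_le_mul_of_nonneg_left ?_ (abs_nonneg _)
    rw [abs_of_nonneg (by positivity : 0 ≤ √T + |x|)]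
    linarith [Real.sqrt_nonneg T]
  · rw [Real.sqrt_eq_zero_of_nonpos h, sub_zero, abs_abs,
      abs_of_nonpos (by nlinarith [sq_nonneg x] : T - x ^ 2 ≤ 0)]
    nlinarith [sq_abs x]

theorem decay_abs_sub_le (p a x s : ℝ) :
    decay p (a * (|x| - s)) ≤ decay p (a * (x - s)) + decay p (a * (x - -s)) := by
  rcases abs_cases x with ⟨h, -⟩ | ⟨h, -⟩ <;> rw [h]
  · exact le_self_add
  · refine le_trans (le_of_eq ?_) le_add_self
    rw [← decay_neg]
    congr 1
    ring

/-- The integral of the profile along a parabola. -/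
theorem exists_lintegral_decay_parabola_le {p : ℝ} (hp : 1 < p) :
    ∃ C : ℝ≥0, (∀ T : ℝ, ∫⁻ x, decay p (T - x ^ 2) ≤ C) ∧
      ∀ T θ t : ℝ, 0 ≤ θ → θ ≤ 1 / 2 → 0 < t → t ≤ |T| →
        ∫⁻ x, decay p (T - x ^ 2) ≤ C * ENNReal.ofReal (t ^ (-θ)) := by
  obtain ⟨C, hC⟩ := exists_lintegral_decay_le hp
  have hp0 : 0 ≤ p := by linarith
  have hm := measurable_decay p
  have hsum : ∀ a s : ℝ, 0 < a → ∫⁻ x, decay p (a * (|x| - s)) ≤ ENNReal.ofReal a⁻¹ * (C + C) := by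
    intro a s ha
    calc ∫⁻ x, decay p (a * (|x| - s))
        ≤ ∫⁻ x, (decay p (a * (x - s)) + decay p (a * (x - -s))) :=
          lintegral_mono fun x => decay_abs_sub_le p a x s
      _ ≤ ENNReal.ofReal a⁻¹ * C + ENNReal.ofReal a⁻¹ * C := by
          rw [lintegral_add_left (by fun_prop)]
          gcongr
          · rw [lintegral_comp_mul_sub (decay p) ha s]; gcongr
          · rw [lintegral_comp_mul_sub (decay p) ha (-s)]; gcongr
      _ = _ := by rw [mul_add]
  have h1 : ∀ T : ℝ, ∫⁻ x, decay p (T - x ^ 2) ≤ ENNReal.ofReal (2 ^ p) * (C + C) := by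
    intro T
    calc ∫⁻ x, decay p (T - x ^ 2) ≤ ∫⁻ x, ENNReal.ofReal (2 ^ p) * decay p (1 * (|x| - √T)) := by
          refine lintegral_mono fun x => ?_
          rw [decay, decay, ← ENNReal.ofReal_mul (by positivity)]
          refine ENNReal.ofReal_le_ofReal ?_
          set y := |x| - √T
          have h2 : (1 + |1 * y|) / 2 ≤ 1 + |T - x ^ 2| := by
            have := abs_sub_sq_ge_sq T x
            rw [one_mul]
            nlinarith [sq_nonneg (|y| - 1), sq_abs y]
          calc (1 + |T - x ^ 2|) ^ (-p) ≤ ((1 + |1 * y|) / 2) ^ (-p) :=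
                Real.rpow_le_rpow_of_nonpos (by positivity) h2 (by linarith)
            _ = 2 ^ p * (1 + |1 * y|) ^ (-p) := half_rpow_neg p (by positivity)
      _ ≤ _ := by
          rw [lintegral_const_mul _ (by fun_prop)]
          gcongr
          simpa using hsum 1 (√T) one_pos
  have h2 : ∀ T : ℝ, T ≠ 0 →
      ∫⁻ x, decay p (T - x ^ 2) ≤ ENNReal.ofReal (|T| ^ (-(1 / 2) : ℝ)) * (C + C) := by
    intro T hT
    have hT' : 0 < √|T| := Real.sqrt_pos.2 (abs_pos.2 hT)
    calc ∫⁻ x, decay p (T - x ^ 2) ≤ ∫⁻ x, decay p (√|T| * (|x| - √T)) := by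
          refine lintegral_mono fun x => decay_anti hp0 ?_
          rw [abs_mul, abs_of_pos hT']
          exact abs_sub_sq_ge_mul T x
      _ ≤ _ := hsum _ _ hT'
      _ = _ := by rw [Real.rpow_neg (abs_nonneg _), Real.sqrt_eq_rpow]
  refine ⟨Real.toNNReal (2 ^ p) * (C + C), fun T => by push_cast; exact h1 T,
    fun T θ t hθ hθ' ht htT => ?_⟩
  have hT : T ≠ 0 := abs_pos.1 (ht.trans_le htT)
  have h2p : (1 : ℝ) ≤ 2 ^ p := Real.one_le_rpow (by norm_num) hp0
  push_cast
  -- For `t ≤ 1` the uniform bound suffices because `t ^ (-θ) ≥ 1`. For `t ≥ 1` the full decay `|T|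
  -- ^ (-1/2)` is stronger than `t ^ (-θ)`.
  rcases le_total t 1 with h | h
  · calc _ ≤ ENNReal.ofReal (2 ^ p) * (C + C) * 1 := by simpa using h1 T
      _ ≤ _ := by
        gcongr
        · exact le_rfl
        · rw [ENNReal.one_le_ofReal]
          exact Real.one_le_rpow_of_pos_of_le_one_of_nonpos ht h (by linarith)
  · calc _ ≤ 1 * (C + C) * ENNReal.ofReal (|T| ^ (-(1 / 2) : ℝ)) := by
          rw [one_mul, mul_comm]
          exact h2 T hT
      _ ≤ _ := by
        gcongr
        · exact ENNReal.one_le_ofReal.2 h2p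
        · calc |T| ^ (-(1 / 2) : ℝ) ≤ t ^ (-(1 / 2) : ℝ) :=
                Real.rpow_le_rpow_of_nonpos ht htT (by norm_num)
            _ ≤ t ^ (-θ) := Real.rpow_le_rpow_of_exponent_le h (by linarith)

end Decay

/-! ### Weakly singular integrals and kernel bounds on the characteristic surface. -/

section Kernels

theorem lintegral_abs_rpow_lt_top {s : ℝ} (hs1 : s < 1) :
    ∫⁻ x, (Set.Icc (-1 : ℝ) 1).indicator (fun x => ENNReal.ofReal (|x| ^ (-s))) x < ∞ := by
  have h1 : IntegrableOn (fun x : ℝ => x ^ (-s)) (Set.Ioc 0 1) := by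
    have := intervalIntegral.intervalIntegrable_rpow' (a := 0) (b := 1) (r := -s) (by linarith)
    rwa [intervalIntegrable_iff_integrableOn_Ioc_of_le zero_le_one] at this
  set f : ℝ → ℝ≥0∞ := (Set.Ioc (0 : ℝ) 1).indicator (fun x => ENNReal.ofReal (x ^ (-s)))
  have hf : Measurable f := by
    refine Measurable.indicator ?_ measurableSet_Ioc
    fun_prop
  have hfi : ∫⁻ x, f x < ∞ := by
    rw [lintegral_indicator measurableSet_Ioc]
    exact h1.lintegral_lt_top
  have hle : ∀ᵐ x : ℝ, (Set.Icc (-1 : ℝ) 1).indicator (fun x => ENNReal.ofReal (|x| ^ (-s))) x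
      ≤ f x + f (-x) := by
    have : ∀ᵐ x : ℝ, x ≠ 0 := compl_mem_ae_iff.2 (measure_singleton 0)
    filter_upwards [this] with x hx
    by_cases hx1 : x ∈ Set.Icc (-1 : ℝ) 1
    · rw [Set.indicator_of_mem hx1]
      rcases lt_or_gt_of_ne hx with h | h
      · refine le_trans (le_of_eq ?_) le_add_self
        have : -x ∈ Set.Ioc (0 : ℝ) 1 := ⟨by linarith, by linarith [hx1.1]⟩
        simp only [f, Set.indicator_of_mem this, abs_of_neg h]
      · refine le_trans (le_of_eq ?_) le_self_add
        have : x ∈ Set.Ioc (0 : ℝ) 1 := ⟨h, hx1.2⟩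
        simp only [f, Set.indicator_of_mem this, abs_of_pos h]
    · rw [Set.indicator_of_notMem hx1]
      exact zero_le
  refine (lintegral_mono_ae hle).trans_lt ?_
  rw [lintegral_add_left hf, lintegral_neg_eq_self]
  exact ENNReal.add_lt_top.2 ⟨hfi, hfi⟩

/-- A weakly singular integral, uniformly in the position of the singularity. -/
theorem exists_lintegral_singular_le {a s : ℝ} (ha : 0 ≤ a) (hs : 0 ≤ s) (hs1 : s < 1)
    (has : 1 < a + s) :
    ∃ C : ℝ≥0, ∀ c : ℝ, ∫⁻ x, ENNReal.ofReal ((1 + |x|) ^ (-a) * |x - c| ^ (-s)) ≤ C := by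
  set g : ℝ → ℝ≥0∞ := (Set.Icc (-1 : ℝ) 1).indicator (fun x => ENNReal.ofReal (|x| ^ (-s)))
  have hg : Measurable g := by
    refine Measurable.indicator ?_ measurableSet_Icc
    fun_prop
  have hm := measurable_decay (a + s)
  set B : ℝ≥0∞ := (∫⁻ x, g x)
    + ENNReal.ofReal (2 ^ s) * ((∫⁻ x, decay (a + s) x) + ∫⁻ x, decay (a + s) x)
  have hB : B < ∞ := by
    have := lintegral_decay_lt_top has
    refine ENNReal.add_lt_top.2 ⟨lintegral_abs_rpow_lt_top hs1, ENNReal.mul_lt_top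
      ENNReal.ofReal_lt_top (ENNReal.add_lt_top.2 ⟨this, this⟩)⟩
  refine ⟨B.toNNReal, fun c => ?_⟩
  rw [ENNReal.coe_toNNReal hB.ne]
  -- Within distance one of `c` the local integrability of the singularity is used. Farther away `|x
  -- - c|` is comparable to `1 + |x - c|`, and the product of powers is at most the power `-(a + s)`
  -- of the smaller bracket, which is integrable.
  have hle : ∀ x, ENNReal.ofReal ((1 + |x|) ^ (-a) * |x - c| ^ (-s))
      ≤ g (x - c) + ENNReal.ofReal (2 ^ s) * (decay (a + s) x + decay (a + s) (x - c)) := by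
    intro x
    by_cases h : x - c ∈ Set.Icc (-1 : ℝ) 1
    · refine le_trans ?_ le_self_add
      simp only [g, Set.indicator_of_mem h]
      refine ENNReal.ofReal_le_ofReal (mul_le_of_le_one_left (by positivity) ?_)
      exact Real.rpow_le_one_of_one_le_of_nonpos (by linarith [abs_nonneg x]) (by linarith)
    · refine le_trans ?_ le_add_self
      rw [decay, decay, ← ENNReal.ofReal_add (by positivity) (by positivity),
        ← ENNReal.ofReal_mul (by positivity)]
      refine ENNReal.ofReal_le_ofReal ?_
      have h1 : 1 ≤ |x - c| := by
        by_contra h2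
        exact h (Set.mem_Icc.2 (abs_le.1 (not_le.1 h2).le))
      have h2 : |x - c| ^ (-s) ≤ 2 ^ s * (1 + |x - c|) ^ (-s) := by
        rw [← half_rpow_neg s (by positivity)]
        exact Real.rpow_le_rpow_of_nonpos (by positivity) (by linarith) (by linarith)
      set u := 1 + |x|
      set v := 1 + |x - c|
      have hu : 0 < u := by positivity
      have hv : 0 < v := by positivity
      have h3 : u ^ (-a) * v ^ (-s) ≤ u ^ (-(a + s)) + v ^ (-(a + s)) := by
        rcases le_total u v with huv | huv
        · have : v ^ (-s) ≤ u ^ (-s) := Real.rpow_le_rpow_of_nonpos hu huv (by linarith)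
          calc u ^ (-a) * v ^ (-s) ≤ u ^ (-a) * u ^ (-s) := by gcongr
            _ = u ^ (-(a + s)) := by rw [← Real.rpow_add hu]; congr 1; ring
            _ ≤ _ := le_add_of_nonneg_right (by positivity)
        · have : u ^ (-a) ≤ v ^ (-a) := Real.rpow_le_rpow_of_nonpos hv huv (by linarith)
          calc u ^ (-a) * v ^ (-s) ≤ v ^ (-a) * v ^ (-s) := by gcongr
            _ = v ^ (-(a + s)) := by rw [← Real.rpow_add hv]; congr 1; ring
            _ ≤ _ := le_add_of_nonneg_left (by positivity)
      calc u ^ (-a) * |x - c| ^ (-s) ≤ u ^ (-a) * (2 ^ s * v ^ (-s)) := by gcongr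
        _ = 2 ^ s * (u ^ (-a) * v ^ (-s)) := by ring
        _ ≤ _ := by gcongr
  refine (lintegral_mono hle).trans (le_of_eq ?_)
  rw [lintegral_add_left (by fun_prop), lintegral_const_mul _ (by fun_prop),
    lintegral_add_left hm, lintegral_sub_right_eq_self, lintegral_sub_right_eq_self]

/-- Integration in the modulation variable. -/
theorem exists_lintegral_pair_le {p : ℝ} (hp : 1 < p) :
    ∃ C : ℝ≥0, ∀ (m : ℝ → ℝ → ℝ≥0∞) (k η τ : ℝ),
      ∫⁻ k₂, ∫⁻ η₂, ∫⁻ τ₂, m k₂ η₂ * (decay p (τ - τ₂ - phase (k - k₂) (η - η₂))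
          * decay p (τ₂ - phase k₂ η₂))
        ≤ C * ∫⁻ k₂, ∫⁻ η₂, m k₂ η₂ * decay p (τ - (phase (k - k₂) (η - η₂) + phase k₂ η₂)) := by
  obtain ⟨C, hC⟩ := exists_lintegral_decay_mul_le hp
  have hm := measurable_decay p
  refine ⟨C, fun m k η τ => ?_⟩
  rw [← lintegral_const_mul' _ _ ENNReal.coe_ne_top]
  refine lintegral_mono fun k₂ => ?_
  rw [← lintegral_const_mul' _ _ ENNReal.coe_ne_top]
  refine lintegral_mono fun η₂ => ?_
  rw [lintegral_const_mul _ (by fun_prop)]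
  calc _ ≤ m k₂ η₂ * (C * decay p (τ - phase (k - k₂) (η - η₂) - phase k₂ η₂)) := by
        gcongr
        refine le_trans (le_of_eq ?_) (hC _ _)
        congr 1 with τ₂
        congr 2
        ring
    _ = _ := by
        rw [mul_left_comm, sub_sub]

/-- For fixed `k₁`, `k₂` the derivative of the phase sum in the `η` variable is twice the velocity
difference `q`, and its divided difference is `q x + q y`. The phase sum is therefore injective on
each of `q > 0` and `q < 0`, and each set contributes one integral of the profile. -/
theorem lintegral_transversal_le (p c k₁ k₂ η : ℝ) (h₁ : k₁ ≠ 0) (h₂ : k₂ ≠ 0) :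
    ∫⁻ x, ENNReal.ofReal |k₁⁻¹ * (η - x) - k₂⁻¹ * x| * decay p (c - (phase k₁ (η - x) + phase k₂ x))
      ≤ 2 * ∫⁻ x, decay p x := by
  set q : ℝ → ℝ := fun x => k₁⁻¹ * (η - x) - k₂⁻¹ * x
  set Ψ : ℝ → ℝ := fun x => phase k₁ (η - x) + phase k₂ x
  have hq : Measurable q := by fun_prop
  have hder : ∀ x, HasDerivAt Ψ (2 * q x) x := by
    intro x
    have e1 : HasDerivAt (fun x => η - x) (-1) x := by
      simpa using (hasDerivAt_id x).const_sub η
    have h := (((e1.pow 2).div_const k₁).const_sub (k₁ ^ 3)).add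
      ((((hasDerivAt_id x).pow 2).div_const k₂).const_sub (k₂ ^ 3))
    refine h.congr_deriv ?_
    simp only [q, id]
    push_cast
    field_simp
    ring
  have hdiff : ∀ x y, Ψ x - Ψ y = (x - y) * (q x + q y) := by
    intro x y
    simp only [Ψ, q, phase]
    field_simp
    ring
  have hpos : ∀ S : Set ℝ, MeasurableSet S → (∀ x ∈ S, ∀ y ∈ S, q x + q y ≠ 0) →
      ∫⁻ x in S, ENNReal.ofReal |q x| * decay p (c - Ψ x) ≤ ∫⁻ x, decay p x := by
    intro S hS hSq
    refine le_trans ?_ (lintegral_decay_comp_le (c := c) hS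
      (fun x _ => (hder x).hasDerivWithinAt) ?_)
    · refine lintegral_mono fun x => ?_
      refine mul_le_mul' (ENNReal.ofReal_le_ofReal ?_) le_rfl
      rw [abs_mul, abs_two]
      linarith [abs_nonneg (q x)]
    · intro x hx y hy hxy
      have := hdiff x y
      rw [hxy, sub_self] at this
      rcases mul_eq_zero.1 this.symm with h | h
      · linarith
      · exact absurd h (hSq x hx y hy)
  have hS1 : MeasurableSet {x | 0 < q x} := measurableSet_lt measurable_const hq
  have hS2 : MeasurableSet {x | q x < 0} := measurableSet_lt hq measurable_const
  have b1 := hpos _ hS1 fun x hx y hy => (add_pos hx hy).ne'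
  have b2 := hpos _ hS2 fun x hx y hy => (add_neg hx hy).ne
  rw [two_mul]
  refine le_trans ?_ (add_le_add b1 b2)
  rw [← lintegral_indicator hS1, ← lintegral_indicator hS2, ← lintegral_add_left]
  · refine lintegral_mono fun x => ?_
    change ENNReal.ofReal |q x| * decay p (c - Ψ x) ≤ _
    rcases lt_trichotomy (q x) 0 with h | h | h
    · rw [Set.indicator_of_notMem (by simp; linarith), Set.indicator_of_mem (by simpa using h),
        zero_add]
    · simp [h]
    · rw [Set.indicator_of_mem (by simpa using h)]
      exact le_self_add
  · refine Measurable.indicator ?_ hS1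
    have hm := measurable_decay p
    have : Measurable Ψ := by simp only [Ψ, phase]; fun_prop
    fun_prop

/-- The bilinear kernel bound with transversality in the `y` direction. -/
theorem exists_lintegral_transversal_le {p δ : ℝ} (hp : 1 < p) (hδ : 0 < δ) :
    ∃ C : ℝ≥0, ∀ k η τ : ℝ,
      ∫⁻ k₂, ∫⁻ η₂, ENNReal.ofReal (|(k - k₂)⁻¹ * (η - η₂) - k₂⁻¹ * η₂| * (1 + |k₂|) ^ (-(1 + δ)))
          * decay p (τ - (phase (k - k₂) (η - η₂) + phase k₂ η₂)) ≤ C := by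
  obtain ⟨C, hC⟩ := exists_lintegral_decay_le hp
  obtain ⟨D, hD⟩ := exists_lintegral_decay_le (p := 1 + δ) (by linarith)
  refine ⟨D * (2 * C), fun k η τ => ?_⟩
  calc _ ≤ ∫⁻ k₂, decay (1 + δ) k₂ * (2 * C) := by
        have h0 : ∀ᵐ x : ℝ, x ≠ 0 := compl_mem_ae_iff.2 (measure_singleton 0)
        have hk : ∀ᵐ x : ℝ, x ≠ k := compl_mem_ae_iff.2 (measure_singleton k)
        refine lintegral_mono_ae ?_
        filter_upwards [h0, hk] with k₂ h0 hk
        simp only [mul_comm |_|]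
        simp only [ENNReal.ofReal_mul (by positivity : 0 ≤ (1 + |k₂|) ^ (-(1 + δ))), mul_assoc]
        rw [lintegral_const_mul' _ _ ENNReal.ofReal_ne_top]
        refine mul_le_mul' le_rfl ?_
        exact (lintegral_transversal_le p τ (k - k₂) k₂ η (sub_ne_zero.2 hk.symm) h0).trans
          (by gcongr)
    _ ≤ _ := by
        rw [lintegral_mul_const _ (measurable_decay _)]
        push_cast
        gcongr

theorem abs_add_abs_le_abs_sub {x y : ℝ} (h : x * y ≤ 0) : |x| + |y| ≤ |x - y| := by
  rw [← sq_le_sq₀ (by positivity) (abs_nonneg _), sq_abs, add_sq, sq_abs, sq_abs, mul_assoc,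
    ← abs_mul, abs_of_nonpos h]
  apply le_of_eq
  ring

/-- For fixed `η` frequencies the derivative of the phase sum is the difference of `3x² + e²/x²` and
`3(k-x)² + e'²/(k-x)²`. On the indicated set the first expression is a small fraction of `(k-x)²`,
while the KP-II sign makes the `e'` term only help. The derivative is thus at least `(k-x)²` in
modulus for every `e'`. The divided difference has the same structure, whence injectivity on each
half-line. -/
theorem lintegral_fast_le (p c k e e' : ℝ) :
    ∫⁻ x, {x : ℝ | x ≠ 0 ∧ 4 * (|x| + |x⁻¹ * e|) ≤ |k - x|}.indicator
        (fun x => ENNReal.ofReal ((k - x) ^ 2) * decay p (c - (phase (k - x) e' + phase x e))) x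
      ≤ 2 * ∫⁻ x, decay p x := by
  set Ψ : ℝ → ℝ := fun x => phase (k - x) e' + phase x e
  have hder : ∀ x, x ≠ 0 → k - x ≠ 0 → HasDerivAt Ψ
      ((3 * x ^ 2 + e ^ 2 / x ^ 2) - (3 * (k - x) ^ 2 + e' ^ 2 / (k - x) ^ 2)) x := by
    intro x hx hkx
    have e1 : HasDerivAt (fun x => k - x) (-1) x := by
      simpa using (hasDerivAt_id x).const_sub k
    have h := ((e1.pow 3).sub ((hasDerivAt_const x (e' ^ 2)).div e1 hkx)).add
      (((hasDerivAt_id x).pow 3).sub ((hasDerivAt_const x (e ^ 2)).div (hasDerivAt_id x) hx))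
    refine h.congr_deriv ?_
    simp only [id]
    push_cast
    field_simp
    ring
  have hne : ∀ x, x ≠ 0 → 4 * (|x| + |x⁻¹ * e|) ≤ |k - x| → k - x ≠ 0 := by
    intro x hx h h0
    rw [h0, abs_zero] at h
    have := abs_pos.2 hx
    linarith [abs_nonneg (x⁻¹ * e)]
  have hdiff : ∀ x y, x ≠ 0 → y ≠ 0 → k - x ≠ 0 → k - y ≠ 0 → Ψ x - Ψ y
      = (x - y) * ((x ^ 2 + x * y + y ^ 2 + (x⁻¹ * e) * (y⁻¹ * e))
        - ((k - x) ^ 2 + (k - x) * (k - y) + (k - y) ^ 2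
          + ((k - x)⁻¹ * e') * ((k - y)⁻¹ * e'))) := by
    intro x y hx hy hkx hky
    simp only [Ψ, phase]
    field_simp
    ring
  have hinj : ∀ x y, 0 < x * y → 4 * (|x| + |x⁻¹ * e|) ≤ |k - x| →
      4 * (|y| + |y⁻¹ * e|) ≤ |k - y| → Ψ x = Ψ y → x = y := by
    intro x y hxy h1 h2 hΨ
    have hx : x ≠ 0 := left_ne_zero_of_mul hxy.ne'
    have hy : y ≠ 0 := right_ne_zero_of_mul hxy.ne'
    have hkx := hne x hx h1
    have hky := hne y hy h2
    have hd := hdiff x y hx hy hkx hky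
    rw [hΨ, sub_self] at hd
    rcases mul_eq_zero.1 hd.symm with h | h
    · linarith
    exfalso
    set X := k - x
    set Y := k - y
    set a := x⁻¹ * e
    set b := y⁻¹ * e
    -- Opposite signs of `X` and `Y` would give `|X| + |Y| ≤ |X - Y| = |x - y| ≤ |x| + |y|`, against
    -- the dominance by a factor 4.
    have hXY : 0 < X * Y := by
      by_contra hneg
      have hX := abs_pos.2 hx
      have hY := abs_pos.2 hy
      have e1 : X - Y = y - x := by simp only [X, Y]; ring
      have h3 := abs_add_abs_le_abs_sub (not_lt.1 hneg)
      have h4 : |y - x| ≤ |x| + |y| := by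
        have := abs_sub y x
        linarith
      rw [e1] at h3
      linarith [abs_nonneg a, abs_nonneg b]
    have hq : 0 ≤ (X⁻¹ * e') * (Y⁻¹ * e') := by
      have : (X⁻¹ * e') * (Y⁻¹ * e') = e' ^ 2 / (X * Y) := by field_simp
      rw [this]
      positivity
    have ha : |x| + |a| ≤ |X| / 4 := by linarith
    have hb : |y| + |b| ≤ |Y| / 4 := by linarith
    have hX0 := abs_pos.2 hkx
    have hY0 := abs_pos.2 hky
    have i1 : x ^ 2 ≤ X ^ 2 / 16 := by
      rw [← sq_abs x, ← sq_abs X]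
      nlinarith [abs_nonneg x, abs_nonneg a]
    have i2 : y ^ 2 ≤ Y ^ 2 / 16 := by
      rw [← sq_abs y, ← sq_abs Y]
      nlinarith [abs_nonneg y, abs_nonneg b]
    have hXYabs : |X| * |Y| = X * Y := by rw [← abs_mul, abs_of_pos hXY]
    have i3 : x * y ≤ X * Y / 16 := by
      have : x * y ≤ |x| * |y| := by rw [← abs_mul]; exact le_abs_self _
      have : |x| * |y| ≤ (|X| / 4) * (|Y| / 4) := by
        gcongr <;> linarith [abs_nonneg a, abs_nonneg b]
      nlinarith
    have i4 : a * b ≤ X * Y / 16 := by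
      have : a * b ≤ |a| * |b| := by rw [← abs_mul]; exact le_abs_self _
      have : |a| * |b| ≤ (|X| / 4) * (|Y| / 4) := by
        gcongr <;> linarith [abs_nonneg x, abs_nonneg y]
      nlinarith
    nlinarith [sq_nonneg X, sq_nonneg Y]
  have hpart : ∀ S : Set ℝ, MeasurableSet S →
      (∀ x ∈ S, x ≠ 0 ∧ 4 * (|x| + |x⁻¹ * e|) ≤ |k - x|) → (∀ x ∈ S, ∀ y ∈ S, 0 < x * y) →
      ∫⁻ x in S, ENNReal.ofReal ((k - x) ^ 2) * decay p (c - Ψ x) ≤ ∫⁻ x, decay p x := by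
    intro S hS hS1 hS2
    refine le_trans ?_ (lintegral_decay_comp_le (c := c) hS
      (fun x hx => (hder x (hS1 x hx).1 (hne x (hS1 x hx).1 (hS1 x hx).2)).hasDerivWithinAt) ?_)
    · refine setLIntegral_mono' hS fun x hx => ?_
      obtain ⟨hx0, h⟩ := hS1 x hx
      refine mul_le_mul' (ENNReal.ofReal_le_ofReal ?_) le_rfl
      have hX : |x| + |x⁻¹ * e| ≤ |k - x| / 4 := by linarith
      have i1 : x ^ 2 ≤ (k - x) ^ 2 / 16 := by
        rw [← sq_abs x, ← sq_abs (k - x)]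
        nlinarith [abs_nonneg x, abs_nonneg (x⁻¹ * e)]
      have i2 : e ^ 2 / x ^ 2 ≤ (k - x) ^ 2 / 16 := by
        have : e ^ 2 / x ^ 2 = (x⁻¹ * e) ^ 2 := by field_simp
        rw [this, ← sq_abs (x⁻¹ * e), ← sq_abs (k - x)]
        nlinarith [abs_nonneg x, abs_nonneg (x⁻¹ * e)]
      have i3 : 0 ≤ e' ^ 2 / (k - x) ^ 2 := by positivity
      rw [abs_sub_comm]
      refine le_trans ?_ (le_abs_self _)
      nlinarith [sq_nonneg (k - x)]
    · intro x hx y hy hxy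
      exact hinj x y (hS2 x hx y hy) (hS1 x hx).2 (hS1 y hy).2 hxy
  have hSm : MeasurableSet {x : ℝ | 4 * (|x| + |x⁻¹ * e|) ≤ |k - x|} :=
    measurableSet_le (by fun_prop) (by fun_prop)
  have hS1 : MeasurableSet ({x : ℝ | 4 * (|x| + |x⁻¹ * e|) ≤ |k - x|} ∩ Set.Ioi 0) :=
    hSm.inter measurableSet_Ioi
  have hS2 : MeasurableSet ({x : ℝ | 4 * (|x| + |x⁻¹ * e|) ≤ |k - x|} ∩ Set.Iio 0) :=
    hSm.inter measurableSet_Iio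
  have b1 := hpart _ hS1 (fun x hx => ⟨ne_of_gt hx.2, hx.1⟩) fun x hx y hy => mul_pos hx.2 hy.2
  have b2 := hpart _ hS2 (fun x hx => ⟨ne_of_lt hx.2, hx.1⟩)
    fun x hx y hy => mul_pos_of_neg_of_neg hx.2 hy.2
  rw [two_mul]
  refine le_trans ?_ (add_le_add b1 b2)
  rw [← lintegral_indicator hS1, ← lintegral_indicator hS2, ← lintegral_add_left]
  · refine lintegral_mono fun x => ?_
    by_cases hx : x ≠ 0 ∧ 4 * (|x| + |x⁻¹ * e|) ≤ |k - x|
    · rw [Set.indicator_of_mem (by exact hx)]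
      rcases lt_or_gt_of_ne hx.1 with h | h
      · refine le_trans (le_of_eq ?_) le_add_self
        rw [Set.indicator_of_mem (by exact ⟨hx.2, h⟩)]
      · refine le_trans (le_of_eq ?_) le_self_add
        rw [Set.indicator_of_mem (by exact ⟨hx.2, h⟩)]
    · rw [Set.indicator_of_notMem (by exact hx)]
      exact zero_le
  · refine Measurable.indicator ?_ hS1
    have hm := measurable_decay p
    have : Measurable Ψ := by simp only [Ψ, phase]; fun_prop
    fun_prop

theorem measurableSet_fast (k : ℝ) :
    MeasurableSet {x : ℝ × ℝ | x.1 ≠ 0 ∧ 4 * (|x.1| + |x.1⁻¹ * x.2|) ≤ |k - x.1|} := by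
  have h1 : MeasurableSet {x : ℝ × ℝ | x.1 ≠ 0} := measurable_fst (measurableSet_singleton 0).compl
  have h2 : MeasurableSet {x : ℝ × ℝ | 4 * (|x.1| + |x.1⁻¹ * x.2|) ≤ |k - x.1|} :=
    measurableSet_le (by fun_prop) (by fun_prop)
  exact h1.inter h2

/-- The bilinear kernel bound with smoothing in the `x` direction. -/
theorem exists_lintegral_fast_le {p : ℝ} (hp : 1 < p) :
    ∃ C : ℝ≥0, ∀ k η τ : ℝ,
      ∫⁻ k₂, ∫⁻ η₂, {x : ℝ × ℝ | x.1 ≠ 0 ∧ 4 * (|x.1| + |x.1⁻¹ * x.2|) ≤ |k - x.1|}.indicator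
          (fun x => ENNReal.ofReal ((k - x.1) ^ 2 * (1 + |x.2|) ^ (-2 : ℝ))) (k₂, η₂)
          * decay p (τ - (phase (k - k₂) (η - η₂) + phase k₂ η₂)) ≤ C := by
  obtain ⟨C, hC⟩ := exists_lintegral_decay_le hp
  obtain ⟨D, hD⟩ := exists_lintegral_decay_le (p := 2) (by norm_num)
  have hm := measurable_decay p
  refine ⟨D * (2 * C), fun k η τ => ?_⟩
  -- The change of variables takes place in `k₂` at fixed `η₂`; the weight `(1 + |η₂|) ^ (-2)` then
  -- makes the outer integral finite.
  rw [lintegral_lintegral_swap]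
  · calc _ ≤ ∫⁻ η₂, decay 2 η₂ * (2 * C) := by
          refine lintegral_mono fun η₂ => ?_
          refine le_trans (le_of_eq ?_) (mul_le_mul' le_rfl
            ((lintegral_fast_le p τ k η₂ (η - η₂)).trans (mul_le_mul' le_rfl hC)))
          rw [← lintegral_const_mul' _ _ (by simp [decay])]
          congr 1 with x
          simp only [Set.indicator_apply, Set.mem_ofPred_eq]
          split_ifs
          · rw [mul_comm ((k - x) ^ 2), ENNReal.ofReal_mul (by positivity), mul_assoc]
            rfl
          · simp
      _ ≤ _ := by
          rw [lintegral_mul_const _ (measurable_decay _)]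
          push_cast
          gcongr
  · refine Measurable.aemeasurable (Measurable.mul ?_ ?_)
    · exact Measurable.indicator (by fun_prop) (measurableSet_fast k)
    · simp only [phase]
      fun_prop

/-- Completion of the square in `x`. The term `3 k k₁ k₂` is the resonance function in `k`, and the
two corrections have the same sign. At fixed `k₂` the level sets of the phase are those of a
parabola. -/
theorem phase_add_phase {k k₂ : ℝ} (η x : ℝ) (h : k ≠ 0) (h₁ : k - k₂ ≠ 0) (h₂ : k₂ ≠ 0) :
    phase (k - k₂) (η - x) + phase k₂ x
      = phase k η - 3 * k * ((k - k₂) * k₂)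
        - k / ((k - k₂) * k₂) * (x - η * k₂ / k) ^ 2 := by
  simp only [phase]
  field_simp
  ring

/-- Integration in `η` for frequencies of equal sign. -/
theorem lintegral_decay_pair_eq (p τ : ℝ) {k k₂ : ℝ} (η : ℝ) (h₁ : 0 < k - k₂) (h₂ : 0 < k₂) :
    ∫⁻ x, decay p (τ - (phase (k - k₂) (η - x) + phase k₂ x))
      = ENNReal.ofReal √((k - k₂) * k₂ / k)
        * ∫⁻ x, decay p ((phase k η - τ - 3 * k * ((k - k₂) * k₂)) - x ^ 2) := by
  have hk : 0 < k := by linarith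
  set r := k / ((k - k₂) * k₂)
  have hr : 0 < r := by positivity
  have hinv : √((k - k₂) * k₂ / k) = (√r)⁻¹ := by
    rw [← Real.sqrt_inv]
    congr 1
    simp only [r, inv_div]
  rw [hinv, ← lintegral_comp_mul_sub _ (Real.sqrt_pos.2 hr) (η * k₂ / k)]
  congr 1 with x
  rw [← decay_neg]
  congr 1
  rw [phase_add_phase η x hk.ne' h₁.ne' h₂.ne', mul_pow, Real.sq_sqrt hr.le]
  ring

end Kernels

/-! ### The kernel of the refined Strichartz estimate for frequencies of equal sign. -/

section SameSign

theorem rpow_neg_abs_sub_le (s z c : ℝ) :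
    |(|z| - c)| ^ (-s) ≤ |z - c| ^ (-s) + |z - -c| ^ (-s) := by
  rcases abs_cases z with ⟨h, -⟩ | ⟨h, -⟩ <;> rw [h]
  · exact le_add_of_nonneg_right (by positivity)
  · refine le_trans (le_of_eq ?_) (le_add_of_nonneg_left (by positivity))
    rw [← abs_neg]
    congr 2
    ring

/-- The weight of the same-sign kernel after integration in `η`. -/
theorem sameSign_weight_le {δ k k₁ k₂ : ℝ} (hδ : 0 < δ) (hk : k = k₁ + k₂) (hk1 : 1 ≤ k)
    (h₁ : 0 < k₁) (h₂ : 0 < k₂) :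
    (1 + |k₁|) * (1 + |k₂|) ^ (-(1 + δ)) * √(k₁ * k₂ / k)
      ≤ 2 * k * (1 + min k₁ k₂) ^ (-(1 / 2 + δ)) := by
  rw [abs_of_pos h₁, abs_of_pos h₂]
  set m := min k₁ k₂
  have hm0 : 0 < m := lt_min h₁ h₂
  have hm2 : m ≤ k₂ := min_le_right _ _
  have e1 : 1 + k₁ ≤ 2 * k := by linarith
  have e2 : (1 + k₂) ^ (-(1 + δ)) ≤ (1 + m) ^ (-(1 + δ)) :=
    Real.rpow_le_rpow_of_nonpos (by positivity) (by linarith) (by linarith)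
  have e3 : k₁ * k₂ / k ≤ m := by
    rw [div_le_iff₀ (by linarith)]
    rcases le_total k₁ k₂ with h | h
    · rw [show m = k₁ from min_eq_left h]; nlinarith
    · rw [show m = k₂ from min_eq_right h]; nlinarith
  have e4 : √(k₁ * k₂ / k) ≤ (1 + m) ^ (1 / 2 : ℝ) := by
    rw [← Real.sqrt_eq_rpow]
    exact Real.sqrt_le_sqrt (by linarith)
  calc (1 + k₁) * (1 + k₂) ^ (-(1 + δ)) * √(k₁ * k₂ / k)
      ≤ 2 * k * (1 + m) ^ (-(1 + δ)) * (1 + m) ^ (1 / 2 : ℝ) := by gcongr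
    _ = _ := by
      rw [mul_assoc, ← Real.rpow_add (by positivity)]
      congr 2
      ring

/-- The bilinear kernel bound for frequencies of equal sign. -/
theorem exists_lintegral_sameSign_le {p δ : ℝ} (hp : 1 < p) (hδ : 0 < δ) (hδ1 : δ ≤ 1) :
    ∃ C : ℝ≥0, ∀ k η τ : ℝ,
      ∫⁻ k₂, ∫⁻ η₂, (Set.Icc 0 k).indicator
          (fun x => ENNReal.ofReal ((1 + |k - x|) * (1 + |x|) ^ (-(1 + δ)))) k₂
          * decay p (τ - (phase (k - k₂) (η - η₂) + phase k₂ η₂)) ≤ C := by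
  obtain ⟨J, hJ0, hJ⟩ := exists_lintegral_decay_parabola_le hp
  -- The exponents add up to `1 + δ` for separated frequencies and to `1 + δ/4` for comparable ones,
  -- so both integrals converge.
  obtain ⟨C₁, hC₁⟩ := exists_lintegral_singular_le (a := 1 / 2 + δ) (s := 1 / 2) (by linarith)
    (by norm_num) (by norm_num) (by linarith)
  obtain ⟨C₂, hC₂⟩ := exists_lintegral_singular_le (a := 3 * δ / 4) (s := 1 - δ / 2) (by linarith)
    (by linarith) (by linarith) (by linarith)
  have hm := measurable_decay p
  refine ⟨2 * J + J * (4 * (C₁ + C₁) + 64 * (C₂ + C₂)), fun k η τ => ?_⟩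
  have hne : ∀ a : ℝ, ∀ᵐ x : ℝ, x ≠ a := fun a => compl_mem_ae_iff.2 (measure_singleton a)
  set G : ℝ → ℝ≥0∞ := fun k₂ => ∫⁻ x, decay p ((phase k η - τ - 3 * k * ((k - k₂) * k₂)) - x ^ 2)
  -- reduction to an integral in `k₂`
  have hred : ∀ᵐ k₂ : ℝ, (∫⁻ η₂, (Set.Icc 0 k).indicator
          (fun x => ENNReal.ofReal ((1 + |k - x|) * (1 + |x|) ^ (-(1 + δ)))) k₂
          * decay p (τ - (phase (k - k₂) (η - η₂) + phase k₂ η₂)))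
        ≤ (Set.Ioo 0 k).indicator (fun x => ENNReal.ofReal ((1 + |k - x|) * (1 + |x|) ^ (-(1 + δ))
          * √((k - x) * x / k)) * G x) k₂ := by
    filter_upwards [hne 0, hne k] with k₂ h0 hk
    by_cases hmem : k₂ ∈ Set.Icc 0 k
    · have h1 : 0 < k₂ := lt_of_le_of_ne hmem.1 h0.symm
      have h2 : k₂ < k := lt_of_le_of_ne hmem.2 hk
      rw [Set.indicator_of_mem hmem, Set.indicator_of_mem (by exact ⟨h1, h2⟩),
        lintegral_const_mul' _ _ ENNReal.ofReal_ne_top,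
        lintegral_decay_pair_eq p τ η (sub_pos.2 h2) h1, ← mul_assoc,
        ← ENNReal.ofReal_mul (by positivity)]
    · simp [Set.indicator_of_notMem hmem]
  refine (lintegral_mono_ae hred).trans ?_
  rcases le_or_gt k 1 with hk1 | hk1
  · -- low frequencies
    push_cast
    refine le_trans ?_ le_self_add
    calc _ ≤ ∫⁻ x, (Set.Ioo (0 : ℝ) 1).indicator (fun _ => 2 * (J : ℝ≥0∞)) x := by
          refine lintegral_mono fun x => ?_
          by_cases hx : x ∈ Set.Ioo 0 k
          · have hk0 : 0 < k := hx.1.trans hx.2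
            rw [Set.indicator_of_mem hx, Set.indicator_of_mem (by exact ⟨hx.1, hx.2.trans_le hk1⟩)]
            refine mul_le_mul' ?_ (hJ0 _)
            rw [show (2 : ℝ≥0∞) = ENNReal.ofReal 2 by simp]
            refine ENNReal.ofReal_le_ofReal ?_
            have e1 : 1 + |k - x| ≤ 2 := by
              rw [abs_of_pos (by linarith [hx.2])]
              linarith [hx.1]
            have e2 : (1 + |x|) ^ (-(1 + δ)) ≤ 1 :=
              Real.rpow_le_one_of_one_le_of_nonpos (by linarith [abs_nonneg x]) (by linarith)
            have e3 : √((k - x) * x / k) ≤ 1 := by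
              rw [Real.sqrt_le_one, div_le_one hk0]
              nlinarith [hx.1, hx.2]
            calc _ ≤ 2 * 1 * 1 := by gcongr
              _ = (2 : ℝ) := by norm_num
          · rw [Set.indicator_of_notMem hx]
            exact zero_le
      _ = 2 * J := by
          rw [lintegral_indicator_const measurableSet_Ioo]
          simp
  · -- high frequencies
    have hk0 : 0 < k := by linarith
    -- Centred at `k/2`, the parameter of the parabola vanishes where `(x - k/2)² = c`. Below, `z =
    -- x - k/2`, and `y` is the distance from `|z|` to `√c`.
    set c := k ^ 2 / 4 - (phase k η - τ) / (3 * k)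
    set r := √c
    have hT : ∀ x, phase k η - τ - 3 * k * ((k - x) * x) = -(3 * k * (c - (x - k / 2) ^ 2)) := by
      intro x
      simp only [c]
      field_simp
      ring
    have hpt : ∀ᵐ x : ℝ, (Set.Ioo 0 k).indicator (fun x => ENNReal.ofReal ((1 + |k - x|)
          * (1 + |x|) ^ (-(1 + δ)) * √((k - x) * x / k)) * G x) x
        ≤ J * (4 * (ENNReal.ofReal ((1 + |x|) ^ (-(1 / 2 + δ)) * |x - (k / 2 - r)| ^ (-(1 / 2) : ℝ))
            + ENNReal.ofReal ((1 + |k - x|) ^ (-(1 / 2 + δ))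
              * |k - x - (k / 2 - r)| ^ (-(1 / 2) : ℝ)))
          + 64 * (ENNReal.ofReal ((1 + |x - k / 2|) ^ (-(3 * δ / 4))
              * |x - k / 2 - r| ^ (-(1 - δ / 2)))
            + ENNReal.ofReal ((1 + |x - k / 2|) ^ (-(3 * δ / 4))
              * |x - k / 2 - -r| ^ (-(1 - δ / 2))))) := by
      filter_upwards [hne (k / 2 + r), hne (k / 2 - r)] with x hx1 hx2
      by_cases hx : x ∈ Set.Ioo 0 k
      swap
      · rw [Set.indicator_of_notMem hx]
        exact zero_le
      rw [Set.indicator_of_mem hx]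
      have hw := sameSign_weight_le hδ (k := k) (k₁ := k - x) (k₂ := x) (by ring) hk1.le
        (by linarith [hx.2]) hx.1
      set m := min (k - x) x
      set z := x - k / 2
      set y := |(|z| - r)|
      have hmz : m = k / 2 - |z| := by
        rcases le_total (k - x) x with h | h
        · rw [show m = k - x from min_eq_left h, abs_of_nonneg (by simp only [z]; linarith)]
          simp only [z]; ring
        · rw [show m = x from min_eq_right h, abs_of_nonpos (by simp only [z]; linarith)]
          simp only [z]; ring
      have hm0 : 0 < m := lt_min (by linarith [hx.2]) hx.1
      have hy : 0 < y := by
        rw [abs_pos, sub_ne_zero]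
        intro h
        rcases abs_cases z with ⟨h', -⟩ | ⟨h', -⟩
        · exact hx1 (by simp only [z] at h h'; linarith)
        · exact hx2 (by simp only [z] at h h'; linarith)
      have hTabs : |phase k η - τ - 3 * k * ((k - x) * x)| = 3 * k * |c - z ^ 2| := by
        rw [hT, abs_neg, abs_mul, abs_of_pos (by positivity)]
      rcases le_or_gt (k / 4) |z| with hz | hz
      · -- separated frequencies
        -- The bound `|c - z²| ≥ |z| y ≥ k y / 4` makes the parabola integral of size `k⁻¹
        -- y^(-1/2)`, which cancels the factor `k` in the weight.
        have hG : G x ≤ J * ENNReal.ofReal ((3 * k * (k / 4 * y)) ^ (-(1 / 2) : ℝ)) := by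
          refine hJ _ _ _ (by norm_num) le_rfl (by positivity) ?_
          rw [hTabs]
          have := abs_sub_sq_ge_abs_mul c z
          have h2 : k / 4 * y ≤ |z| * y := by gcongr
          have h3 : k / 4 * y ≤ |c - z ^ 2| := h2.trans this
          gcongr
        have hreal : (1 + |k - x|) * (1 + |x|) ^ (-(1 + δ)) * √((k - x) * x / k)
            * (3 * k * (k / 4 * y)) ^ (-(1 / 2) : ℝ)
            ≤ 4 * ((1 + m) ^ (-(1 / 2 + δ)) * y ^ (-(1 / 2) : ℝ)) := by
          have e1 : (3 * k * (k / 4 * y)) ^ (-(1 / 2) : ℝ) ≤ 2 * (k⁻¹ * y ^ (-(1 / 2) : ℝ)) := by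
            have : (3 * k * (k / 4 * y)) ^ (-(1 / 2) : ℝ)
                ≤ ((k / 2) ^ 2 * y) ^ (-(1 / 2) : ℝ) := by
              refine Real.rpow_le_rpow_of_nonpos (by positivity) ?_ (by norm_num)
              nlinarith [mul_pos (mul_pos hk0 hk0) hy]
            refine this.trans (le_of_eq ?_)
            rw [Real.mul_rpow (by positivity) hy.le, Real.rpow_neg (by positivity),
              ← Real.sqrt_eq_rpow, Real.sqrt_sq (by positivity)]
            field_simp
          calc _ ≤ 2 * k * (1 + m) ^ (-(1 / 2 + δ)) * (2 * (k⁻¹ * y ^ (-(1 / 2) : ℝ))) := by gcongr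
            _ = _ := by field_simp; norm_num
        have hmain : ENNReal.ofReal ((1 + m) ^ (-(1 / 2 + δ)) * y ^ (-(1 / 2) : ℝ))
            ≤ ENNReal.ofReal ((1 + |x|) ^ (-(1 / 2 + δ)) * |x - (k / 2 - r)| ^ (-(1 / 2) : ℝ))
            + ENNReal.ofReal ((1 + |k - x|) ^ (-(1 / 2 + δ))
              * |k - x - (k / 2 - r)| ^ (-(1 / 2) : ℝ)) := by
          have hym : y = |m - (k / 2 - r)| := by
            rw [hmz, ← abs_neg (_ - _)]
            simp only [y]
            congr 1
            ring
          rcases le_total (k - x) x with h | h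
          · have : m = k - x := min_eq_left h
            refine le_trans (le_of_eq ?_) le_add_self
            rw [hym, this, abs_of_pos (by linarith [hx.2] : 0 < k - x)]
          · have : m = x := min_eq_right h
            refine le_trans (le_of_eq ?_) le_self_add
            rw [hym, this, abs_of_pos hx.1]
        calc _ ≤ ENNReal.ofReal ((1 + |k - x|) * (1 + |x|) ^ (-(1 + δ)) * √((k - x) * x / k))
              * (J * ENNReal.ofReal ((3 * k * (k / 4 * y)) ^ (-(1 / 2) : ℝ))) := by gcongr
          _ = J * ENNReal.ofReal ((1 + |k - x|) * (1 + |x|) ^ (-(1 + δ)) * √((k - x) * x / k)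
              * (3 * k * (k / 4 * y)) ^ (-(1 / 2) : ℝ)) := by
              rw [ENNReal.ofReal_mul (p := (1 + |k - x|) * (1 + |x|) ^ (-(1 + δ))
                * √((k - x) * x / k)) (by positivity)]
              ring
          _ ≤ J * (4 * ENNReal.ofReal ((1 + m) ^ (-(1 / 2 + δ)) * y ^ (-(1 / 2) : ℝ))) := by
              refine mul_le_mul' le_rfl ?_
              rw [show (4 : ℝ≥0∞) = ENNReal.ofReal 4 by simp, ← ENNReal.ofReal_mul (by norm_num)]
              exact ENNReal.ofReal_le_ofReal hreal
          _ ≤ _ := by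
              refine mul_le_mul' le_rfl (le_trans ?_ le_self_add)
              exact mul_le_mul' le_rfl hmain
      · -- comparable frequencies
        -- Only `|c - z²| ≥ y²` is available near `z = 0`. The exponent is taken below `1/2` because
        -- `y⁻¹` is not integrable; the loss is covered by `m ≥ k/4`, which gives the extra decay
        -- `k^(-δ)`.
        have hG : G x ≤ J * ENNReal.ofReal ((3 * k * y ^ 2) ^ (-(1 / 2 - δ / 4))) := by
          refine hJ _ _ _ (by linarith) (by linarith) (by positivity) ?_
          rw [hTabs]
          have := abs_sub_sq_ge_sq c z
          have h2 : y ^ 2 ≤ |c - z ^ 2| := by rwa [sq_abs]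
          gcongr
        have hreal : (1 + |k - x|) * (1 + |x|) ^ (-(1 + δ)) * √((k - x) * x / k)
            * (3 * k * y ^ 2) ^ (-(1 / 2 - δ / 4))
            ≤ 64 * ((1 + |z|) ^ (-(3 * δ / 4)) * y ^ (-(1 - δ / 2))) := by
          have e1 : (3 * k * y ^ 2) ^ (-(1 / 2 - δ / 4))
              ≤ k ^ (-(1 / 2 - δ / 4)) * y ^ (-(1 - δ / 2)) := by
            have : (3 * k * y ^ 2) ^ (-(1 / 2 - δ / 4)) ≤ (k * y ^ 2) ^ (-(1 / 2 - δ / 4)) := by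
              refine Real.rpow_le_rpow_of_nonpos (by positivity) ?_ (by linarith)
              nlinarith [mul_pos hk0 (pow_pos hy 2)]
            refine this.trans (le_of_eq ?_)
            rw [Real.mul_rpow hk0.le (by positivity), ← Real.rpow_natCast, ← Real.rpow_mul hy.le]
            congr 2
            push_cast
            ring
          have e2 : (1 + m) ^ (-(1 / 2 + δ)) ≤ 16 * k ^ (-(1 / 2 + δ)) := by
            have h1 : (1 + m) ^ (-(1 / 2 + δ)) ≤ (k / 4) ^ (-(1 / 2 + δ)) :=
              Real.rpow_le_rpow_of_nonpos (by positivity) (by linarith) (by linarith)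
            refine h1.trans ?_
            rw [Real.div_rpow hk0.le (by norm_num), Real.rpow_neg (by norm_num : (0 : ℝ) ≤ 4),
              div_inv_eq_mul, mul_comm]
            gcongr
            calc (4 : ℝ) ^ (1 / 2 + δ) ≤ 4 ^ (2 : ℝ) :=
                  Real.rpow_le_rpow_of_exponent_le (by norm_num) (by linarith)
              _ = 16 := by norm_num
          have e3 : k ^ (-(3 * δ / 4)) ≤ 2 * (1 + |z|) ^ (-(3 * δ / 4)) := by
            have h1 : k ^ (-(3 * δ / 4)) ≤ ((1 + |z|) / 2) ^ (-(3 * δ / 4)) :=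
              Real.rpow_le_rpow_of_nonpos (by positivity) (by linarith) (by linarith)
            refine h1.trans ?_
            rw [half_rpow_neg _ (by positivity)]
            gcongr
            calc (2 : ℝ) ^ (3 * δ / 4) ≤ 2 ^ (1 : ℝ) :=
                  Real.rpow_le_rpow_of_exponent_le (by norm_num) (by linarith)
              _ = 2 := by norm_num
          calc _ ≤ 2 * k * (16 * k ^ (-(1 / 2 + δ)))
                * (k ^ (-(1 / 2 - δ / 4)) * y ^ (-(1 - δ / 2))) := by
                refine mul_le_mul (hw.trans (by gcongr)) e1 (by positivity) (by positivity)
            _ = 32 * (k ^ (1 : ℝ) * k ^ (-(1 / 2 + δ)) * k ^ (-(1 / 2 - δ / 4)))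
                * y ^ (-(1 - δ / 2)) := by
                rw [Real.rpow_one]
                ring
            _ = 32 * k ^ (-(3 * δ / 4)) * y ^ (-(1 - δ / 2)) := by
                rw [← Real.rpow_add hk0, ← Real.rpow_add hk0]
                congr 3
                ring
            _ ≤ 32 * (2 * (1 + |z|) ^ (-(3 * δ / 4))) * y ^ (-(1 - δ / 2)) := by gcongr
            _ = _ := by ring
        have hmain : ENNReal.ofReal ((1 + |z|) ^ (-(3 * δ / 4)) * y ^ (-(1 - δ / 2)))
            ≤ ENNReal.ofReal ((1 + |z|) ^ (-(3 * δ / 4)) * |z - r| ^ (-(1 - δ / 2)))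
            + ENNReal.ofReal ((1 + |z|) ^ (-(3 * δ / 4)) * |z - -r| ^ (-(1 - δ / 2))) := by
          rw [← ENNReal.ofReal_add (by positivity) (by positivity), ← mul_add]
          refine ENNReal.ofReal_le_ofReal ?_
          gcongr
          exact rpow_neg_abs_sub_le _ _ _
        calc _ ≤ ENNReal.ofReal ((1 + |k - x|) * (1 + |x|) ^ (-(1 + δ)) * √((k - x) * x / k))
              * (J * ENNReal.ofReal ((3 * k * y ^ 2) ^ (-(1 / 2 - δ / 4)))) := by gcongr
          _ = J * ENNReal.ofReal ((1 + |k - x|) * (1 + |x|) ^ (-(1 + δ)) * √((k - x) * x / k)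
              * (3 * k * y ^ 2) ^ (-(1 / 2 - δ / 4))) := by
              rw [ENNReal.ofReal_mul (p := (1 + |k - x|) * (1 + |x|) ^ (-(1 + δ))
                * √((k - x) * x / k)) (by positivity)]
              ring
          _ ≤ J * (64 * ENNReal.ofReal ((1 + |z|) ^ (-(3 * δ / 4)) * y ^ (-(1 - δ / 2)))) := by
              refine mul_le_mul' le_rfl ?_
              rw [show (64 : ℝ≥0∞) = ENNReal.ofReal 64 by simp, ← ENNReal.ofReal_mul (by norm_num)]
              exact ENNReal.ofReal_le_ofReal hreal
          _ ≤ _ := by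
              refine mul_le_mul' le_rfl (le_trans ?_ le_add_self)
              exact mul_le_mul' le_rfl hmain
    refine (lintegral_mono_ae hpt).trans ?_
    rw [lintegral_const_mul _ (by fun_prop), lintegral_add_left (by fun_prop),
      lintegral_const_mul _ (by fun_prop), lintegral_const_mul _ (by fun_prop),
      lintegral_add_left (by fun_prop), lintegral_add_left (by fun_prop),
      lintegral_sub_left_eq_self (fun x : ℝ => ENNReal.ofReal ((1 + |x|) ^ (-(1 / 2 + δ))
              * |x - (k / 2 - r)| ^ (-(1 / 2) : ℝ))) k,
      lintegral_sub_right_eq_self (fun x : ℝ => ENNReal.ofReal ((1 + |x|) ^ (-(3 * δ / 4))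
              * |x - r| ^ (-(1 - δ / 2)))) (k / 2),
      lintegral_sub_right_eq_self (fun x : ℝ => ENNReal.ofReal ((1 + |x|) ^ (-(3 * δ / 4))
              * |x - -r| ^ (-(1 - δ / 2)))) (k / 2)]
    push_cast
    refine le_trans ?_ le_add_self
    gcongr
    · exact hC₁ _
    · exact hC₁ _
    · exact hC₂ _
    · exact hC₂ _

end SameSign

/-! ### Bilinear estimates and Sobolev embedding in space-time. -/

section Bilinear

/-- The frequency `k` of `w`. -/
noncomputable def freqX (w : SpaceTime) : ℝ := 2 * Real.pi * w 0

/-- The frequency `η` of `w`. -/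
noncomputable def freqY (w : SpaceTime) : ℝ := 2 * Real.pi * w 1

/-- The frequency `τ` of `w`. -/
noncomputable def freqT (w : SpaceTime) : ℝ := 2 * Real.pi * w 2

/-- The modulation `τ - φ(k, η)` of `w`. -/
noncomputable def modulation (w : SpaceTime) : ℝ := freqT w - phase (freqX w) (freqY w)

theorem measurable_freqX : Measurable freqX := by
  unfold freqX
  fun_prop

theorem measurable_freqY : Measurable freqY := by
  unfold freqY
  fun_prop

theorem measurable_freqT : Measurable freqT := by
  unfold freqT
  fun_prop

theorem measurable_modulation : Measurable modulation := by
  have h1 := measurable_freqX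
  have h2 := measurable_freqY
  have h3 := measurable_freqT
  have : modulation = fun w => freqT w - (freqX w ^ 3 - freqY w ^ 2 / freqX w) := rfl
  rw [this]
  fun_prop

theorem freqX_sub (x y : SpaceTime) : freqX (x - y) = freqX x - freqX y := by
  simp [freqX, mul_sub]

theorem freqY_sub (x y : SpaceTime) : freqY (x - y) = freqY x - freqY y := by
  simp [freqY, mul_sub]

theorem freqT_sub (x y : SpaceTime) : freqT (x - y) = freqT x - freqT y := by
  simp [freqT, mul_sub]

theorem freqX_neg (x : SpaceTime) : freqX (-x) = -freqX x := by simp [freqX]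

theorem freqY_neg (x : SpaceTime) : freqY (-x) = -freqY x := by simp [freqY]

theorem freqT_neg (x : SpaceTime) : freqT (-x) = -freqT x := by simp [freqT]

theorem modulation_neg (x : SpaceTime) : modulation (-x) = -modulation x := by
  simp only [modulation, freqX_neg, freqY_neg, freqT_neg, phase, neg_sq, div_neg]
  ring

theorem lintegral_comp_two_pi_le (f : ℝ → ℝ≥0∞) :
    ∫⁻ x, f (2 * Real.pi * x) ≤ ∫⁻ x, f x := by
  have h : (1 : ℝ) ≤ 2 * Real.pi := by linarith [Real.pi_gt_three]
  have := lintegral_comp_mul_sub f (a := 2 * Real.pi) (by positivity) 0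
  simp only [sub_zero] at this
  rw [this]
  refine mul_le_of_le_one_left' ?_
  rw [← ENNReal.ofReal_one]
  exact ENNReal.ofReal_le_ofReal (inv_le_one_of_one_le₀ h)

/-- Integrals over space-time are bounded by iterated integrals over the frequencies. -/
theorem lintegral_freq_le (Φ : ℝ → ℝ → ℝ → ℝ≥0∞)
    (hΦ : Measurable fun p : ℝ × ℝ × ℝ => Φ p.1 p.2.1 p.2.2) :
    ∫⁻ w : SpaceTime, Φ (freqX w) (freqY w) (freqT w) ≤ ∫⁻ k, ∫⁻ η, ∫⁻ τ, Φ k η τ := by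
  have hmp := EuclideanSpace.volume_preserving_symm_measurableEquiv_toLp (Fin 3)
  set F : (Fin 3 → ℝ) → ℝ≥0∞ := fun v =>
    Φ (2 * Real.pi * v 0) (2 * Real.pi * v 1) (2 * Real.pi * v 2)
  have hF : Measurable F := hΦ.comp (f := fun v : Fin 3 → ℝ =>
    (2 * Real.pi * v 0, 2 * Real.pi * v 1, 2 * Real.pi * v 2)) (by fun_prop)
  have h1 : ∫⁻ w : SpaceTime, Φ (freqX w) (freqY w) (freqT w) = ∫⁻ v, F v :=
    hmp.lintegral_comp hF
  rw [h1, lintegral_fin_cons F hF]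
  calc ∫⁻ x, ∫⁻ v : Fin 2 → ℝ, F (Fin.cons x v)
      = ∫⁻ x, ∫⁻ y, ∫⁻ z, Φ (2 * Real.pi * x) (2 * Real.pi * y) (2 * Real.pi * z) := by
        congr 1 with x
        have m1 : Measurable fun v : Fin 2 → ℝ => F (Fin.cons x v) :=
          hF.comp (measurable_fin_cons.comp (measurable_const.prodMk measurable_id))
        rw [lintegral_fin_cons _ m1]
        congr 1 with y
        have m2 : Measurable fun v : Fin 1 → ℝ => F (Fin.cons x (Fin.cons y v)) :=
          m1.comp (measurable_fin_cons.comp (measurable_const.prodMk measurable_id))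
        rw [lintegral_fin_cons _ m2]
        congr 1 with z
        simp only [F]
        rw [lintegral_unique]
        simp [volume_pi]
        rfl
    _ ≤ ∫⁻ x, ∫⁻ y, ∫⁻ τ, Φ (2 * Real.pi * x) (2 * Real.pi * y) τ := by
        refine lintegral_mono fun x => lintegral_mono fun y => ?_
        exact lintegral_comp_two_pi_le _
    _ ≤ ∫⁻ x, ∫⁻ η, ∫⁻ τ, Φ (2 * Real.pi * x) η τ := by
        refine lintegral_mono fun x => ?_
        exact lintegral_comp_two_pi_le fun η => ∫⁻ τ, Φ (2 * Real.pi * x) η τ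
    _ ≤ _ := lintegral_comp_two_pi_le fun k => ∫⁻ η, ∫⁻ τ, Φ k η τ

theorem decay_half_sq (p x : ℝ) : decay (p / 2) x ^ 2 = decay p x := by
  rw [decay, decay, ← ENNReal.ofReal_pow (by positivity), ← Real.rpow_natCast,
    ← Real.rpow_mul (by positivity)]
  congr 2
  push_cast
  ring

/-- Reduction of a bilinear estimate to a bound for the kernel on the characteristic surface. -/
theorem exists_convSq_le {p : ℝ} (hp : 1 < p) {M : ℝ × ℝ → ℝ × ℝ → ℝ≥0∞}
    (hM : Measurable (Function.uncurry M)) {C : ℝ≥0}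
    (hC : ∀ k η τ : ℝ, ∫⁻ k₂, ∫⁻ η₂, M (k - k₂, η - η₂) (k₂, η₂)
      * decay p (τ - (phase (k - k₂) (η - η₂) + phase k₂ η₂)) ≤ C) :
    ∃ D : ℝ≥0, ∀ m : SpaceTime → SpaceTime → ℝ≥0∞, Measurable (Function.uncurry m) →
      (∀ x y, m x y ^ 2 ≤ M (freqX x, freqY x) (freqX y, freqY y)
        * (decay p (modulation x) * decay p (modulation y))) →
      ∀ f g : SpaceTime → ℝ≥0∞, Measurable f → Measurable g →
        convSq (fun x y => m x y * (f x * g y)) ≤ D * ((∫⁻ x, f x ^ 2) * ∫⁻ x, g x ^ 2) := by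
  obtain ⟨B, hB⟩ := exists_lintegral_pair_le hp
  have hd := measurable_decay p
  refine ⟨B * C, fun m hm hmM f g hf hg => convSq_le_of_kernel hm (fun ω => ?_) hf hg⟩
  have hmeas : Measurable fun v : ℝ × ℝ × ℝ =>
      M (freqX ω - v.1, freqY ω - v.2.1) (v.1, v.2.1)
        * (decay p (freqT ω - v.2.2 - phase (freqX ω - v.1) (freqY ω - v.2.1))
          * decay p (v.2.2 - phase v.1 v.2.1)) := by
    refine Measurable.mul ?_ ?_
    · exact hM.comp (f := fun v : ℝ × ℝ × ℝ => ((freqX ω - v.1, freqY ω - v.2.1), (v.1, v.2.1)))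
        (by fun_prop)
    · simp only [phase]
      fun_prop
  calc ∫⁻ ζ, m (ω - ζ) ζ ^ 2
      ≤ ∫⁻ ζ, M (freqX ω - freqX ζ, freqY ω - freqY ζ) (freqX ζ, freqY ζ)
        * (decay p (freqT ω - freqT ζ - phase (freqX ω - freqX ζ) (freqY ω - freqY ζ))
          * decay p (freqT ζ - phase (freqX ζ) (freqY ζ))) := by
        refine lintegral_mono fun ζ => ?_
        simpa only [modulation, freqX_sub, freqY_sub, freqT_sub] using hmM (ω - ζ) ζ
    _ ≤ _ := lintegral_freq_le (fun k η τ => M (freqX ω - k, freqY ω - η) (k, η)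
        * (decay p (freqT ω - τ - phase (freqX ω - k) (freqY ω - η))
          * decay p (τ - phase k η))) hmeas
    _ ≤ _ := hB (fun k₂ η₂ => M (freqX ω - k₂, freqY ω - η₂) (k₂, η₂)) _ _ _
    _ ≤ _ := by
        push_cast
        gcongr
        exact hC _ _ _

/-- The factor `1 + |k|`. -/
noncomputable def kap (w : SpaceTime) : ℝ := 1 + |freqX w|

theorem one_le_kap (w : SpaceTime) : 1 ≤ kap w := by simp [kap]

theorem kap_pos (w : SpaceTime) : 0 < kap w := by linarith [one_le_kap w]

theorem measurable_kap : Measurable kap := by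
  have := measurable_freqX
  unfold kap
  fun_prop

theorem kap_neg (w : SpaceTime) : kap (-w) = kap w := by simp [kap, freqX_neg]

/-- The velocity `k⁻¹ η`. -/
noncomputable def velocity (w : SpaceTime) : ℝ := (freqX w)⁻¹ * freqY w

theorem measurable_velocity : Measurable velocity := by
  have := measurable_freqX
  have := measurable_freqY
  unfold velocity
  fun_prop

theorem ofReal_rpow_half_sq {x : ℝ} (hx : 0 ≤ x) (s : ℝ) :
    ENNReal.ofReal (x ^ (s / 2)) ^ 2 = ENNReal.ofReal (x ^ s) := by
  rw [← ENNReal.ofReal_pow (by positivity), ← Real.rpow_natCast, ← Real.rpow_mul hx]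
  congr 2
  push_cast
  ring

/-- Bilinear smoothing in the `y` direction. -/
theorem exists_convSq_transversal_le {p δ : ℝ} (hp : 1 < p) (hδ : 0 < δ) :
    ∃ D : ℝ≥0, ∀ f g : SpaceTime → ℝ≥0∞, Measurable f → Measurable g →
      convSq (fun x y => ENNReal.ofReal (|velocity x - velocity y| ^ (1 / 2 : ℝ))
          * ((decay (p / 2) (modulation x) * f x)
            * (ENNReal.ofReal (kap y ^ (-(1 + δ) / 2)) * decay (p / 2) (modulation y) * g y)))
        ≤ D * ((∫⁻ x, f x ^ 2) * ∫⁻ x, g x ^ 2) := by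
  obtain ⟨C, hC⟩ := exists_lintegral_transversal_le hp hδ
  obtain ⟨D, hD⟩ := exists_convSq_le hp
    (M := fun u v => ENNReal.ofReal (|u.1⁻¹ * u.2 - v.1⁻¹ * v.2| * (1 + |v.1|) ^ (-(1 + δ))))
    (by simp only [Function.uncurry_def]; fun_prop) hC
  have m1 := measurable_velocity
  have m2 := measurable_kap
  have m3 := measurable_modulation
  have m4 := measurable_decay (p / 2)
  refine ⟨D, fun f g hf hg => ?_⟩
  have h := hD (fun x y => ENNReal.ofReal (|velocity x - velocity y| ^ (1 / 2 : ℝ))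
    * (decay (p / 2) (modulation x)
      * (ENNReal.ofReal (kap y ^ (-(1 + δ) / 2)) * decay (p / 2) (modulation y))))
    (by simp only [Function.uncurry_def]; fun_prop) ?_ f g hf hg
  · refine le_trans (le_of_eq ?_) h
    congr 1 with x y
    ring
  · intro x y
    rw [mul_pow, mul_pow, mul_pow, decay_half_sq, decay_half_sq, ofReal_rpow_half_sq (kap_pos y).le,
      ofReal_rpow_half_sq (abs_nonneg _), Real.rpow_one, ENNReal.ofReal_mul (abs_nonneg _)]
    apply le_of_eq
    simp only [velocity, kap]
    ring

/-- Bilinear smoothing in the `x` direction. -/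
theorem exists_convSq_fast_le {p : ℝ} (hp : 1 < p) :
    ∃ D : ℝ≥0, ∀ f g : SpaceTime → ℝ≥0∞, Measurable f → Measurable g →
      convSq (fun x y => {z : SpaceTime × SpaceTime | freqX z.2 ≠ 0 ∧
            4 * (|freqX z.2| + |velocity z.2|) ≤ |freqX z.1|}.indicator
          (fun z => ENNReal.ofReal |freqX z.1|) (x, y) * ((decay (p / 2) (modulation x) * f x)
            * (ENNReal.ofReal ((1 + |freqY y|) ^ (-1 : ℝ)) * decay (p / 2) (modulation y) * g y)))
        ≤ D * ((∫⁻ x, f x ^ 2) * ∫⁻ x, g x ^ 2) := by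
  obtain ⟨C, hC⟩ := exists_lintegral_fast_le hp
  set S : Set ((ℝ × ℝ) × (ℝ × ℝ)) :=
    {z | z.2.1 ≠ 0 ∧ 4 * (|z.2.1| + |z.2.1⁻¹ * z.2.2|) ≤ |z.1.1|}
  have hS : MeasurableSet S := by
    have h1 : MeasurableSet {z : (ℝ × ℝ) × (ℝ × ℝ) | z.2.1 ≠ 0} :=
      (measurable_fst.comp measurable_snd) (measurableSet_singleton 0).compl
    have h2 : MeasurableSet {z : (ℝ × ℝ) × (ℝ × ℝ) |
        4 * (|z.2.1| + |z.2.1⁻¹ * z.2.2|) ≤ |z.1.1|} :=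
      measurableSet_le (by fun_prop) (by fun_prop)
    exact h1.inter h2
  obtain ⟨D, hD⟩ := exists_convSq_le hp
    (M := fun u v => S.indicator
      (fun z => ENNReal.ofReal (z.1.1 ^ 2 * (1 + |z.2.2|) ^ (-2 : ℝ))) (u, v))
    (by exact Measurable.indicator (by fun_prop) hS) hC
  have m0 := measurable_freqX
  have m0' := measurable_freqY
  have m1 := measurable_velocity
  have m3 := measurable_modulation
  have m4 := measurable_decay (p / 2)
  set T : Set (SpaceTime × SpaceTime) := {z | freqX z.2 ≠ 0 ∧
    4 * (|freqX z.2| + |velocity z.2|) ≤ |freqX z.1|}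
  have hT : MeasurableSet T := by
    have h1 : MeasurableSet {z : SpaceTime × SpaceTime | freqX z.2 ≠ 0} :=
      (m0.comp measurable_snd) (measurableSet_singleton 0).compl
    have h2 : MeasurableSet {z : SpaceTime × SpaceTime |
        4 * (|freqX z.2| + |velocity z.2|) ≤ |freqX z.1|} :=
      measurableSet_le (by fun_prop) (by fun_prop)
    exact h1.inter h2
  refine ⟨D, fun f g hf hg => ?_⟩
  have hTm : Measurable fun z : SpaceTime × SpaceTime =>
      T.indicator (fun z => ENNReal.ofReal |freqX z.1|) (z.1, z.2) :=
    Measurable.indicator (by fun_prop) hT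
  have h := hD (fun x y => T.indicator (fun z => ENNReal.ofReal |freqX z.1|) (x, y)
    * (decay (p / 2) (modulation x)
      * (ENNReal.ofReal ((1 + |freqY y|) ^ (-1 : ℝ)) * decay (p / 2) (modulation y))))
    (by simp only [Function.uncurry_def]; fun_prop) ?_ f g hf hg
  · refine le_trans (le_of_eq ?_) h
    congr 1 with x y
    ring
  · intro x y
    rw [mul_pow, mul_pow, mul_pow, decay_half_sq, decay_half_sq,
      show (-1 : ℝ) = -2 / 2 by norm_num, ofReal_rpow_half_sq (by positivity)]
    by_cases hxy : (x, y) ∈ T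
    · have hxy' : ((freqX x, freqY x), (freqX y, freqY y)) ∈ S := hxy
      rw [Set.indicator_of_mem hxy, Set.indicator_of_mem hxy', ENNReal.ofReal_mul (by positivity),
        ← ENNReal.ofReal_pow (abs_nonneg _), sq_abs]
      apply le_of_eq
      ring
    · simp [Set.indicator_of_notMem hxy]

/-- The bilinear refinement of the `L⁴` Strichartz estimate. -/
theorem exists_convSq_strichartz_le {p δ : ℝ} (hp : 1 < p) (hδ : 0 < δ) (hδ1 : δ ≤ 1) :
    ∃ D : ℝ≥0, ∀ f g : SpaceTime → ℝ≥0∞, Measurable f → Measurable g →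
      convSq (fun x y => (ENNReal.ofReal (kap x ^ (1 / 2 : ℝ)) * decay (p / 2) (modulation x) * f x)
            * (ENNReal.ofReal (kap y ^ (-(1 + δ) / 2)) * decay (p / 2) (modulation y) * g y))
        ≤ D * ((∫⁻ x, f x ^ 2) * ∫⁻ x, g x ^ 2) := by
  obtain ⟨C, hC⟩ := exists_lintegral_sameSign_le hp hδ hδ1
  set S : Set ((ℝ × ℝ) × (ℝ × ℝ)) := {z | 0 ≤ z.1.1 ∧ 0 ≤ z.2.1}
  have hS : MeasurableSet S := by
    have h1 : MeasurableSet {z : (ℝ × ℝ) × (ℝ × ℝ) | 0 ≤ z.1.1} :=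
      measurableSet_le (by fun_prop) (by fun_prop)
    have h2 : MeasurableSet {z : (ℝ × ℝ) × (ℝ × ℝ) | 0 ≤ z.2.1} :=
      measurableSet_le (by fun_prop) (by fun_prop)
    exact h1.inter h2
  obtain ⟨D, hD⟩ := exists_convSq_le hp
    (M := fun u v => S.indicator
      (fun z => ENNReal.ofReal ((1 + |z.1.1|) * (1 + |z.2.1|) ^ (-(1 + δ)))) (u, v))
    (by exact Measurable.indicator (by fun_prop) hS) (C := C) (by
      intro k η τ
      refine le_trans (le_of_eq ?_) (hC k η τ)
      congr 1 with k₂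
      congr 1 with η₂
      congr 1
      simp only [Set.indicator_apply, S, Set.mem_ofPred_eq, Set.mem_Icc, sub_nonneg]
      simp only [and_comm])
  have m0 := measurable_freqX
  have m2 := measurable_kap
  have m3 := measurable_modulation
  have m4 := measurable_decay (p / 2)
  set T : Set SpaceTime := {w | 0 ≤ freqX w}
  have hT : MeasurableSet T := measurableSet_le measurable_const m0
  set ρ₁ : SpaceTime → ℝ≥0∞ := fun x =>
    ENNReal.ofReal (kap x ^ (1 / 2 : ℝ)) * decay (p / 2) (modulation x)
  set ρ₂ : SpaceTime → ℝ≥0∞ := fun y =>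
    ENNReal.ofReal (kap y ^ (-(1 + δ) / 2)) * decay (p / 2) (modulation y)
  have h₁ : Measurable ρ₁ := by fun_prop
  have h₂ : Measurable ρ₂ := by fun_prop
  refine ⟨16 * D, fun f g hf hg => ?_⟩
  push_cast
  -- The weights are even, so it suffices to treat two nonnegative `k` frequencies.
  refine convSq_le_of_half hT (fun x => ?_) h₁ h₂ (fun x => ?_) (fun x => ?_) (C := D) ?_ hf hg
  · simp only [T, Set.mem_ofPred_eq, freqX_neg, Left.nonneg_neg_iff]
    exact le_total _ _
  · simp only [ρ₁, kap_neg, modulation_neg, decay_neg]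
  · simp only [ρ₂, kap_neg, modulation_neg, decay_neg]
  · intro f g hf hg
    refine hD (fun x y => T.indicator ρ₁ x * T.indicator ρ₂ y) ?_ ?_ f g hf hg
    · exact ((h₁.indicator hT).comp measurable_fst).mul ((h₂.indicator hT).comp measurable_snd)
    · intro x y
      by_cases hx : x ∈ T
      · by_cases hy : y ∈ T
        · have hxy : ((freqX x, freqY x), (freqX y, freqY y)) ∈ S := ⟨hx, hy⟩
          rw [Set.indicator_of_mem hx, Set.indicator_of_mem hy, Set.indicator_of_mem hxy]
          simp only [ρ₁, ρ₂]
          rw [mul_pow, mul_pow, mul_pow, decay_half_sq, decay_half_sq,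
            ofReal_rpow_half_sq (kap_pos x).le, ofReal_rpow_half_sq (kap_pos y).le, Real.rpow_one,
            ENNReal.ofReal_mul (by positivity)]
          apply le_of_eq
          simp only [kap]
          ring
        · simp [Set.indicator_of_notMem hy]
      · simp [Set.indicator_of_notMem hx]

/-- The Fourier-side form of the Sobolev embedding into `L^∞`. -/
theorem exists_lintegral_sobolev_le {p δ : ℝ} (hp : 1 < p) (hδ : 0 < δ) :
    ∃ D : ℝ≥0, ∀ f : SpaceTime → ℝ≥0∞, Measurable f →
      (∫⁻ x, ENNReal.ofReal (kap x ^ (-(1 + δ) / 2) * (1 + |freqY x|) ^ (-(1 + δ) / 2))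
        * decay (p / 2) (modulation x) * f x) ^ 2 ≤ D * ∫⁻ x, f x ^ 2 := by
  obtain ⟨B, hB⟩ := exists_lintegral_decay_le hp
  obtain ⟨C, hC⟩ := exists_lintegral_decay_le (p := 1 + δ) (by linarith)
  have m0 := measurable_freqY
  have m2 := measurable_kap
  have m3 := measurable_modulation
  have m4 := measurable_decay (p / 2)
  have m5 := measurable_decay p
  have m6 := measurable_decay (1 + δ)
  refine ⟨C * (C * B), fun f hf => ?_⟩
  -- Cauchy–Schwarz against the weight: its square is integrable, with exponents `1 + δ` in `k` and
  -- `η` and `p` in the modulation.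
  refine (sq_lintegral_mul_le volume (Measurable.aemeasurable (by fun_prop))
    hf.aemeasurable).trans ?_
  gcongr
  calc _ = ∫⁻ x, decay (1 + δ) (freqX x) * (decay (1 + δ) (freqY x)
        * decay p (freqT x - phase (freqX x) (freqY x))) := by
        refine lintegral_congr fun x => ?_
        rw [ENNReal.ofReal_mul (Real.rpow_nonneg (kap_pos x).le _), mul_pow, mul_pow, decay_half_sq,
          ofReal_rpow_half_sq (kap_pos x).le, ofReal_rpow_half_sq (by positivity), mul_assoc]
        rfl
    _ ≤ ∫⁻ k, ∫⁻ η, ∫⁻ τ, decay (1 + δ) k * (decay (1 + δ) η * decay p (τ - phase k η)) := by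
        refine lintegral_freq_le (fun k η τ => decay (1 + δ) k * (decay (1 + δ) η
          * decay p (τ - phase k η))) ?_
        simp only [phase]
        fun_prop
    _ = ∫⁻ k, ∫⁻ η, decay (1 + δ) k * (decay (1 + δ) η * ∫⁻ τ, decay p τ) := by
        congr 1 with k
        congr 1 with η
        rw [lintegral_const_mul _ (by fun_prop), lintegral_const_mul _ (by fun_prop),
          lintegral_sub_right_eq_self]
    _ = (∫⁻ k, decay (1 + δ) k) * ((∫⁻ η, decay (1 + δ) η) * ∫⁻ τ, decay p τ) := by
        rw [← lintegral_mul_const _ m6]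
        congr 1 with k
        rw [lintegral_const_mul _ (by fun_prop), lintegral_mul_const _ m6]
    _ ≤ _ := by
        push_cast
        gcongr

end Bilinear

/-! ### Frequency sizes, their logarithms, and the combined weight. -/

section Weights

/-- The anisotropic size `1 + k² + |η|`. -/
noncomputable def par (w : SpaceTime) : ℝ := 1 + freqX w ^ 2 + |freqY w|

/-- The size `1 + |k| + |k⁻¹ η|` of the group velocity. -/
noncomputable def vel (w : SpaceTime) : ℝ := 1 + |freqX w| + |velocity w|

theorem one_le_par (w : SpaceTime) : 1 ≤ par w := by
  unfold par
  nlinarith [sq_nonneg (freqX w), abs_nonneg (freqY w)]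

theorem one_le_vel (w : SpaceTime) : 1 ≤ vel w := by
  unfold vel
  linarith [abs_nonneg (freqX w), abs_nonneg (velocity w)]

theorem par_pos (w : SpaceTime) : 0 < par w := by linarith [one_le_par w]

theorem vel_pos (w : SpaceTime) : 0 < vel w := by linarith [one_le_vel w]

theorem kap_le_vel (w : SpaceTime) : kap w ≤ vel w := by
  unfold kap vel
  linarith [abs_nonneg (velocity w)]

theorem kap_sq_le (w : SpaceTime) : kap w ^ 2 ≤ 2 * par w := by
  unfold kap par
  nlinarith [sq_nonneg (|freqX w| - 1), sq_abs (freqX w), abs_nonneg (freqY w)]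

theorem abs_freqX_mul_velocity {w : SpaceTime} (h : freqX w ≠ 0) :
    |freqX w| * |velocity w| = |freqY w| := by
  rw [← abs_mul, velocity, mul_inv_cancel_left₀ h]

/-- Rests on `|η| = |k| |η/k|`. At `k = 0` the velocity has the default value `0` and no longer
controls `η`, hence the hypothesis. -/
theorem par_le {w : SpaceTime} (h : freqX w ≠ 0) : par w ≤ kap w * vel w := by
  have := abs_freqX_mul_velocity h
  unfold par kap vel
  nlinarith [sq_abs (freqX w), abs_nonneg (freqX w), abs_nonneg (velocity w)]

/-- Serves to exchange a power of the velocity size for one of `par` with the help of the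
derivative. This is what tames the velocity weight of an output with small `k`. -/
theorem abs_freqX_mul_vel_le (w : SpaceTime) : |freqX w| * vel w ≤ 2 * par w := by
  have : |freqX w| * |velocity w| ≤ |freqY w| := by
    by_cases h : freqX w = 0
    · simp [h]
    · exact (abs_freqX_mul_velocity h).le
  unfold par vel
  nlinarith [sq_abs (freqX w), sq_nonneg (|freqX w| - 1), abs_nonneg (freqY w)]

theorem one_add_freqY_le (w : SpaceTime) : 1 + |freqY w| ≤ par w := by
  unfold par
  nlinarith [sq_nonneg (freqX w)]

theorem measurable_par : Measurable par := by
  have := measurable_freqX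
  have := measurable_freqY
  unfold par
  fun_prop

theorem measurable_vel : Measurable vel := by
  have := measurable_freqX
  have := measurable_velocity
  unfold vel
  fun_prop

/-- The logarithm of `kap`. -/
noncomputable def lk (w : SpaceTime) : ℝ := Real.log (kap w)

/-- The logarithm of `par`. -/
noncomputable def lh (w : SpaceTime) : ℝ := Real.log (par w)

/-- The logarithm of `vel`. -/
noncomputable def lv (w : SpaceTime) : ℝ := Real.log (vel w)

/-- The logarithm of `1 + |modulation|`. -/
noncomputable def lm (w : SpaceTime) : ℝ := Real.log (1 + |modulation w|)

theorem lk_nonneg (w : SpaceTime) : 0 ≤ lk w := Real.log_nonneg (one_le_kap w)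

theorem lh_nonneg (w : SpaceTime) : 0 ≤ lh w := Real.log_nonneg (one_le_par w)

theorem lv_nonneg (w : SpaceTime) : 0 ≤ lv w := Real.log_nonneg (one_le_vel w)

theorem lm_nonneg (w : SpaceTime) : 0 ≤ lm w :=
  Real.log_nonneg (by linarith [abs_nonneg (modulation w)])

theorem lk_le_lv (w : SpaceTime) : lk w ≤ lv w := Real.log_le_log (kap_pos w) (kap_le_vel w)

theorem lh_le {w : SpaceTime} (h : freqX w ≠ 0) : lh w ≤ lk w + lv w := by
  rw [lk, lv, ← Real.log_mul (kap_pos w).ne' (vel_pos w).ne']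
  exact Real.log_le_log (par_pos w) (par_le h)

theorem two_mul_lk_le (w : SpaceTime) : 2 * lk w ≤ Real.log 2 + lh w := by
  rw [lk, lh, ← Real.log_mul (by norm_num) (par_pos w).ne']
  have := Real.log_le_log (pow_pos (kap_pos w) 2) (kap_sq_le w)
  rwa [Real.log_pow] at this

theorem kap_rpow (w : SpaceTime) (s : ℝ) : kap w ^ s = Real.exp (s * lk w) := by
  rw [Real.rpow_def_of_pos (kap_pos w), lk, mul_comm]

theorem par_rpow (w : SpaceTime) (s : ℝ) : par w ^ s = Real.exp (s * lh w) := by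
  rw [Real.rpow_def_of_pos (par_pos w), lh, mul_comm]

theorem vel_rpow (w : SpaceTime) (s : ℝ) : vel w ^ s = Real.exp (s * lv w) := by
  rw [Real.rpow_def_of_pos (vel_pos w), lv, mul_comm]

theorem decay_modulation (p : ℝ) (w : SpaceTime) :
    decay p (modulation w) = ENNReal.ofReal (Real.exp (-p * lm w)) := by
  rw [decay, Real.rpow_def_of_pos (by positivity), lm, mul_comm]

/-- The weight `(1 + |k|)^s₁ (1 + k² + |η|)^s₂ (1 + |k| + |k⁻¹ η|)^ε`. -/
noncomputable def fullWeight (s₁ s₂ ε : ℝ) (w : SpaceTime) : ℝ :=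
  kap w ^ s₁ * par w ^ s₂ * vel w ^ ε

theorem fullWeight_eq (s₁ s₂ ε : ℝ) (w : SpaceTime) :
    fullWeight s₁ s₂ ε w = Real.exp (s₁ * lk w + s₂ * lh w + ε * lv w) := by
  rw [fullWeight, kap_rpow, par_rpow, vel_rpow, ← Real.exp_add, ← Real.exp_add]

theorem fullWeight_pos (s₁ s₂ ε : ℝ) (w : SpaceTime) : 0 < fullWeight s₁ s₂ ε w := by
  rw [fullWeight_eq]
  exact Real.exp_pos _

theorem measurable_fullWeight (s₁ s₂ ε : ℝ) : Measurable (fullWeight s₁ s₂ ε) := by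
  have := measurable_kap
  have := measurable_par
  have := measurable_vel
  unfold fullWeight
  fun_prop

/-- The derivative compensates the loss at low output frequencies. -/
theorem abs_freqX_mul_fullWeight_le {s₁ s₂ ε : ℝ} (hε : 0 < ε) (hε1 : ε ≤ 1) (w : SpaceTime) :
    |freqX w| * fullWeight s₁ s₂ ε w
      ≤ 2 * Real.exp ((1 + s₁ - ε) * lk w + (s₂ + ε) * lh w) := by
  -- The part `|k|^ε` is spent on the velocity; the remaining power `1 - ε` is nonnegative because
  -- `ε ≤ 1`.
  have h1 : |freqX w| * vel w ^ ε ≤ 2 * (kap w ^ (1 - ε) * par w ^ ε) := by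
    rcases (abs_nonneg (freqX w)).eq_or_lt with h | h
    · rw [← h, zero_mul]
      have := kap_pos w
      have := par_pos w
      positivity
    · calc |freqX w| * vel w ^ ε = |freqX w| ^ (1 - ε) * (|freqX w| * vel w) ^ ε := by
            rw [Real.mul_rpow h.le (vel_pos w).le, ← mul_assoc, ← Real.rpow_add h]
            simp
        _ ≤ kap w ^ (1 - ε) * (2 * par w) ^ ε := by
            have := abs_freqX_mul_vel_le w
            have : |freqX w| ≤ kap w := by simp [kap]
            have := vel_pos w
            have := kap_pos w
            have : 0 ≤ 1 - ε := by linarith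
            gcongr
        _ = kap w ^ (1 - ε) * (2 ^ ε * par w ^ ε) := by
            rw [Real.mul_rpow (by norm_num) (par_pos w).le]
        _ ≤ kap w ^ (1 - ε) * (2 * par w ^ ε) := by
            have := kap_pos w
            have := par_pos w
            gcongr
            calc (2 : ℝ) ^ ε ≤ 2 ^ (1 : ℝ) :=
                  Real.rpow_le_rpow_of_exponent_le (by norm_num) hε1
              _ = 2 := by norm_num
        _ = _ := by ring
  have := kap_pos w
  have := par_pos w
  calc |freqX w| * fullWeight s₁ s₂ ε w
      = (|freqX w| * vel w ^ ε) * (kap w ^ s₁ * par w ^ s₂) := by rw [fullWeight]; ring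
    _ ≤ 2 * (kap w ^ (1 - ε) * par w ^ ε) * (kap w ^ s₁ * par w ^ s₂) := by gcongr
    _ = _ := by
      rw [kap_rpow, kap_rpow, par_rpow, par_rpow, mul_assoc, ← Real.exp_add, ← Real.exp_add,
        ← Real.exp_add]
      congr 2
      ring

theorem sum_freqX {ι : Type*} (s : Finset ι) (w : ι → SpaceTime) :
    freqX (∑ i ∈ s, w i) = ∑ i ∈ s, freqX (w i) := by
  simp [freqX, Finset.mul_sum]

theorem sum_freqY {ι : Type*} (s : Finset ι) (w : ι → SpaceTime) :
    freqY (∑ i ∈ s, w i) = ∑ i ∈ s, freqY (w i) := by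
  simp [freqY, Finset.mul_sum]

theorem kap_sum_le {ι : Type*} [Fintype ι] [Nonempty ι] (w : ι → SpaceTime) {a : ℝ}
    (h : ∀ i, kap (w i) ≤ a) : kap (∑ i, w i) ≤ Fintype.card ι * a := by
  have h1 : kap (∑ i, w i) ≤ ∑ i, kap (w i) := by
    simp only [kap, sum_freqX]
    rw [Finset.sum_add_distrib]
    have := Finset.abs_sum_le_sum_abs (fun i => freqX (w i)) Finset.univ
    have h2 : (1 : ℝ) ≤ ∑ _i : ι, (1 : ℝ) := by
      simp only [Finset.sum_const, Finset.card_univ, nsmul_eq_mul, mul_one]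
      exact_mod_cast Fintype.card_pos
    linarith
  refine h1.trans ((Finset.sum_le_sum fun i _ => h i).trans (le_of_eq ?_))
  simp

theorem par_sum_le {ι : Type*} [Fintype ι] [Nonempty ι] (w : ι → SpaceTime) :
    par (∑ i, w i) ≤ Fintype.card ι * ∑ i, par (w i) := by
  have hc : (1 : ℝ) ≤ Fintype.card ι := by exact_mod_cast Fintype.card_pos
  have h1 : (∑ i, freqX (w i)) ^ 2 ≤ Fintype.card ι * ∑ i, freqX (w i) ^ 2 := by
    simpa using sq_sum_le_card_mul_sum_sq (s := Finset.univ) (f := fun i => freqX (w i))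
  have h2 := Finset.abs_sum_le_sum_abs (fun i => freqY (w i)) Finset.univ
  have h3 : 0 ≤ ∑ i, |freqY (w i)| := Finset.sum_nonneg fun i _ => abs_nonneg _
  simp only [par, sum_freqX, sum_freqY, Finset.sum_add_distrib, Finset.sum_const, Finset.card_univ,
    nsmul_eq_mul, mul_one]
  nlinarith

end Weights

/-! ### The bookkeeping of exponents as linear inequalities between logarithms. -/

section LogInequalities

/-- The regularity in `y` pays for the factors estimated in `L^∞` when the two largest
anisotropic sizes `a`, `b` are not among them; `S` is the sum over the other `n` factors. -/
theorem sobolev_balance {n : ℕ} {s₂ a b S : ℝ} (hs₂ : (n : ℝ) / (2 * (n + 2)) ≤ s₂)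
    (ha : S ≤ n * a) (hb : S ≤ n * b) (hS : 0 ≤ S) :
    S / 2 ≤ s₂ * S + (n : ℝ) / (2 * (n + 2)) * (a + b) := by
  have hn : (0 : ℝ) < n + 2 := by positivity
  -- Since `n (a + b) ≥ 2 S`, the two largest sizes cover the share `S / (n + 2)`. The weights of
  -- the `n` factors themselves cover the remaining `n / (2 (n + 2))` of `S`.
  have h1 : S / (n + 2) ≤ (n : ℝ) / (2 * (n + 2)) * (a + b) := by
    rw [div_mul_eq_mul_div, div_le_div_iff₀ hn (by positivity)]
    nlinarith
  have h2 : S / 2 = (n : ℝ) / (2 * (n + 2)) * S + S / (n + 2) := by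
    field_simp
  have h3 : (n : ℝ) / (2 * (n + 2)) * S ≤ s₂ * S := mul_le_mul_of_nonneg_right hs₂ hS
  linarith

variable {n : ℕ} {s₁ s₂ ε δ : ℝ}

/-- Weight inequality when the highest frequency has an anisotropic size comparable to the
largest one. -/
theorem log_weight_le_of_comparable (hs₂ : (n : ℝ) / (2 * (n + 2)) ≤ s₂)
    (hε1 : ε ≤ s₁) (hδ : 0 < δ) (hδ₁ : 1 / 2 + 2 * δ ≤ s₁) (hδε : 3 * δ ≤ ε)
    {c k₀ h₀ ka ha na kb hb nb kc hc nc Sk Sh Sn m : ℝ} (hc0 : 0 ≤ c)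
    (hkb : 0 ≤ kb) (hkc : 0 ≤ kc) (hSk : 0 ≤ Sk) (hhb : 0 ≤ hb) (hhc : 0 ≤ hc) (hSh : 0 ≤ Sh)
    (hnb : 0 ≤ nb) (hnc : 0 ≤ nc) (hSn : 0 ≤ Sn)
    (hSb : Sh ≤ n * hb) (hSc : Sh ≤ n * hc) (hSn2 : Sh ≤ 2 * Sn)
    (hk₀ : k₀ ≤ ka + c) (hh₀ : h₀ ≤ ha + c) (hha : ha ≤ ka + na) (hm : ka ≤ m) :
    (1 / 2 + s₁ - ε) * k₀ + (s₂ + ε) * h₀ + δ * (kb + nb + kc + nc + Sk + Sn)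
      ≤ (1 + s₁ + s₂) * c + s₁ * (ka + kb + kc + Sk) + s₂ * (ha + hb + hc + Sh)
        + ε * (na + nb + nc + Sn) + m / 2 - (1 / 2 + δ) * (kb + kc + Sk) - (1 / 2 + δ) * Sh := by
  have hbal := sobolev_balance hs₂ hSb hSc hSh
  have hs0 : 0 ≤ (n : ℝ) / (2 * (n + 2)) := by positivity
  -- Here `ε ≤ s₁` makes the coefficient of the output frequency nonnegative.
  have e1 : (1 / 2 + s₁ - ε) * k₀ ≤ (1 / 2 + s₁ - ε) * (ka + c) :=
    mul_le_mul_of_nonneg_left hk₀ (by linarith)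
  have e2 : (s₂ + ε) * h₀ ≤ (s₂ + ε) * (ha + c) :=
    mul_le_mul_of_nonneg_left hh₀ (by linarith)
  have e3 : ε * ha ≤ ε * (ka + na) := mul_le_mul_of_nonneg_left hha (by linarith)
  have e4 : (n : ℝ) / (2 * (n + 2)) * (hb + hc) ≤ s₂ * (hb + hc) :=
    mul_le_mul_of_nonneg_right hs₂ (by linarith)
  have e5 : (1 / 2 + 2 * δ) * (kb + kc + Sk) ≤ s₁ * (kb + kc + Sk) :=
    mul_le_mul_of_nonneg_right hδ₁ (by linarith)
  have e6 : 3 * δ * (nb + nc + Sn) ≤ ε * (nb + nc + Sn) :=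
    mul_le_mul_of_nonneg_right hδε (by linarith)
  have e7 : δ * Sh ≤ δ * (2 * Sn) := mul_le_mul_of_nonneg_left hSn2 hδ.le
  have e8 : 0 ≤ δ * nb := by positivity
  have e9 : 0 ≤ δ * nc := by positivity
  have e10 : 0 ≤ c / 2 := by positivity
  linarith

/-- Weight inequality when the largest anisotropic size belongs to a faster factor. -/
theorem log_weight_le_of_transversal (hs₂ : (n : ℝ) / (2 * (n + 2)) ≤ s₂)
    (hε1 : ε ≤ s₁) (hδ : 0 < δ) (hδ₁ : 1 / 2 + 2 * δ ≤ s₁) (hδε : 3 * δ ≤ ε)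
    (hδn : δ ≤ 1 / (n + 2))
    {c k₀ h₀ ka ha na kb hb nb kc hc nc Sk Sh Sn m : ℝ} (hc0 : 0 ≤ c)
    (hka : 0 ≤ ka) (hha0 : 0 ≤ ha) (hkb : 0 ≤ kb) (hkc : 0 ≤ kc) (hSk : 0 ≤ Sk) (hhc : 0 ≤ hc)
    (hSh : 0 ≤ Sh) (hnc : 0 ≤ nc) (hSn : 0 ≤ Sn)
    (hSb : Sh ≤ n * hb) (hSc : Sh ≤ n * hc) (hSn2 : Sh ≤ 2 * Sn)
    (hk₀ : k₀ ≤ ka + c) (hh₀ : h₀ ≤ hb + c) (hhb : hb ≤ kb + nb) (hkab : kb ≤ ka)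
    (hkan : ka ≤ na) (hha : 2 * ka ≤ ha + c)
    (hm : ka ≤ m) (hmn : nb ≤ m + c) (hmh : hb ≤ m + ka + c) :
    (1 / 2 + s₁ - ε) * k₀ + (s₂ + ε) * h₀ + δ * (kb + nb + kc + nc + Sk + Sn)
      ≤ (3 + s₁ + s₂) * c + s₁ * (ka + kb + kc + Sk) + s₂ * (ha + hb + hc + Sh)
        + ε * (na + nb + nc + Sn) + m / 2 - (1 / 2 + δ) * (kb + kc + Sk) - (1 / 2 + δ) * Sh := by
  have hbal := sobolev_balance hs₂ hSb hSc hSh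
  have hn : (0 : ℝ) < n + 2 := by positivity
  set θ : ℝ := 1 / (n + 2)
  have hθ : (n : ℝ) / (2 * (n + 2)) = 1 / 2 - θ := by
    simp only [θ]
    field_simp
    ring
  have hs0 : 0 ≤ (n : ℝ) / (2 * (n + 2)) := by positivity
  rw [hθ] at hbal hs₂ hs0
  have hθ0 : 0 < θ := by positivity
  have e1 : (1 / 2 + s₁ - ε) * k₀ ≤ (1 / 2 + s₁ - ε) * (ka + c) :=
    mul_le_mul_of_nonneg_left hk₀ (by linarith)
  have e2 : (s₂ + ε) * h₀ ≤ (s₂ + ε) * (hb + c) :=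
    mul_le_mul_of_nonneg_left hh₀ (by linarith)
  have e3 : ε * hb ≤ ε * (ka + nb) := mul_le_mul_of_nonneg_left (by linarith) (by linarith)
  have e4 : (1 / 2 - θ) * (ha + hc) ≤ s₂ * (ha + hc) :=
    mul_le_mul_of_nonneg_right hs₂ (by linarith)
  have e5 : (1 / 2 + 2 * δ) * (kb + kc + Sk) ≤ s₁ * (kb + kc + Sk) :=
    mul_le_mul_of_nonneg_right hδ₁ (by linarith)
  have e6 : 3 * δ * (nc + Sn) ≤ ε * (nc + Sn) :=
    mul_le_mul_of_nonneg_right hδε (by linarith)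
  have e7 : δ * Sh ≤ δ * (2 * Sn) := mul_le_mul_of_nonneg_left hSn2 hδ.le
  have e8 : 0 ≤ δ * nc := by positivity
  -- The output consumes the `s₂` weight of the factor with size `hb`, so its share in
  -- `sobolev_balance` must come from elsewhere. It is recovered from `hb ≤ m + ka + c`, with `ka`
  -- paid by the weight of the highest frequency through `2 ka ≤ ha + c`. What is left is `(θ - δ)(m
  -- - ka)`, and its sign is where `δ ≤ 1/(n+2)` enters.
  have e9 : (1 / 2 - θ) * hb ≤ (1 / 2 - θ) * (m + ka + c) := mul_le_mul_of_nonneg_left hmh hs0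
  have e10 : (1 / 2 - θ) * (2 * ka) ≤ (1 / 2 - θ) * (ha + c) := mul_le_mul_of_nonneg_left hha hs0
  have e11 : δ * nb ≤ δ * (m + c) := mul_le_mul_of_nonneg_left hmn hδ.le
  have e12 : 0 ≤ (θ - δ) * (m - ka) := mul_nonneg (by linarith) (by linarith)
  have e13 : δ * ka ≤ ε * na := mul_le_mul (by linarith) hkan hka (by linarith)
  have e14 : δ * c ≤ 1 / 2 * c := by
    refine mul_le_mul_of_nonneg_right ?_ hc0
    linarith
  have e15 : 0 ≤ θ * c := by positivity
  linarith

/-- Weight inequality for the region of large output modulation. -/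
theorem log_weight_le_of_modulation (hs₂ : 0 ≤ s₂) (hε : 0 < ε) (hε1 : ε ≤ s₁)
    {c k₀ h₀ ka ha na P : ℝ} (hk₀ : k₀ ≤ ka + c) (hh₀ : h₀ ≤ ha + P + c) (hha : ha ≤ ka + na) :
    (1 + s₁ - ε) * k₀ + (s₂ + ε) * h₀
      ≤ (1 + s₁ + s₂) * c + s₁ * ka + s₂ * ha + ε * na + ka + (s₂ + ε) * P := by
  have e1 : (1 + s₁ - ε) * k₀ ≤ (1 + s₁ - ε) * (ka + c) :=
    mul_le_mul_of_nonneg_left hk₀ (by linarith)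
  have e2 : (s₂ + ε) * h₀ ≤ (s₂ + ε) * (ha + P + c) :=
    mul_le_mul_of_nonneg_left hh₀ (by linarith)
  have e3 : ε * ha ≤ ε * (ka + na) := mul_le_mul_of_nonneg_left hha hε.le
  linarith

end LogInequalities

/-! ### Pointwise bounds for the weight quotient on ordered configurations. -/

section Pointwise

/-- The weight of a factor estimated in `L^∞`. -/
noncomputable def sobolevWeight (δ : ℝ) (w : SpaceTime) : ℝ :=
  kap w ^ (-(1 + 2 * δ) / 2) * (1 + |freqY w|) ^ (-(1 + 2 * δ) / 2)

theorem measurable_sobolevWeight (δ : ℝ) : Measurable (sobolevWeight δ) := by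
  have := measurable_kap
  have := measurable_freqY
  unfold sobolevWeight
  fun_prop

theorem sobolevWeight_nonneg (δ : ℝ) (w : SpaceTime) : 0 ≤ sobolevWeight δ w := by
  have := kap_pos w
  unfold sobolevWeight
  positivity

theorem exp_le_sobolevWeight {δ : ℝ} (hδ : 0 < δ) (w : SpaceTime) :
    Real.exp (-(1 / 2 + δ) * (lk w + lh w)) ≤ sobolevWeight δ w := by
  have h1 : par w ^ (-(1 + 2 * δ) / 2) ≤ (1 + |freqY w|) ^ (-(1 + 2 * δ) / 2) :=
    Real.rpow_le_rpow_of_nonpos (by positivity) (one_add_freqY_le w) (by linarith)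
  have h0 := kap_pos w
  calc Real.exp (-(1 / 2 + δ) * (lk w + lh w))
      = kap w ^ (-(1 + 2 * δ) / 2) * par w ^ (-(1 + 2 * δ) / 2) := by
        rw [kap_rpow, par_rpow, ← Real.exp_add]
        congr 1
        ring
    _ ≤ _ := by
        unfold sobolevWeight
        gcongr

theorem prod_exp_le_sobolevWeight {δ : ℝ} (hδ : 0 < δ) {n : ℕ} (v : Fin n → SpaceTime) :
    Real.exp (-(1 / 2 + δ) * ((∑ i, lk (v i)) + ∑ i, lh (v i))) ≤ ∏ i, sobolevWeight δ (v i) := by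
  rw [← Finset.sum_add_distrib, Finset.mul_sum, Real.exp_sum]
  exact Finset.prod_le_prod (fun i _ => (Real.exp_pos _).le) fun i _ => exp_le_sobolevWeight hδ _

/-- Transversality of a factor with a much larger anisotropic size but smaller frequency. -/
theorem transversal_of_par {x y : SpaceTime} (hx : freqX x ≠ 0) (hy : freqX y ≠ 0)
    (hk : kap y ≤ kap x) (h : 3 * par x ≤ par y) :
    par y ≤ 3 * (|velocity x - velocity y| * kap x)
      ∧ vel y ≤ kap x + 2 * |velocity x - velocity y| := by
  have hk' : |freqX y| ≤ |freqX x| := by unfold kap at hk; linarith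
  have ex := abs_freqX_mul_velocity hx
  have ey := abs_freqX_mul_velocity hy
  have hx0 := abs_pos.2 hx
  have hy0 := abs_pos.2 hy
  have hsq : freqX y ^ 2 ≤ freqX x ^ 2 := sq_le_sq.2 hk'
  unfold par at h
  -- the `η` frequency dominates
  have h1 : 2 * (1 + freqX x ^ 2 + |freqY x|) ≤ |freqY y| := by
    nlinarith [abs_nonneg (freqY x)]
  have h2 : 2 * |velocity x| ≤ |velocity y| := by
    have : |freqX x| * (2 * |velocity x|) ≤ |freqX x| * |velocity y| := by
      nlinarith [abs_nonneg (velocity y), sq_nonneg (freqX x)]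
    exact le_of_mul_le_mul_left this hx0
  have h3 : |velocity y| ≤ 2 * |velocity x - velocity y| := by
    have := abs_sub_abs_le_abs_sub (velocity y) (velocity x)
    rw [abs_sub_comm] at this
    linarith
  constructor
  · have h4 : |freqY y| ≤ 2 * (|velocity x - velocity y| * |freqX x|) := by
      rw [← ey]
      nlinarith [abs_nonneg (velocity x - velocity y)]
    have h5 : 0 ≤ |velocity x - velocity y| := abs_nonneg _
    unfold par kap
    nlinarith [abs_nonneg (freqY x)]
  · unfold vel kap
    linarith

variable {n : ℕ}

/-- The frequency configuration in which factor `0` has the highest frequency in `x`, and factors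
`1`, `2` have the largest anisotropic sizes among the other ones. -/
def Ordered (w : Fin (n + 3) → SpaceTime) : Prop :=
  (∀ j, kap (w j) ≤ kap (w 0)) ∧ (∀ j, j ≠ 0 → par (w j) ≤ par (w 1)) ∧
    ∀ i : Fin n, par (w i.succ.succ.succ) ≤ par (w 2)

/-- The first two bounds feed `sobolev_balance`. The third, from `lh ≤ lk + lv ≤ 2 lv`, lets the `ε`
weight pay the excess `δ` in the Sobolev exponents. -/
theorem lh_sum_bounds {w : Fin (n + 3) → SpaceTime} (hw : Ordered w) (h0 : ∀ j, freqX (w j) ≠ 0) :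
    (∑ i : Fin n, lh (w i.succ.succ.succ)) ≤ n * lh (w 1) ∧
    (∑ i : Fin n, lh (w i.succ.succ.succ)) ≤ n * lh (w 2) ∧
    (∑ i : Fin n, lh (w i.succ.succ.succ)) ≤ 2 * ∑ i : Fin n, lv (w i.succ.succ.succ) := by
  refine ⟨?_, ?_, ?_⟩
  · refine (Finset.sum_le_sum fun i _ => Real.log_le_log (par_pos _)
      (hw.2.1 i.succ.succ.succ (Fin.succ_ne_zero _))).trans (le_of_eq ?_)
    simp [lh]
  · refine (Finset.sum_le_sum fun i _ => Real.log_le_log (par_pos _) (hw.2.2 i)).trans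
      (le_of_eq ?_)
    simp [lh]
  · rw [Finset.mul_sum]
    refine Finset.sum_le_sum fun i _ => ?_
    have h1 := lh_le (h0 i.succ.succ.succ)
    have h2 := lk_le_lv (w i.succ.succ.succ)
    linarith

theorem prod_fullWeight_eq (s₁ s₂ ε : ℝ) {m : ℕ} (w : Fin m → SpaceTime) :
    ∏ j, fullWeight s₁ s₂ ε (w j)
      = Real.exp (s₁ * (∑ j, lk (w j)) + s₂ * (∑ j, lh (w j)) + ε * ∑ j, lv (w j)) := by
  simp only [fullWeight_eq]
  rw [← Real.exp_sum, Finset.sum_add_distrib, Finset.sum_add_distrib, ← Finset.mul_sum,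
    ← Finset.mul_sum, ← Finset.mul_sum]

theorem fin_sum_three (f : Fin (n + 3) → ℝ) :
    ∑ j, f j = f 0 + f 1 + f 2 + ∑ i : Fin n, f i.succ.succ.succ := by
  rw [Fin.sum_univ_succ, Fin.sum_univ_succ, Fin.sum_univ_succ]
  simp only [Fin.succ_zero_eq_one, Fin.succ_one_eq_two]
  ring

theorem lk_sum_le {w : Fin (n + 3) → SpaceTime} (hw : Ordered w) :
    lk (∑ j, w j) ≤ lk (w 0) + Real.log (3 * (n + 3) ^ 2) := by
  have h := kap_sum_le w hw.1
  have hn : (0 : ℝ) ≤ n := by positivity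
  rw [lk, lk, ← Real.log_mul (kap_pos _).ne' (by positivity)]
  refine Real.log_le_log (kap_pos _) (h.trans ?_)
  rw [mul_comm]
  have := kap_pos (w 0)
  gcongr
  simp only [Fintype.card_fin]
  push_cast
  nlinarith

/-- The factor 3 matches the threshold that separates comparable from transversal configurations in
`pointwise_moderate`. -/
theorem lh_sum_le_of_le {w : Fin (n + 3) → SpaceTime} {a : ℝ} (ha : 0 < a)
    (h : ∀ j, par (w j) ≤ 3 * a) :
    lh (∑ j, w j) ≤ Real.log a + Real.log (3 * (n + 3) ^ 2) := by
  rw [lh, ← Real.log_mul ha.ne' (by positivity)]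
  refine Real.log_le_log (par_pos _) ((par_sum_le w).trans ?_)
  have : ∑ j, par (w j) ≤ (n + 3 : ℕ) * (3 * a) := by
    refine (Finset.sum_le_sum fun j _ => h j).trans (le_of_eq ?_)
    simp
  simp only [Fintype.card_fin]
  calc ((n + 3 : ℕ) : ℝ) * ∑ j, par (w j) ≤ (n + 3 : ℕ) * ((n + 3 : ℕ) * (3 * a)) := by gcongr
    _ = _ := by push_cast; ring

theorem lh_sum_le_of_logs {w : Fin (n + 3) → SpaceTime} {a : ℝ} (h : ∀ j, lh (w j) ≤ a) :
    lh (∑ j, w j) ≤ a + Real.log (3 * (n + 3) ^ 2) := by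
  have := lh_sum_le_of_le (w := w) (Real.exp_pos a) fun j => by
    have h1 : par (w j) ≤ Real.exp a := by
      rw [← Real.log_le_iff_le_exp (par_pos _)]
      exact h j
    linarith [Real.exp_pos a]
  rwa [Real.log_exp] at this

/-- The total logarithmic size of all factors but the first one. -/
noncomputable def restSize (w : Fin (n + 3) → SpaceTime) : ℝ :=
  lk (w 1) + lv (w 1) + lk (w 2) + lv (w 2) + (∑ i : Fin n, lk (w i.succ.succ.succ))
    + ∑ i : Fin n, lv (w i.succ.succ.succ)

variable {s₁ s₂ ε δ : ℝ}

/-- The derivative is split into a half power for the output, to be paired with factor 2, and a half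
power for the pair of factors 0 and 1. All other factors receive Sobolev weights. The factor `exp (δ
* restSize w)` is the room that later allows the exponent of the output modulation to be lowered. -/
theorem pointwise_moderate (hs₂ : (n : ℝ) / (2 * (n + 2)) ≤ s₂) (hε0 : 0 < ε) (hε₁ : ε ≤ 1)
    (hε1 : ε ≤ s₁) (hδ : 0 < δ) (hδ₁ : 1 / 2 + 2 * δ ≤ s₁) (hδε : 3 * δ ≤ ε)
    (hδn : δ ≤ 1 / (n + 2)) {w : Fin (n + 3) → SpaceTime} (hw : Ordered w)
    (h0 : ∀ j, freqX (w j) ≠ 0) :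
    |freqX (∑ j, w j)| * fullWeight s₁ s₂ ε (∑ j, w j) / (∏ j, fullWeight s₁ s₂ ε (w j))
        * Real.exp (δ * restSize w)
      ≤ 2 * Real.exp ((3 + s₁ + s₂) * Real.log (3 * (n + 3) ^ 2))
        * (kap (∑ j, w j) ^ (1 / 2 : ℝ)
          * ((kap (w 0) ^ (1 / 2 : ℝ) + |velocity (w 0) - velocity (w 1)| ^ (1 / 2 : ℝ))
          * (kap (w 1) ^ (-(1 + 2 * δ) / 2) * kap (w 2) ^ (-(1 + 2 * δ) / 2)
            * ∏ i : Fin n, sobolevWeight δ (w i.succ.succ.succ)))) := by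
  set c : ℝ := Real.log (3 * (n + 3) ^ 2)
  have hc0 : 0 ≤ c := Real.log_nonneg (by nlinarith [(Nat.cast_nonneg n : (0 : ℝ) ≤ n)])
  obtain ⟨hSb, hSc, hSn2⟩ := lh_sum_bounds hw h0
  set Sk := ∑ i : Fin n, lk (w i.succ.succ.succ)
  set Sh := ∑ i : Fin n, lh (w i.succ.succ.succ)
  set Sn := ∑ i : Fin n, lv (w i.succ.succ.succ)
  have hSk : 0 ≤ Sk := Finset.sum_nonneg fun i _ => lk_nonneg _
  have hSh : 0 ≤ Sh := Finset.sum_nonneg fun i _ => lh_nonneg _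
  have hSn : 0 ≤ Sn := Finset.sum_nonneg fun i _ => lv_nonneg _
  have hk₀ := lk_sum_le hw
  set z := ∑ j, w j
  -- a common reduction
  have main : ∀ m : ℝ, 0 < m → m ^ (1 / 2 : ℝ) ≤ kap (w 0) ^ (1 / 2 : ℝ)
        + |velocity (w 0) - velocity (w 1)| ^ (1 / 2 : ℝ) →
      (1 / 2 + s₁ - ε) * lk z + (s₂ + ε) * lh z + δ * restSize w
      ≤ (3 + s₁ + s₂) * c + s₁ * (lk (w 0) + lk (w 1) + lk (w 2) + Sk)
        + s₂ * (lh (w 0) + lh (w 1) + lh (w 2) + Sh)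
        + ε * (lv (w 0) + lv (w 1) + lv (w 2) + Sn) + Real.log m / 2
        - (1 / 2 + δ) * (lk (w 1) + lk (w 2) + Sk) - (1 / 2 + δ) * Sh →
      |freqX z| * fullWeight s₁ s₂ ε z / (∏ j, fullWeight s₁ s₂ ε (w j))
        * Real.exp (δ * restSize w)
      ≤ 2 * Real.exp ((3 + s₁ + s₂) * c)
        * (kap z ^ (1 / 2 : ℝ)
          * ((kap (w 0) ^ (1 / 2 : ℝ) + |velocity (w 0) - velocity (w 1)| ^ (1 / 2 : ℝ))
          * (kap (w 1) ^ (-(1 + 2 * δ) / 2) * kap (w 2) ^ (-(1 + 2 * δ) / 2)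
            * ∏ i : Fin n, sobolevWeight δ (w i.succ.succ.succ)))) := by
    intro m hm hmle hlog
    have hp1 := kap_pos (w 1)
    have hp2 := kap_pos (w 2)
    have hpz := kap_pos z
    calc |freqX z| * fullWeight s₁ s₂ ε z / (∏ j, fullWeight s₁ s₂ ε (w j))
        * Real.exp (δ * restSize w)
        ≤ 2 * Real.exp ((1 + s₁ - ε) * lk z + (s₂ + ε) * lh z)
          / (∏ j, fullWeight s₁ s₂ ε (w j)) * Real.exp (δ * restSize w) := by
          have hP : 0 < ∏ j, fullWeight s₁ s₂ ε (w j) :=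
            Finset.prod_pos fun j _ => fullWeight_pos _ _ _ _
          exact mul_le_mul_of_nonneg_right (div_le_div_of_nonneg_right
            (abs_freqX_mul_fullWeight_le hε0 hε₁ z) hP.le) (Real.exp_pos _).le
      _ = 2 * Real.exp ((1 + s₁ - ε) * lk z + (s₂ + ε) * lh z
          - (s₁ * (lk (w 0) + lk (w 1) + lk (w 2) + Sk)
            + s₂ * (lh (w 0) + lh (w 1) + lh (w 2) + Sh)
            + ε * (lv (w 0) + lv (w 1) + lv (w 2) + Sn)) + δ * restSize w) := by
          rw [prod_fullWeight_eq, fin_sum_three, fin_sum_three, fin_sum_three, Real.exp_add _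
            (δ * restSize w), Real.exp_sub]
          ring
      _ ≤ 2 * Real.exp ((3 + s₁ + s₂) * c + (1 / 2 * lk z + (Real.log m * (1 / 2)
          + (-(1 + 2 * δ) / 2 * lk (w 1) + -(1 + 2 * δ) / 2 * lk (w 2)
            + -(1 / 2 + δ) * (Sk + Sh))))) :=
          mul_le_mul_of_nonneg_left (Real.exp_le_exp.2 (by linarith)) (by norm_num)
      _ = 2 * Real.exp ((3 + s₁ + s₂) * c) * (kap z ^ (1 / 2 : ℝ) * (m ^ (1 / 2 : ℝ)
          * (kap (w 1) ^ (-(1 + 2 * δ) / 2) * kap (w 2) ^ (-(1 + 2 * δ) / 2)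
            * Real.exp (-(1 / 2 + δ) * (Sk + Sh))))) := by
          rw [Real.exp_add, Real.exp_add, Real.exp_add, Real.exp_add, Real.exp_add, kap_rpow,
            kap_rpow, kap_rpow, Real.rpow_def_of_pos hm]
          ring
      _ ≤ _ := by
          have := prod_exp_le_sobolevWeight hδ fun i : Fin n => w i.succ.succ.succ
          have := kap_pos (w 0)
          have : 0 ≤ kap (w 0) ^ (1 / 2 : ℝ)
            + |velocity (w 0) - velocity (w 1)| ^ (1 / 2 : ℝ) := by positivity
          gcongr
  have hk1 : lk (w 1) ≤ lk (w 0) := Real.log_le_log (kap_pos _) (hw.1 1)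
  -- Either factor 0 has, up to a constant, the largest anisotropic size and the Strichartz gain
  -- suffices, or factor 1 has a much larger `η` with a smaller `|k|` and its velocity differs
  -- strongly from that of factor 0.
  rcases le_or_gt (par (w 1)) (3 * par (w 0)) with hcase | hcase
  · have hh₀ : lh z ≤ lh (w 0) + c := lh_sum_le_of_le (par_pos _) fun j => by
      by_cases hj : j = 0
      · rw [hj]; linarith [par_pos (w 0)]
      · exact (hw.2.1 j hj).trans hcase
    refine main (kap (w 0)) (kap_pos _) (le_add_of_nonneg_right (by positivity)) ?_
    have := log_weight_le_of_comparable hs₂ hε1 hδ hδ₁ hδε hc0 (lk_nonneg (w 1)) (lk_nonneg (w 2))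
      hSk (lh_nonneg (w 1)) (lh_nonneg (w 2)) hSh (lv_nonneg (w 1)) (lv_nonneg (w 2)) hSn hSb hSc
      hSn2 hk₀ hh₀ (lh_le (h0 0)) (le_refl (lk (w 0)))
    have e : Real.log (kap (w 0)) = lk (w 0) := rfl
    have e' : restSize w = lk (w 1) + lv (w 1) + lk (w 2) + lv (w 2) + Sk + Sn := rfl
    rw [e, e']
    linarith
  · have hh₀ : lh z ≤ lh (w 1) + c := lh_sum_le_of_le (par_pos _) fun j => by
      by_cases hj : j = 0
      · rw [hj]; linarith [par_pos (w 0)]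
      · linarith [hw.2.1 j hj, par_pos (w 1)]
    obtain ⟨t1, t2⟩ := transversal_of_par (h0 0) (h0 1) (hw.1 1) hcase.le
    set q := |velocity (w 0) - velocity (w 1)|
    -- The better of the Strichartz and the transversal gain; in both cases its square root is one
    -- of the two summands on the right.
    set m := max (kap (w 0)) q
    have hm : 0 < m := lt_max_of_lt_left (kap_pos _)
    have hmk : lk (w 0) ≤ Real.log m := Real.log_le_log (kap_pos _) (le_max_left _ _)
    have h3c : Real.log 3 ≤ c := by
      refine Real.log_le_log (by norm_num) ?_
      nlinarith [(Nat.cast_nonneg n : (0 : ℝ) ≤ n)]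
    have h2c : Real.log 2 ≤ c := (Real.log_le_log (by norm_num) (by norm_num)).trans h3c
    have hmn : lv (w 1) ≤ Real.log m + c := by
      have : vel (w 1) ≤ m * 3 := by
        linarith [le_max_left (kap (w 0)) q, le_max_right (kap (w 0)) q]
      have := Real.log_le_log (vel_pos _) this
      rw [Real.log_mul hm.ne' (by norm_num)] at this
      rw [lv]
      linarith
    have hmh : lh (w 1) ≤ Real.log m + lk (w 0) + c := by
      have h1 : par (w 1) ≤ m * kap (w 0) * 3 := by
        have : q * kap (w 0) ≤ m * kap (w 0) := by
          have := kap_pos (w 0)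
          gcongr
          exact le_max_right _ _
        linarith
      have := Real.log_le_log (par_pos _) h1
      rw [Real.log_mul (mul_pos hm (kap_pos _)).ne' (by norm_num),
        Real.log_mul hm.ne' (kap_pos _).ne'] at this
      rw [lh, lk]
      linarith
    refine main m hm ?_ ?_
    · have hq0 : 0 ≤ q := abs_nonneg _
      rcases max_choice (kap (w 0)) q with h | h
      · rw [show m = kap (w 0) from h]
        exact le_add_of_nonneg_right (by positivity)
      · rw [show m = q from h]
        have := kap_pos (w 0)
        exact le_add_of_nonneg_left (by positivity)
    · have := log_weight_le_of_transversal hs₂ hε1 hδ hδ₁ hδε hδn hc0 (lk_nonneg (w 0))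
        (lh_nonneg (w 0)) (lk_nonneg (w 1)) (lk_nonneg (w 2)) hSk (lh_nonneg (w 2)) hSh
        (lv_nonneg (w 2)) hSn hSb hSc hSn2 hk₀ hh₀ (lh_le (h0 1)) hk1 (lk_le_lv (w 0))
        (by linarith [two_mul_lk_le (w 0)]) hmk hmn hmh
      have e' : restSize w = lk (w 1) + lv (w 1) + lk (w 2) + lv (w 2) + Sk + Sn := rfl
      rw [e']
      linarith

theorem sum_lh_le {w : Fin (n + 3) → SpaceTime} (h0 : ∀ j, freqX (w j) ≠ 0) :
    ∑ i : Fin n, lh (w i.succ.succ.succ)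
      ≤ (∑ i : Fin n, lk (w i.succ.succ.succ)) + ∑ i : Fin n, lv (w i.succ.succ.succ) := by
  rw [← Finset.sum_add_distrib]
  exact Finset.sum_le_sum fun i _ => lh_le (h0 _)

theorem restSize_bounds (w : Fin (n + 3) → SpaceTime) (h0 : ∀ j, freqX (w j) ≠ 0) :
    0 ≤ restSize w ∧ lh (w 1) ≤ restSize w := by
  have hSk : 0 ≤ ∑ i : Fin n, lk (w i.succ.succ.succ) := Finset.sum_nonneg fun i _ => lk_nonneg _
  have hSn : 0 ≤ ∑ i : Fin n, lv (w i.succ.succ.succ) := Finset.sum_nonneg fun i _ => lv_nonneg _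
  have n1 := lk_nonneg (w 1)
  have n2 := lk_nonneg (w 2)
  have n3 := lv_nonneg (w 1)
  have n4 := lv_nonneg (w 2)
  have l1 := lh_le (h0 1)
  unfold restSize
  constructor <;> linarith

theorem log_fullWeight_le_sum (hs₁ : 0 ≤ s₁) (hs₂ : 0 ≤ s₂) (hε : 0 ≤ ε) {m : ℕ}
    (w : Fin (m + 1) → SpaceTime) :
    s₁ * lk (w 0) + s₂ * lh (w 0) + ε * lv (w 0) ≤ s₁ * (∑ j, lk (w j))
      + s₂ * (∑ j, lh (w j)) + ε * ∑ j, lv (w j) := by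
  refine add_le_add (add_le_add (mul_le_mul_of_nonneg_left ?_ hs₁)
    (mul_le_mul_of_nonneg_left ?_ hs₂)) (mul_le_mul_of_nonneg_left ?_ hε)
  · exact Finset.single_le_sum (f := fun j => lk (w j)) (fun j _ => lk_nonneg _)
      (Finset.mem_univ 0)
  · exact Finset.single_le_sum (f := fun j => lh (w j)) (fun j _ => lh_nonneg _)
      (Finset.mem_univ 0)
  · exact Finset.single_le_sum (f := fun j => lv (w j)) (fun j _ => lv_nonneg _)
      (Finset.mem_univ 0)

/-- It is enough to keep the weight of factor 0 in the denominator. The numerator exceeds it, up to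
a constant, by at most `kap (w 0)` and `exp ((s₂ + ε) * restSize w)`. Three units of `restSize` in
the exponential are kept for later use. -/
theorem weight_quotient_le_of_large (hs₂ : 0 ≤ s₂) (hε0 : 0 < ε) (hε₁ : ε ≤ 1) (hε1 : ε ≤ s₁)
    {w : Fin (n + 3) → SpaceTime} (hw : Ordered w) (h0 : ∀ j, freqX (w j) ≠ 0) :
    |freqX (∑ j, w j)| * fullWeight s₁ s₂ ε (∑ j, w j) / (∏ j, fullWeight s₁ s₂ ε (w j))
        * Real.exp (-(s₂ + ε + 3) * restSize w)
      ≤ 2 * Real.exp ((1 + s₁ + s₂) * Real.log (3 * (n + 3) ^ 2))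
        * (kap (w 0) * Real.exp (-3 * restSize w)) := by
  obtain ⟨hP0, hP1⟩ := restSize_bounds w h0
  have hk₀ := lk_sum_le hw
  set c : ℝ := Real.log (3 * (n + 3) ^ 2)
  set P := restSize w
  have hh₀ : lh (∑ j, w j) ≤ lh (w 0) + P + c := by
    refine lh_sum_le_of_logs fun j => ?_
    by_cases hj : j = 0
    · rw [hj]; linarith
    · have : lh (w j) ≤ lh (w 1) := Real.log_le_log (par_pos _) (hw.2.1 j hj)
      linarith [lh_nonneg (w 0)]
  set z := ∑ j, w j
  have hlog := log_weight_le_of_modulation hs₂ hε0 hε1 hk₀ hh₀ (lh_le (h0 0))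
  have hW := log_fullWeight_le_sum (by linarith : 0 ≤ s₁) hs₂ hε0.le w
  have hPp : 0 < ∏ j, fullWeight s₁ s₂ ε (w j) :=
    Finset.prod_pos fun j _ => fullWeight_pos _ _ _ _
  calc _ ≤ 2 * Real.exp ((1 + s₁ - ε) * lk z + (s₂ + ε) * lh z)
        / (∏ j, fullWeight s₁ s₂ ε (w j)) * Real.exp (-(s₂ + ε + 3) * P) :=
        mul_le_mul_of_nonneg_right (div_le_div_of_nonneg_right
          (abs_freqX_mul_fullWeight_le hε0 hε₁ z) hPp.le) (Real.exp_pos _).le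
    _ = 2 * Real.exp ((1 + s₁ - ε) * lk z + (s₂ + ε) * lh z - (s₁ * (∑ j, lk (w j))
        + s₂ * (∑ j, lh (w j)) + ε * ∑ j, lv (w j)) + -(s₂ + ε + 3) * P) := by
        rw [prod_fullWeight_eq, Real.exp_add _ (-(s₂ + ε + 3) * P), Real.exp_sub]
        ring
    _ ≤ 2 * Real.exp ((1 + s₁ + s₂) * c + (lk (w 0) + -3 * P)) :=
        mul_le_mul_of_nonneg_left (Real.exp_le_exp.2 (by linarith)) (by norm_num)
    _ = _ := by
        rw [Real.exp_add, Real.exp_add, lk, Real.exp_log (kap_pos _)]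
        ring

/-- As `δ ≤ 1/2` and `lh ≤ lk + lv`, a Sobolev weight is at least `exp (-2 (lk + lv))`. Two of the
three units of `restSize` thus pay for all Sobolev weights, and the third one pays for `vel (w 1)`.
-/
theorem exp_restSize_le (hδ : 0 < δ) (hδ₂ : δ ≤ 1 / 2) (w : Fin (n + 3) → SpaceTime)
    (h0 : ∀ j, freqX (w j) ≠ 0) :
    Real.exp (-3 * restSize w) ≤ (1 + |freqY (w 1)|) ^ (-1 : ℝ)
        * (sobolevWeight δ (w 2) * ∏ i : Fin n, sobolevWeight δ (w i.succ.succ.succ)) ∧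
    vel (w 1) * Real.exp (-3 * restSize w) ≤ sobolevWeight δ (w 1)
        * (sobolevWeight δ (w 2) * ∏ i : Fin n, sobolevWeight δ (w i.succ.succ.succ)) := by
  have hSle := sum_lh_le h0
  have hSr := prod_exp_le_sobolevWeight hδ fun i : Fin n => w i.succ.succ.succ
  have hP : restSize w = lk (w 1) + lv (w 1) + lk (w 2) + lv (w 2)
    + (∑ i : Fin n, lk (w i.succ.succ.succ)) + ∑ i : Fin n, lv (w i.succ.succ.succ) := rfl
  set Sk := ∑ i : Fin n, lk (w i.succ.succ.succ)
  set Sh := ∑ i : Fin n, lh (w i.succ.succ.succ)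
  set Sn := ∑ i : Fin n, lv (w i.succ.succ.succ)
  have hSk : 0 ≤ Sk := Finset.sum_nonneg fun i _ => lk_nonneg _
  have hSh : 0 ≤ Sh := Finset.sum_nonneg fun i _ => lh_nonneg _
  have hSn : 0 ≤ Sn := Finset.sum_nonneg fun i _ => lv_nonneg _
  have n1 := lk_nonneg (w 1)
  have n2 := lk_nonneg (w 2)
  have n3 := lv_nonneg (w 1)
  have n4 := lv_nonneg (w 2)
  have n6 := lh_nonneg (w 1)
  have n7 := lh_nonneg (w 2)
  have l1 := lh_le (h0 1)
  have l2 := lh_le (h0 2)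
  have aux : ∀ x y : ℝ, 0 ≤ x + y → (1 / 2 + δ) * (x + y) ≤ x + y := fun x y h => by
    nlinarith
  have hS1 : Real.exp (-(lk (w 1) + lv (w 1)) * 2) ≤ sobolevWeight δ (w 1) := by
    refine le_trans (Real.exp_le_exp.2 ?_) (exp_le_sobolevWeight hδ (w 1))
    linarith [aux (lk (w 1)) (lh (w 1)) (by linarith)]
  have hS2 : Real.exp (-(lk (w 2) + lv (w 2)) * 2) ≤ sobolevWeight δ (w 2) := by
    refine le_trans (Real.exp_le_exp.2 ?_) (exp_le_sobolevWeight hδ (w 2))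
    linarith [aux (lk (w 2)) (lh (w 2)) (by linarith)]
  have hSr' : Real.exp (-(Sk + Sn) * 2)
      ≤ ∏ i : Fin n, sobolevWeight δ (w i.succ.succ.succ) := by
    refine le_trans (Real.exp_le_exp.2 ?_) hSr
    linarith [aux Sk Sh (by linarith)]
  have hY : Real.exp (-(lk (w 1) + lv (w 1))) ≤ (1 + |freqY (w 1)|) ^ (-1 : ℝ) := by
    calc Real.exp (-(lk (w 1) + lv (w 1))) ≤ Real.exp (-1 * lh (w 1)) :=
          Real.exp_le_exp.2 (by linarith)
      _ = par (w 1) ^ (-1 : ℝ) := by rw [par_rpow]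
      _ ≤ _ := Real.rpow_le_rpow_of_nonpos (by positivity) (one_add_freqY_le _) (by norm_num)
  have hrest : Real.exp (-(lk (w 2) + lv (w 2)) * 2 + -(Sk + Sn) * 2)
      ≤ sobolevWeight δ (w 2) * ∏ i : Fin n, sobolevWeight δ (w i.succ.succ.succ) := by
    rw [Real.exp_add]
    exact mul_le_mul hS2 hSr' (Real.exp_pos _).le (sobolevWeight_nonneg _ _)
  constructor
  · calc Real.exp (-3 * restSize w) ≤ Real.exp (-(lk (w 1) + lv (w 1))
            + (-(lk (w 2) + lv (w 2)) * 2 + -(Sk + Sn) * 2)) :=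
            Real.exp_le_exp.2 (by linarith)
      _ ≤ _ := by
          rw [Real.exp_add]
          exact mul_le_mul hY hrest (Real.exp_pos _).le (by positivity)
  · calc vel (w 1) * Real.exp (-3 * restSize w) = Real.exp (lv (w 1) + -3 * restSize w) := by
          rw [Real.exp_add, lv, Real.exp_log (vel_pos _)]
      _ ≤ Real.exp (-(lk (w 1) + lv (w 1)) * 2
            + (-(lk (w 2) + lv (w 2)) * 2 + -(Sk + Sn) * 2)) :=
            Real.exp_le_exp.2 (by linarith)
      _ ≤ _ := by
          rw [Real.exp_add]
          exact mul_le_mul hS1 hrest (Real.exp_pos _).le (sobolevWeight_nonneg _ _)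

/-- The pairs of frequencies in which the first one is much faster than the second one. -/
def fastSet : Set (SpaceTime × SpaceTime) :=
  {z | freqX z.2 ≠ 0 ∧ 4 * (|freqX z.2| + |velocity z.2|) ≤ |freqX z.1|}

/-- A dichotomy for the remaining factor `kap (w 0)`. Either factor 0 is much faster than factor 1
with `|k| ≥ 1`, and `|k|` is left to the smoothing in `x`; or `kap (w 0) ≤ 5 * vel (w 1)`, which the
spare exponential absorbs. -/
theorem pointwise_large (hs₂ : 0 ≤ s₂) (hε0 : 0 < ε) (hε₁ : ε ≤ 1) (hε1 : ε ≤ s₁)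
    (hδ : 0 < δ) (hδ₂ : δ ≤ 1 / 2) {w : Fin (n + 3) → SpaceTime}
    (hw : Ordered w) (h0 : ∀ j, freqX (w j) ≠ 0) :
    |freqX (∑ j, w j)| * fullWeight s₁ s₂ ε (∑ j, w j) / (∏ j, fullWeight s₁ s₂ ε (w j))
        * Real.exp (-(s₂ + ε + 3) * restSize w)
      ≤ 10 * Real.exp ((1 + s₁ + s₂) * Real.log (3 * (n + 3) ^ 2))
        * ((fastSet.indicator (fun z => |freqX z.1|) (w 0, w 1) * (1 + |freqY (w 1)|) ^ (-1 : ℝ)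
            + sobolevWeight δ (w 1))
          * (sobolevWeight δ (w 2) * ∏ i : Fin n, sobolevWeight δ (w i.succ.succ.succ))) := by
  refine (weight_quotient_le_of_large hs₂ hε0 hε₁ hε1 hw h0).trans ?_
  obtain ⟨hE1, hE2⟩ := exp_restSize_le hδ hδ₂ w h0
  set K := Real.exp ((1 + s₁ + s₂) * Real.log (3 * (n + 3) ^ 2))
  have hK : 0 < K := Real.exp_pos _
  set Y : ℝ := (1 + |freqY (w 1)|) ^ (-1 : ℝ)
  have hY : 0 ≤ Y := by positivity
  set T := sobolevWeight δ (w 2) * ∏ i : Fin n, sobolevWeight δ (w i.succ.succ.succ)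
  have hT : 0 ≤ T := mul_nonneg (sobolevWeight_nonneg _ _)
    (Finset.prod_nonneg fun i _ => sobolevWeight_nonneg _ _)
  set X := Real.exp (-3 * restSize w)
  have hX : 0 < X := Real.exp_pos _
  set S := sobolevWeight δ (w 1)
  have hS : 0 ≤ S := sobolevWeight_nonneg _ _
  have hind : 0 ≤ fastSet.indicator (fun z => |freqX z.1|) (w 0, w 1) :=
    Set.indicator_nonneg (fun z _ => abs_nonneg _) _
  suffices h : kap (w 0) * X
      ≤ 5 * ((fastSet.indicator (fun z => |freqX z.1|) (w 0, w 1) * Y + S) * T) by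
    calc 2 * K * (kap (w 0) * X) ≤ 2 * K * _ := mul_le_mul_of_nonneg_left h (by positivity)
      _ = _ := by ring
  by_cases hfast : 1 ≤ |freqX (w 0)| ∧ 4 * (|freqX (w 1)| + |velocity (w 1)|) ≤ |freqX (w 0)|
  · rw [Set.indicator_of_mem (by exact ⟨h0 1, hfast.2⟩)]
    have hk2 : kap (w 0) ≤ 2 * |freqX (w 0)| := by unfold kap; linarith [hfast.1]
    have e1 : kap (w 0) * X ≤ 2 * |freqX (w 0)| * (Y * T) :=
      mul_le_mul hk2 hE1 hX.le (by positivity)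
    have e2 : 0 ≤ |freqX (w 0)| * Y * T := by positivity
    have e3 : 0 ≤ S * T := by positivity
    simp only
    linarith
  · have hk5 : kap (w 0) ≤ 5 * vel (w 1) := by
      unfold kap vel
      have a1 := abs_nonneg (freqX (w 1))
      have a2 := abs_nonneg (velocity (w 1))
      by_cases h1 : 1 ≤ |freqX (w 0)|
      · have := lt_of_not_ge fun h => hfast ⟨h1, h⟩
        linarith
      · push Not at h1
        linarith
    have e1 : kap (w 0) * X ≤ 5 * vel (w 1) * X := mul_le_mul_of_nonneg_right hk5 hX.le
    have e3 : 0 ≤ fastSet.indicator (fun z => |freqX z.1|) (w 0, w 1) * Y * T := by positivity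
    linarith

end Pointwise

/-! ### Forms in which two or three factors are coupled. -/

section Forms

variable {E : Type*} [AddCommGroup E] [MeasureSpace E] [MeasurableAdd₂ E] [MeasurableNeg E]
  [SigmaFinite (volume : Measure E)] [(volume : Measure E).IsAddLeftInvariant]
  [(volume : Measure E).IsNegInvariant]

/-- Young's inequality. -/
theorem convSq_le_of_lintegral {f g : E → ℝ≥0∞} (hf : Measurable f) (hg : Measurable g) :
    convSq (fun x y => f x * g y) ≤ (∫⁻ x, f x ^ 2) * (∫⁻ x, g x) ^ 2 := by
  have h1 : ∀ ζ ζ', ∫⁻ a, f a * f (a + ζ - ζ') ≤ ∫⁻ x, f x ^ 2 := by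
    intro ζ ζ'
    have h2 : Measurable fun a => f (a + ζ - ζ') := by fun_prop
    refine le_of_sq_le ((sq_lintegral_mul_le volume hf.aemeasurable h2.aemeasurable).trans ?_)
    have : ∫⁻ a, f (a + ζ - ζ') ^ 2 = ∫⁻ a, f a ^ 2 := by
      simp only [add_sub_assoc]
      exact lintegral_add_right_eq_self (fun a => f a ^ 2) (ζ - ζ')
    rw [this, sq]
  rw [convSq_mul_eq hf hg]
  calc ∫⁻ ζ, ∫⁻ ζ', ∫⁻ a, f a * f (a + ζ - ζ') * (g ζ * g ζ')
      ≤ ∫⁻ ζ, ∫⁻ ζ', (∫⁻ x, f x ^ 2) * (g ζ * g ζ') := by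
        refine lintegral_mono fun ζ => lintegral_mono fun ζ' => ?_
        rw [lintegral_mul_const _ (by fun_prop)]
        exact mul_le_mul_left (h1 ζ ζ') _
    _ = _ := by
        have h3 : ∀ ζ, ∫⁻ ζ', (∫⁻ x, f x ^ 2) * (g ζ * g ζ')
            = (∫⁻ x, f x ^ 2) * (∫⁻ x, g x) * g ζ := fun ζ => by
          simp only [← mul_assoc]
          rw [lintegral_const_mul _ hg]
          ring
        simp only [h3]
        rw [lintegral_const_mul _ hg]
        ring

/-- A multilinear form with two factors coupled by a kernel, and the other ones integrated. -/
theorem sq_form_two_le {n : ℕ} {A : E → E → ℝ≥0∞} (hA : Measurable (Function.uncurry A))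
    {F : E → ℝ≥0∞} (hF : Measurable F) {g : Fin n → E → ℝ≥0∞} (hg : ∀ i, Measurable (g i)) :
    (∫⁻ w : Fin (n + 2) → E,
        A (w 0) (w 1) * (F (∑ j, w j) * ∏ i : Fin n, g i (w i.succ.succ))) ^ 2
      ≤ convSq A * (∫⁻ x, F x ^ 2) * ∏ i, (∫⁻ x, g i x) ^ 2 := by
  refine le_of_eq_of_le ?_ (sq_form_le hA hF hg)
  have hm : Measurable fun w : Fin (n + 2) → E =>
      A (w 0) (w 1) * (F (∑ j, w j) * ∏ i : Fin n, g i (w i.succ.succ)) := by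
    have : Measurable fun w : Fin (n + 2) → E => A (w 0) (w 1) :=
      hA.comp (f := fun w : Fin (n + 2) → E => (w 0, w 1)) (by fun_prop)
    have : Measurable fun w : Fin (n + 2) → E => ∑ j, w j :=
      Finset.measurable_fun_sum _ fun i _ => measurable_pi_apply i
    fun_prop
  rw [lintegral_fin_cons _ hm]
  congr 1
  refine lintegral_congr fun x => ?_
  have hm2 := hm.comp (measurable_fin_cons.comp (measurable_prodMk_left (x := x)))
  simp only [Function.comp_def] at hm2
  rw [lintegral_fin_cons _ hm2]
  refine lintegral_congr fun y => lintegral_congr fun w => ?_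
  simp only [Fin.sum_univ_succ, Fin.cons_zero, Fin.cons_succ, Fin.cons_one]

/-- A multilinear form with two factors coupled by a kernel, a third one coupled to the
output, and the other ones integrated. -/
theorem sq_form_three_le {n : ℕ} {A : E → E → ℝ≥0∞} (hA : Measurable (Function.uncurry A))
    {F h : E → ℝ≥0∞} (hF : Measurable F) (hh : Measurable h) {g : Fin n → E → ℝ≥0∞}
    (hg : ∀ i, Measurable (g i)) :
    (∫⁻ w : Fin (n + 3) → E, A (w 0) (w 1)
        * (F (∑ j, w j) * (h (w 2) * ∏ i : Fin n, g i (w i.succ.succ.succ)))) ^ 2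
      ≤ convSq A * convSq (fun x y => F x * h y) * ∏ i, (∫⁻ x, g i x) ^ 2 := by
  -- Integrating the third factor against the dual function first gives a new dual function, whose
  -- `L²` norm is a bilinear quantity.
  set G : E → ℝ≥0∞ := fun ω => ∫⁻ z, F (ω + z) * h z
  have hG : Measurable G := by
    refine Measurable.lintegral_prod_right' (f := fun p : E × E => F (p.1 + p.2) * h p.2) ?_
    fun_prop
  rw [← lintegral_correlation_sq hF hh]
  refine le_of_eq_of_le ?_ (sq_form_le hA hG hg)
  have hm : Measurable fun w : Fin (n + 3) → E => A (w 0) (w 1)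
        * (F (∑ j, w j) * (h (w 2) * ∏ i : Fin n, g i (w i.succ.succ.succ))) := by
    have : Measurable fun w : Fin (n + 3) → E => A (w 0) (w 1) :=
      hA.comp (f := fun w : Fin (n + 3) → E => (w 0, w 1)) (by fun_prop)
    have : Measurable fun w : Fin (n + 3) → E => ∑ j, w j :=
      Finset.measurable_fun_sum _ fun i _ => measurable_pi_apply i
    fun_prop
  rw [lintegral_fin_cons _ hm]
  congr 1
  refine lintegral_congr fun x => ?_
  have hm2 := hm.comp (measurable_fin_cons.comp (measurable_prodMk_left (x := x)))
  simp only [Function.comp_def] at hm2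
  rw [lintegral_fin_cons _ hm2]
  refine lintegral_congr fun y => ?_
  have hm3 := hm2.comp (measurable_fin_cons.comp (measurable_prodMk_left (x := y)))
  simp only [Function.comp_def] at hm3
  rw [lintegral_fin_cons _ hm3, lintegral_lintegral_swap]
  · refine lintegral_congr fun w => ?_
    have h2 : (2 : Fin (n + 3)) = (0 : Fin (n + 1)).succ.succ := rfl
    have h1 : (1 : Fin (n + 3)) = (0 : Fin (n + 2)).succ := rfl
    simp only [h1, h2, Fin.sum_univ_succ, Fin.cons_zero, Fin.cons_succ]
    have e : ∀ z, A x y * (F (x + (y + (z + ∑ i, w i))) * (h z * ∏ i, g i (w i)))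
        = (A x y * ∏ i, g i (w i)) * (F (x + (y + ∑ i, w i) + z) * h z) := fun z => by
      rw [show x + (y + (z + ∑ i, w i)) = x + (y + ∑ i, w i) + z by abel]
      ring
    simp only [e]
    rw [lintegral_const_mul _ (by fun_prop)]
    simp only [G]
    ring
  · exact ((hm3.comp measurable_fin_cons)).aemeasurable

end Forms

/-! ### Reduction to ordered frequency configurations by permutations. -/

section Symmetry

variable {E : Type*} [MeasureSpace E] [SigmaFinite (volume : Measure E)]

/-- Symmetrization: it suffices to bound a symmetric form on a fundamental domain. -/
theorem sq_lintegral_le_of_perm {m : ℕ} {S : Set (Fin m → E)} (hS : MeasurableSet S)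
    (hcov : ∀ w : Fin m → E, ∃ σ : Equiv.Perm (Fin m), (fun j => w (σ j)) ∈ S)
    {M : (Fin m → E) → ℝ≥0∞} (hM : Measurable M)
    (hMs : ∀ (σ : Equiv.Perm (Fin m)) (w : Fin m → E), M (fun j => w (σ j)) = M w)
    {f : Fin m → E → ℝ≥0∞} (hf : ∀ j, Measurable (f j)) {B : ℝ≥0∞}
    (H : ∀ σ : Equiv.Perm (Fin m),
      (∫⁻ w, S.indicator (fun w => M w * ∏ j, f (σ j) (w j)) w) ^ 2 ≤ B) :
    (∫⁻ w, M w * ∏ j, f j (w j)) ^ 2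
      ≤ 2 ^ Fintype.card (Equiv.Perm (Fin m)) * Fintype.card (Equiv.Perm (Fin m)) * B := by
  have h1 : ∫⁻ w, M w * ∏ j, f j (w j)
      ≤ ∑ σ : Equiv.Perm (Fin m), ∫⁻ w, S.indicator (fun w => M w * ∏ j, f (σ j) (w j)) w := by
    have e : ∀ σ : Equiv.Perm (Fin m),
        ∫⁻ w, S.indicator (fun w => M w * ∏ j, f (σ j) (w j)) w
        = ∫⁻ w : Fin m → E, S.indicator (fun w => M w * ∏ j, f (σ j) (w j)) (fun j : Fin m => w (σ j)) := fun σ =>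
      (lintegral_comp_perm _ σ).symm
    simp only [e]
    rw [← lintegral_finsetSum]
    · refine lintegral_mono fun w => ?_
      -- One summand, that of a permutation moving `w` into `S`, already equals the integrand;
      -- overlaps and ties between regions do no harm.
      obtain ⟨σ, hσ⟩ := hcov w
      refine le_trans ?_ (Finset.single_le_sum (f := fun σ : Equiv.Perm (Fin m) =>
        S.indicator (fun w => M w * ∏ j, f (σ j) (w j)) (fun j => w (σ j)))
        (fun _ _ => zero_le) (Finset.mem_univ σ))
      rw [Set.indicator_of_mem hσ, hMs, Equiv.prod_comp σ fun j => f j (w j)]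
    · intro σ _
      exact ((by fun_prop : Measurable fun w : Fin m → E =>
        M w * ∏ j, f (σ j) (w j)).indicator hS).comp (by fun_prop)
  calc (∫⁻ w, M w * ∏ j, f j (w j)) ^ 2 ≤ _ := pow_le_pow_left₀ zero_le h1 2
    _ ≤ _ := ennreal_sum_sq_le _ _
    _ ≤ 2 ^ Fintype.card (Equiv.Perm (Fin m)) * ∑ _σ : Equiv.Perm (Fin m), B := by
        rw [Finset.card_univ]
        gcongr with σ
        exact H σ
    _ = _ := by
        rw [Finset.sum_const, Finset.card_univ, nsmul_eq_mul, mul_assoc]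

theorem exists_perm_of_ne {m : ℕ} {a b : Fin (m + 2)} (hab : a ≠ b) :
    ∃ σ : Equiv.Perm (Fin (m + 2)), σ 0 = a ∧ σ 1 = b := by
  refine ⟨(Equiv.swap (Equiv.swap 0 a 1) b) * Equiv.swap 0 a, ?_, ?_⟩
  · rw [Equiv.Perm.mul_apply, Equiv.swap_apply_left, Equiv.swap_apply_of_ne_of_ne _ hab]
    intro h
    have := congrArg (Equiv.swap 0 a) h
    simp at this
  · rw [Equiv.Perm.mul_apply, Equiv.swap_apply_left]

theorem exists_perm_of_ne₃ {m : ℕ} {a b c : Fin (m + 3)} (hab : a ≠ b) (hac : a ≠ c)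
    (hbc : b ≠ c) : ∃ σ : Equiv.Perm (Fin (m + 3)), σ 0 = a ∧ σ 1 = b ∧ σ 2 = c := by
  obtain ⟨σ, h0, h1⟩ := exists_perm_of_ne hab
  refine ⟨Equiv.swap (σ 2) c * σ, ?_, ?_, ?_⟩
  · rw [Equiv.Perm.mul_apply, h0, Equiv.swap_apply_of_ne_of_ne _ hac]
    rw [← h0]
    exact fun h => Fin.succ_ne_zero (1 : Fin (m + 2)) (σ.injective h).symm
  · rw [Equiv.Perm.mul_apply, h1, Equiv.swap_apply_of_ne_of_ne _ hbc]
    rw [← h1]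
    exact fun h => Fin.succ_ne_zero (0 : Fin (m + 1)) (Fin.succ_injective _
      (show (0 : Fin (m + 2)).succ = (0 : Fin (m + 1)).succ.succ from σ.injective h)).symm
  · rw [Equiv.Perm.mul_apply, Equiv.swap_apply_left]

theorem exists_perm_ordered {n : ℕ} (w : Fin (n + 3) → SpaceTime) :
    ∃ σ : Equiv.Perm (Fin (n + 3)), Ordered fun j => w (σ j) := by
  obtain ⟨a, -, ha⟩ := Finset.exists_max_image Finset.univ (fun j => kap (w j))
    Finset.univ_nonempty
  have n1 : (Finset.univ.erase a).Nonempty := by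
    rw [← Finset.card_pos, Finset.card_erase_of_mem (Finset.mem_univ _)]
    simp
  obtain ⟨b, hb, hb'⟩ := Finset.exists_max_image (Finset.univ.erase a) (fun j => par (w j)) n1
  have n2 : ((Finset.univ.erase a).erase b).Nonempty := by
    rw [← Finset.card_pos, Finset.card_erase_of_mem hb,
      Finset.card_erase_of_mem (Finset.mem_univ _)]
    simp
  obtain ⟨c, hc, hc'⟩ := Finset.exists_max_image ((Finset.univ.erase a).erase b)
    (fun j => par (w j)) n2
  have hba := Finset.ne_of_mem_erase hb
  have hcb := Finset.ne_of_mem_erase hc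
  have hca := Finset.ne_of_mem_erase (Finset.mem_of_mem_erase hc)
  obtain ⟨σ, h0, h1, h2⟩ := exists_perm_of_ne₃ hba.symm hca.symm hcb.symm
  have hne : ∀ {i j}, i ≠ j → σ i ≠ σ j := fun h h' => h (σ.injective h')
  refine ⟨σ, fun j => ?_, fun j hj => ?_, fun i => ?_⟩
  · beta_reduce
    rw [h0]
    exact ha _ (Finset.mem_univ _)
  · beta_reduce
    rw [h1]
    refine hb' _ (Finset.mem_erase.2 ⟨?_, Finset.mem_univ _⟩)
    rw [← h0]
    exact hne hj
  · beta_reduce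
    rw [h2]
    refine hc' _ (Finset.mem_erase.2 ⟨?_, Finset.mem_erase.2 ⟨?_, Finset.mem_univ _⟩⟩)
    · rw [← h1]
      exact hne fun h => by simp [Fin.ext_iff] at h
    · rw [← h0]
      exact hne (Fin.succ_ne_zero _)

/-- The frequency configuration in which factors `0` and `1` have the largest anisotropic sizes. -/
def ParOrdered {n : ℕ} (w : Fin (n + 2) → SpaceTime) : Prop :=
  (∀ j, par (w j) ≤ par (w 0)) ∧ ∀ i : Fin n, par (w i.succ.succ) ≤ par (w 1)

theorem exists_perm_parOrdered {n : ℕ} (w : Fin (n + 2) → SpaceTime) :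
    ∃ σ : Equiv.Perm (Fin (n + 2)), ParOrdered fun j => w (σ j) := by
  obtain ⟨a, -, ha⟩ := Finset.exists_max_image Finset.univ (fun j => par (w j))
    Finset.univ_nonempty
  have n1 : (Finset.univ.erase a).Nonempty := by
    rw [← Finset.card_pos, Finset.card_erase_of_mem (Finset.mem_univ _)]
    simp
  obtain ⟨b, hb, hb'⟩ := Finset.exists_max_image (Finset.univ.erase a) (fun j => par (w j)) n1
  obtain ⟨σ, h0, h1⟩ := exists_perm_of_ne (Finset.ne_of_mem_erase hb).symm
  refine ⟨σ, fun j => ?_, fun i => ?_⟩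
  · beta_reduce
    rw [h0]
    exact ha _ (Finset.mem_univ _)
  · beta_reduce
    rw [h1]
    refine hb' _ (Finset.mem_erase.2 ⟨?_, Finset.mem_univ _⟩)
    rw [← h0]
    exact fun h => Fin.succ_ne_zero _ (σ.injective h)

theorem measurableSet_ordered {n : ℕ} :
    MeasurableSet {w : Fin (n + 3) → SpaceTime | Ordered w} := by
  have h1 := measurable_kap
  have h2 := measurable_par
  simp only [Ordered, Set.ofPred_and, Set.ofPred_forall]
  refine (MeasurableSet.iInter fun j => measurableSet_le (by fun_prop) (by fun_prop)).inter
    ((MeasurableSet.iInter fun j => MeasurableSet.iInter fun _ =>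
      measurableSet_le (by fun_prop) (by fun_prop)).inter
    (MeasurableSet.iInter fun j => measurableSet_le (by fun_prop) (by fun_prop)))

theorem measurableSet_parOrdered {n : ℕ} :
    MeasurableSet {w : Fin (n + 2) → SpaceTime | ParOrdered w} := by
  have h2 := measurable_par
  simp only [ParOrdered, Set.ofPred_and, Set.ofPred_forall]
  refine (MeasurableSet.iInter fun j => measurableSet_le (by fun_prop) (by fun_prop)).inter
    (MeasurableSet.iInter fun j => measurableSet_le (by fun_prop) (by fun_prop))

end Symmetry

/-! ### The multilinear estimate in dual form. -/

section MainForm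

/-- The symbol of the multilinear form dual to the multilinear estimate. -/
noncomputable def formSymbol (s₁ s₂ ε b' : ℝ) {m : ℕ} (w : Fin m → SpaceTime) : ℝ≥0∞ :=
  ENNReal.ofReal (|freqX (∑ j, w j)| * fullWeight s₁ s₂ ε (∑ j, w j)
    / ∏ j, fullWeight s₁ s₂ ε (w j)) * decay (-b') (modulation (∑ j, w j))

theorem measurable_sum_apply {m : ℕ} : Measurable fun w : Fin m → SpaceTime => ∑ j, w j :=
  Finset.measurable_fun_sum _ fun i _ => measurable_pi_apply i

theorem measurable_formSymbol (s₁ s₂ ε b' : ℝ) {m : ℕ} :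
    Measurable (formSymbol s₁ s₂ ε b' : (Fin m → SpaceTime) → ℝ≥0∞) := by
  have h1 := measurable_freqX
  have h2 := measurable_fullWeight s₁ s₂ ε
  have h3 := measurable_modulation
  have h4 := measurable_decay (-b')
  have h5 := measurable_sum_apply (m := m)
  unfold formSymbol
  fun_prop

theorem formSymbol_perm (s₁ s₂ ε b' : ℝ) {m : ℕ} (σ : Equiv.Perm (Fin m))
    (w : Fin m → SpaceTime) :
    formSymbol s₁ s₂ ε b' (fun j => w (σ j)) = formSymbol s₁ s₂ ε b' w := by
  simp only [formSymbol]
  rw [Equiv.sum_comp σ w, Equiv.prod_comp σ fun j => fullWeight s₁ s₂ ε (w j)]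

variable {n : ℕ} {s₁ s₂ ε δ : ℝ}

theorem formSymbol_eq (s₁ s₂ ε b' : ℝ) {m : ℕ} (w : Fin m → SpaceTime) :
    formSymbol s₁ s₂ ε b' w = ENNReal.ofReal (|freqX (∑ j, w j)| * fullWeight s₁ s₂ ε (∑ j, w j)
      / (∏ j, fullWeight s₁ s₂ ε (w j)) * Real.exp (b' * lm (∑ j, w j))) := by
  rw [formSymbol, decay_modulation, neg_neg, ENNReal.ofReal_mul' (Real.exp_pos _).le]

theorem weight_quotient_nonneg (s₁ s₂ ε : ℝ) {m : ℕ} (w : Fin m → SpaceTime) :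
    0 ≤ |freqX (∑ j, w j)| * fullWeight s₁ s₂ ε (∑ j, w j) / ∏ j, fullWeight s₁ s₂ ε (w j) :=
  div_nonneg (mul_nonneg (abs_nonneg _) (fullWeight_pos _ _ _ _).le)
    (Finset.prod_nonneg fun _ _ => (fullWeight_pos _ _ _ _).le)

/-- The hypothesis on the modulation trades the exponent `b'` for `-p / 2`, at the price of the
exponential that `pointwise_moderate` provides. With `p > 1` the dual function may then enter a
bilinear estimate like any other factor. -/
theorem formSymbol_le_moderate (hs₂ : (n : ℝ) / (2 * (n + 2)) ≤ s₂) (hε0 : 0 < ε) (hε₁ : ε ≤ 1)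
    (hε1 : ε ≤ s₁) (hδ : 0 < δ) (hδ₁ : 1 / 2 + 2 * δ ≤ s₁) (hδε : 3 * δ ≤ ε)
    (hδn : δ ≤ 1 / (n + 2)) {p b' : ℝ} {w : Fin (n + 3) → SpaceTime} (hw : Ordered w)
    (h0 : ∀ j, freqX (w j) ≠ 0)
    (hm : b' * lm (∑ j, w j) ≤ -(p / 2) * lm (∑ j, w j) + δ * restSize w) :
    formSymbol s₁ s₂ ε b' w
      ≤ ENNReal.ofReal (2 * Real.exp ((3 + s₁ + s₂) * Real.log (3 * (n + 3) ^ 2)))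
        * (ENNReal.ofReal (kap (∑ j, w j) ^ (1 / 2 : ℝ)) * decay (p / 2) (modulation (∑ j, w j))
          * ((ENNReal.ofReal (kap (w 0) ^ (1 / 2 : ℝ))
              + ENNReal.ofReal (|velocity (w 0) - velocity (w 1)| ^ (1 / 2 : ℝ)))
          * (ENNReal.ofReal (kap (w 1) ^ (-(1 + 2 * δ) / 2))
            * (ENNReal.ofReal (kap (w 2) ^ (-(1 + 2 * δ) / 2))
            * ∏ i : Fin n, ENNReal.ofReal (sobolevWeight δ (w i.succ.succ.succ)))))) := by
  have hpt := pointwise_moderate hs₂ hε0 hε₁ hε1 hδ hδ₁ hδε hδn hw h0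
  have hQ := weight_quotient_nonneg s₁ s₂ ε w
  have p0 := kap_pos (w 0)
  have p1 := kap_pos (w 1)
  have p2 := kap_pos (w 2)
  have pz := kap_pos (∑ j, w j)
  set Q := |freqX (∑ j, w j)| * fullWeight s₁ s₂ ε (∑ j, w j) / ∏ j, fullWeight s₁ s₂ ε (w j)
  set K := 2 * Real.exp ((3 + s₁ + s₂) * Real.log (3 * (n + 3) ^ 2))
  have hK : 0 ≤ K := by positivity
  rw [decay_modulation, ← ENNReal.ofReal_prod_of_nonneg fun i _ => sobolevWeight_nonneg _ _,
    ← ENNReal.ofReal_mul (by positivity), ← ENNReal.ofReal_mul (by positivity),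
    ← ENNReal.ofReal_add (by positivity) (by positivity), ← ENNReal.ofReal_mul (by positivity),
    ← ENNReal.ofReal_mul (by positivity), ← ENNReal.ofReal_mul (by positivity),
    ← ENNReal.ofReal_mul hK, formSymbol_eq]
  refine ENNReal.ofReal_le_ofReal ?_
  calc Q * Real.exp (b' * lm (∑ j, w j))
      ≤ Q * Real.exp (-(p / 2) * lm (∑ j, w j) + δ * restSize w) :=
        mul_le_mul_of_nonneg_left (Real.exp_le_exp.2 hm) hQ
    _ = Real.exp (-(p / 2) * lm (∑ j, w j)) * (Q * Real.exp (δ * restSize w)) := by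
        rw [Real.exp_add]
        ring
    _ ≤ _ := mul_le_mul_of_nonneg_left hpt (Real.exp_pos _).le
    _ = _ := by ring

/-- The whole modulation weight is spent on the sizes of the factors other than 0. The dual function
keeps no weight and will enter only through its `L²` norm. -/
theorem formSymbol_le_large (hs₂ : 0 ≤ s₂) (hε0 : 0 < ε) (hε₁ : ε ≤ 1) (hε1 : ε ≤ s₁)
    (hδ : 0 < δ) (hδ₂ : δ ≤ 1 / 2) {b' : ℝ} {w : Fin (n + 3) → SpaceTime}
    (hw : Ordered w) (h0 : ∀ j, freqX (w j) ≠ 0)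
    (hm : b' * lm (∑ j, w j) ≤ -(s₂ + ε + 3) * restSize w) :
    formSymbol s₁ s₂ ε b' w
      ≤ ENNReal.ofReal (10 * Real.exp ((1 + s₁ + s₂) * Real.log (3 * (n + 3) ^ 2)))
        * ((fastSet.indicator (fun z => ENNReal.ofReal |freqX z.1|) (w 0, w 1)
            * ENNReal.ofReal ((1 + |freqY (w 1)|) ^ (-1 : ℝ))
            + ENNReal.ofReal (sobolevWeight δ (w 1)))
          * (ENNReal.ofReal (sobolevWeight δ (w 2))
            * ∏ i : Fin n, ENNReal.ofReal (sobolevWeight δ (w i.succ.succ.succ)))) := by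
  have hpt := pointwise_large hs₂ hε0 hε₁ hε1 hδ hδ₂ hw h0
  have hQ := weight_quotient_nonneg s₁ s₂ ε w
  have hind : 0 ≤ fastSet.indicator (fun z => |freqX z.1|) (w 0, w 1) :=
    Set.indicator_nonneg (fun z _ => abs_nonneg _) _
  have hi : fastSet.indicator (fun z => ENNReal.ofReal |freqX z.1|) (w 0, w 1)
      = ENNReal.ofReal (fastSet.indicator (fun z => |freqX z.1|) (w 0, w 1)) := by
    by_cases h : (w 0, w 1) ∈ fastSet <;> simp [h]
  have n1 := sobolevWeight_nonneg δ (w 1)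
  have n2 := sobolevWeight_nonneg δ (w 2)
  set Q := |freqX (∑ j, w j)| * fullWeight s₁ s₂ ε (∑ j, w j) / ∏ j, fullWeight s₁ s₂ ε (w j)
  set K := 10 * Real.exp ((1 + s₁ + s₂) * Real.log (3 * (n + 3) ^ 2))
  have hK : 0 ≤ K := by positivity
  rw [hi, ← ENNReal.ofReal_prod_of_nonneg fun i _ => sobolevWeight_nonneg _ _,
    ← ENNReal.ofReal_mul n2, ← ENNReal.ofReal_mul hind, ← ENNReal.ofReal_add (by positivity) n1,
    ← ENNReal.ofReal_mul (by positivity), ← ENNReal.ofReal_mul hK, formSymbol_eq]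
  exact ENNReal.ofReal_le_ofReal
    ((mul_le_mul_of_nonneg_left (Real.exp_le_exp.2 hm) hQ).trans hpt)

/-- The part of the form with moderate output modulation. -/
theorem exists_moderate_form_le (n : ℕ) {p : ℝ} (hp : 1 < p) (hδ : 0 < δ) (hδ₂ : δ ≤ 1 / 2) :
    ∃ C : ℝ≥0, ∀ (f₀ : SpaceTime → ℝ≥0∞) (f : Fin (n + 3) → SpaceTime → ℝ≥0∞), Measurable f₀ →
      (∀ j, Measurable (f j)) →
      (∫⁻ w : Fin (n + 3) → SpaceTime, (ENNReal.ofReal (kap (∑ j, w j) ^ (1 / 2 : ℝ))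
            * decay (p / 2) (modulation (∑ j, w j))
          * ((ENNReal.ofReal (kap (w 0) ^ (1 / 2 : ℝ))
              + ENNReal.ofReal (|velocity (w 0) - velocity (w 1)| ^ (1 / 2 : ℝ)))
          * (ENNReal.ofReal (kap (w 1) ^ (-(1 + 2 * δ) / 2))
            * (ENNReal.ofReal (kap (w 2) ^ (-(1 + 2 * δ) / 2))
            * ∏ i : Fin n, ENNReal.ofReal (sobolevWeight δ (w i.succ.succ.succ)))))
          * f₀ (∑ j, w j)) * ∏ j, decay (p / 2) (modulation (w j)) * f j (w j)) ^ 2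
        ≤ C * ((∫⁻ x, f₀ x ^ 2) * ∏ j, ∫⁻ x, f j x ^ 2) := by
  obtain ⟨C₁, h₁⟩ := exists_convSq_strichartz_le hp (δ := 2 * δ) (by linarith) (by linarith)
  obtain ⟨C₂, h₂⟩ := exists_convSq_transversal_le hp (δ := 2 * δ) (by linarith)
  obtain ⟨C₃, h₃⟩ := exists_lintegral_sobolev_le hp (δ := 2 * δ) (by linarith)
  have m1 := measurable_velocity
  have m2 := measurable_kap
  have m3 := measurable_modulation
  have m4 := measurable_decay (p / 2)
  have m5 := measurable_sobolevWeight δ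
  refine ⟨2 * (C₁ + C₂) * C₁ * C₃ ^ n, fun f₀ f hf₀ hf => ?_⟩
  -- The pair of factors 0 and 1 is treated by Strichartz in `A₁` and by transversality in `A₂`; the
  -- dual function and factor 2 form a second Strichartz pair.
  set A₁ : SpaceTime → SpaceTime → ℝ≥0∞ := fun x y =>
    (ENNReal.ofReal (kap x ^ (1 / 2 : ℝ)) * decay (p / 2) (modulation x) * f 0 x)
      * (ENNReal.ofReal (kap y ^ (-(1 + 2 * δ) / 2)) * decay (p / 2) (modulation y) * f 1 y)
  set A₂ : SpaceTime → SpaceTime → ℝ≥0∞ := fun x y =>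
    ENNReal.ofReal (|velocity x - velocity y| ^ (1 / 2 : ℝ))
      * ((decay (p / 2) (modulation x) * f 0 x)
      * (ENNReal.ofReal (kap y ^ (-(1 + 2 * δ) / 2)) * decay (p / 2) (modulation y) * f 1 y))
  have hA₁ : Measurable (Function.uncurry A₁) := by
    simp only [A₁, Function.uncurry_def]
    fun_prop
  have hA₂ : Measurable (Function.uncurry A₂) := by
    simp only [A₂, Function.uncurry_def]
    fun_prop
  have hA : Measurable (Function.uncurry fun x y => A₁ x y + A₂ x y) := hA₁.add hA₂
  set F : SpaceTime → ℝ≥0∞ := fun x =>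
    ENNReal.ofReal (kap x ^ (1 / 2 : ℝ)) * decay (p / 2) (modulation x) * f₀ x
  set h : SpaceTime → ℝ≥0∞ := fun y =>
    ENNReal.ofReal (kap y ^ (-(1 + 2 * δ) / 2)) * decay (p / 2) (modulation y) * f 2 y
  set g : Fin n → SpaceTime → ℝ≥0∞ := fun i y =>
    ENNReal.ofReal (sobolevWeight δ y) * decay (p / 2) (modulation y) * f i.succ.succ.succ y
  have key := sq_form_three_le hA (F := F) (h := h) (by fun_prop) (by fun_prop) (g := g)
    (by fun_prop)
  have e : ∀ w : Fin (n + 3) → SpaceTime, (ENNReal.ofReal (kap (∑ j, w j) ^ (1 / 2 : ℝ))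
            * decay (p / 2) (modulation (∑ j, w j))
          * ((ENNReal.ofReal (kap (w 0) ^ (1 / 2 : ℝ))
              + ENNReal.ofReal (|velocity (w 0) - velocity (w 1)| ^ (1 / 2 : ℝ)))
          * (ENNReal.ofReal (kap (w 1) ^ (-(1 + 2 * δ) / 2))
            * (ENNReal.ofReal (kap (w 2) ^ (-(1 + 2 * δ) / 2))
            * ∏ i : Fin n, ENNReal.ofReal (sobolevWeight δ (w i.succ.succ.succ)))))
          * f₀ (∑ j, w j)) * ∏ j, decay (p / 2) (modulation (w j)) * f j (w j)
      = (A₁ (w 0) (w 1) + A₂ (w 0) (w 1))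
        * (F (∑ j, w j) * (h (w 2) * ∏ i : Fin n, g i (w i.succ.succ.succ))) := by
    intro w
    have e1 : ∏ j, decay (p / 2) (modulation (w j)) * f j (w j)
        = (decay (p / 2) (modulation (w 0)) * f 0 (w 0))
        * ((decay (p / 2) (modulation (w 1)) * f 1 (w 1))
        * ((decay (p / 2) (modulation (w 2)) * f 2 (w 2))
        * ∏ i : Fin n, decay (p / 2) (modulation (w i.succ.succ.succ))
          * f i.succ.succ.succ (w i.succ.succ.succ))) := by
      rw [Fin.prod_univ_succ, Fin.prod_univ_succ, Fin.prod_univ_succ]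
      rfl
    have e2 : ∏ i : Fin n, g i (w i.succ.succ.succ)
        = (∏ i : Fin n, ENNReal.ofReal (sobolevWeight δ (w i.succ.succ.succ)))
        * ∏ i : Fin n, decay (p / 2) (modulation (w i.succ.succ.succ))
          * f i.succ.succ.succ (w i.succ.succ.succ) := by
      rw [← Finset.prod_mul_distrib]
      refine Finset.prod_congr rfl fun i _ => ?_
      simp only [g]
      ring
    rw [e1, e2]
    simp only [A₁, A₂, F, h]
    ring
  simp only [e]
  refine key.trans ?_
  have k1 : convSq (fun x y => A₁ x y + A₂ x y)
      ≤ 2 * (C₁ + C₂) * ((∫⁻ x, f 0 x ^ 2) * ∫⁻ x, f 1 x ^ 2) := by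
    refine (convSq_add_le hA₁).trans ?_
    calc 2 * (convSq A₁ + convSq A₂)
        ≤ 2 * (C₁ * ((∫⁻ x, f 0 x ^ 2) * ∫⁻ x, f 1 x ^ 2)
          + C₂ * ((∫⁻ x, f 0 x ^ 2) * ∫⁻ x, f 1 x ^ 2)) :=
          mul_le_mul_right (add_le_add (h₁ _ _ (hf 0) (hf 1)) (h₂ _ _ (hf 0) (hf 1))) _
      _ = _ := by ring
  have k2 : ∏ i, (∫⁻ x, g i x) ^ 2 ≤ C₃ ^ n * ∏ i : Fin n, ∫⁻ x, f i.succ.succ.succ x ^ 2 := by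
    calc ∏ i, (∫⁻ x, g i x) ^ 2 ≤ ∏ i : Fin n, C₃ * ∫⁻ x, f i.succ.succ.succ x ^ 2 :=
          Finset.prod_le_prod' fun i _ => h₃ _ (hf _)
      _ = _ := by simp [Finset.prod_mul_distrib]
  calc _ ≤ (2 * (C₁ + C₂) * ((∫⁻ x, f 0 x ^ 2) * ∫⁻ x, f 1 x ^ 2))
        * (C₁ * ((∫⁻ x, f₀ x ^ 2) * ∫⁻ x, f 2 x ^ 2))
        * (C₃ ^ n * ∏ i : Fin n, ∫⁻ x, f i.succ.succ.succ x ^ 2) :=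
        mul_le_mul' (mul_le_mul' k1 (h₁ _ _ hf₀ (hf 2))) k2
    _ = _ := by
        rw [Fin.prod_univ_succ, Fin.prod_univ_succ, Fin.prod_univ_succ]
        simp only [Fin.succ_zero_eq_one, Fin.succ_one_eq_two]
        push_cast
        ring

theorem measurableSet_fastSet : MeasurableSet fastSet := by
  have h1 := measurable_freqX
  have h2 := measurable_velocity
  exact MeasurableSet.inter
    ((h1.comp measurable_snd) (measurableSet_singleton 0).compl)
    (measurableSet_le
      (f := fun z : SpaceTime × SpaceTime => 4 * (|freqX z.2| + |velocity z.2|))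
      (g := fun z => |freqX z.1|) (by fun_prop) (by fun_prop))

/-- The part of the form with large output modulation. -/
theorem exists_large_form_le (n : ℕ) {p : ℝ} (hp : 1 < p) (hδ : 0 < δ) :
    ∃ C : ℝ≥0, ∀ (f₀ : SpaceTime → ℝ≥0∞) (f : Fin (n + 3) → SpaceTime → ℝ≥0∞), Measurable f₀ →
      (∀ j, Measurable (f j)) →
      (∫⁻ w : Fin (n + 3) → SpaceTime,
        ((fastSet.indicator (fun z => ENNReal.ofReal |freqX z.1|) (w 0, w 1)
            * ENNReal.ofReal ((1 + |freqY (w 1)|) ^ (-1 : ℝ))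
            + ENNReal.ofReal (sobolevWeight δ (w 1)))
          * (ENNReal.ofReal (sobolevWeight δ (w 2))
            * ∏ i : Fin n, ENNReal.ofReal (sobolevWeight δ (w i.succ.succ.succ)))
          * f₀ (∑ j, w j)) * ∏ j, decay (p / 2) (modulation (w j)) * f j (w j)) ^ 2
        ≤ C * ((∫⁻ x, f₀ x ^ 2) * ∏ j, ∫⁻ x, f j x ^ 2) := by
  obtain ⟨C₁, h₁⟩ := exists_convSq_fast_le hp
  obtain ⟨C₃, h₃⟩ := exists_lintegral_sobolev_le hp (δ := 2 * δ) (by linarith)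
  have m0 := measurable_freqY
  have m1 := measurable_freqX
  have m3 := measurable_modulation
  have m4 := measurable_decay (p / 2)
  have m5 := measurable_sobolevWeight δ
  refine ⟨2 * (C₁ + C₃) * C₃ ^ (n + 1), fun f₀ f hf₀ hf => ?_⟩
  -- `A₁` uses the smoothing in `x`. In `A₂` no derivative is left, and Young's inequality with
  -- factor 0 in `L²` and factor 1 in the Sobolev bound suffices.
  set A₁ : SpaceTime → SpaceTime → ℝ≥0∞ := fun x y =>
    fastSet.indicator (fun z => ENNReal.ofReal |freqX z.1|) (x, y)
      * ((decay (p / 2) (modulation x) * f 0 x)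
      * (ENNReal.ofReal ((1 + |freqY y|) ^ (-1 : ℝ)) * decay (p / 2) (modulation y) * f 1 y))
  set A₂ : SpaceTime → SpaceTime → ℝ≥0∞ := fun x y =>
    (decay (p / 2) (modulation x) * f 0 x)
      * (ENNReal.ofReal (sobolevWeight δ y) * decay (p / 2) (modulation y) * f 1 y)
  have hA₁ : Measurable (Function.uncurry A₁) := by
    have hi : Measurable (fastSet.indicator fun z => ENNReal.ofReal |freqX z.1|) :=
      (by fun_prop : Measurable fun z : SpaceTime × SpaceTime =>
        ENNReal.ofReal |freqX z.1|).indicator measurableSet_fastSet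
    simp only [A₁, Function.uncurry_def]
    fun_prop
  have hA₂ : Measurable (Function.uncurry A₂) := by
    simp only [A₂, Function.uncurry_def]
    fun_prop
  have hA : Measurable (Function.uncurry fun x y => A₁ x y + A₂ x y) := hA₁.add hA₂
  set g : Fin (n + 1) → SpaceTime → ℝ≥0∞ := fun i y =>
    ENNReal.ofReal (sobolevWeight δ y) * decay (p / 2) (modulation y) * f i.succ.succ y
  have key := sq_form_two_le hA hf₀ (g := g) (by fun_prop)
  have e : ∀ w : Fin (n + 3) → SpaceTime,
        ((fastSet.indicator (fun z => ENNReal.ofReal |freqX z.1|) (w 0, w 1)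
            * ENNReal.ofReal ((1 + |freqY (w 1)|) ^ (-1 : ℝ))
            + ENNReal.ofReal (sobolevWeight δ (w 1)))
          * (ENNReal.ofReal (sobolevWeight δ (w 2))
            * ∏ i : Fin n, ENNReal.ofReal (sobolevWeight δ (w i.succ.succ.succ)))
          * f₀ (∑ j, w j)) * ∏ j, decay (p / 2) (modulation (w j)) * f j (w j)
      = (A₁ (w 0) (w 1) + A₂ (w 0) (w 1))
        * (f₀ (∑ j, w j) * ∏ i : Fin (n + 1), g i (w i.succ.succ)) := by
    intro w
    have e1 : ∏ j, decay (p / 2) (modulation (w j)) * f j (w j)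
        = (decay (p / 2) (modulation (w 0)) * f 0 (w 0))
        * ((decay (p / 2) (modulation (w 1)) * f 1 (w 1))
        * ∏ i : Fin (n + 1), decay (p / 2) (modulation (w i.succ.succ))
          * f i.succ.succ (w i.succ.succ)) := by
      rw [Fin.prod_univ_succ, Fin.prod_univ_succ]
      rfl
    have e2 : ∏ i : Fin (n + 1), g i (w i.succ.succ)
        = (ENNReal.ofReal (sobolevWeight δ (w 2))
          * ∏ i : Fin n, ENNReal.ofReal (sobolevWeight δ (w i.succ.succ.succ)))
        * ∏ i : Fin (n + 1), decay (p / 2) (modulation (w i.succ.succ))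
          * f i.succ.succ (w i.succ.succ) := by
      rw [show (ENNReal.ofReal (sobolevWeight δ (w 2))
          * ∏ i : Fin n, ENNReal.ofReal (sobolevWeight δ (w i.succ.succ.succ)))
          = ∏ i : Fin (n + 1), ENNReal.ofReal (sobolevWeight δ (w i.succ.succ)) from
            (Fin.prod_univ_succ fun i : Fin (n + 1) =>
              ENNReal.ofReal (sobolevWeight δ (w i.succ.succ))).symm, ← Finset.prod_mul_distrib]
      refine Finset.prod_congr rfl fun i _ => ?_
      simp only [g]
      ring
    rw [e1, e2]
    simp only [A₁, A₂]
    ring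
  simp only [e]
  refine key.trans ?_
  have k0 : convSq A₂ ≤ C₃ * ((∫⁻ x, f 0 x ^ 2) * ∫⁻ x, f 1 x ^ 2) := by
    refine (convSq_le_of_lintegral (by fun_prop) (by fun_prop)).trans ?_
    calc _ ≤ (∫⁻ x, f 0 x ^ 2) * (C₃ * ∫⁻ x, f 1 x ^ 2) := by
          refine mul_le_mul' (lintegral_mono fun x => pow_le_pow_left₀ zero_le ?_ 2)
            (h₃ _ (hf 1))
          exact mul_le_of_le_one_left zero_le (decay_le_one (by linarith) _)
      _ = _ := by ring
  have k1 : convSq (fun x y => A₁ x y + A₂ x y)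
      ≤ 2 * (C₁ + C₃) * ((∫⁻ x, f 0 x ^ 2) * ∫⁻ x, f 1 x ^ 2) := by
    refine (convSq_add_le hA₁).trans ?_
    calc 2 * (convSq A₁ + convSq A₂)
        ≤ 2 * (C₁ * ((∫⁻ x, f 0 x ^ 2) * ∫⁻ x, f 1 x ^ 2)
          + C₃ * ((∫⁻ x, f 0 x ^ 2) * ∫⁻ x, f 1 x ^ 2)) :=
          mul_le_mul_right (add_le_add (h₁ _ _ (hf 0) (hf 1)) k0) _
      _ = _ := by ring
  have k2 : ∏ i, (∫⁻ x, g i x) ^ 2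
      ≤ C₃ ^ (n + 1) * ∏ i : Fin (n + 1), ∫⁻ x, f i.succ.succ x ^ 2 := by
    calc ∏ i, (∫⁻ x, g i x) ^ 2 ≤ ∏ i : Fin (n + 1), C₃ * ∫⁻ x, f i.succ.succ x ^ 2 :=
          Finset.prod_le_prod' fun i _ => h₃ _ (hf _)
      _ = _ := by simp [Finset.prod_mul_distrib]
  calc _ ≤ (2 * (C₁ + C₃) * ((∫⁻ x, f 0 x ^ 2) * ∫⁻ x, f 1 x ^ 2))
        * (∫⁻ x, f₀ x ^ 2)
        * (C₃ ^ (n + 1) * ∏ i : Fin (n + 1), ∫⁻ x, f i.succ.succ x ^ 2) :=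
        mul_le_mul' (mul_le_mul' k1 le_rfl) k2
    _ = _ := by
        rw [Fin.prod_univ_succ (n := n + 2), Fin.prod_univ_succ (n := n + 1)]
        simp only [Fin.succ_zero_eq_one]
        push_cast
        ring

theorem decay_anti_exponent {p q : ℝ} (h : p ≤ q) (x : ℝ) : decay q x ≤ decay p x :=
  ENNReal.ofReal_le_ofReal (Real.rpow_le_rpow_of_exponent_le (by linarith [abs_nonneg x])
    (by linarith))

/-- The bound for the form over ordered configurations. -/
theorem exists_ordered_form_le (hs₂ : (n : ℝ) / (2 * (n + 2)) ≤ s₂) (hε0 : 0 < ε) (hε₁ : ε ≤ 1)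
    (hε1 : ε ≤ s₁) (hδ : 0 < δ) (hδ₂ : δ ≤ 1 / 2) (hδ₁ : 1 / 2 + 2 * δ ≤ s₁) (hδε : 3 * δ ≤ ε)
    (hδn : δ ≤ 1 / (n + 2)) {p b' : ℝ} (hp : 1 < p)
    (hm : ∀ m r : ℝ, 0 ≤ m → 0 ≤ r →
      b' * m ≤ -(p / 2) * m + δ * r ∨ b' * m ≤ -(s₂ + ε + 3) * r) :
    ∃ C : ℝ≥0, ∀ (f₀ : SpaceTime → ℝ≥0∞) (f : Fin (n + 3) → SpaceTime → ℝ≥0∞), Measurable f₀ →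
      (∀ j, Measurable (f j)) → (∀ j x, freqX x = 0 → f j x = 0) →
      (∫⁻ w, {w : Fin (n + 3) → SpaceTime | Ordered w}.indicator (fun w =>
        (formSymbol s₁ s₂ ε b' w * f₀ (∑ j, w j))
          * ∏ j, decay (p / 2) (modulation (w j)) * f j (w j)) w) ^ 2
        ≤ C * ((∫⁻ x, f₀ x ^ 2) * ∏ j, ∫⁻ x, f j x ^ 2) := by
  obtain ⟨C₁, h₁⟩ := exists_moderate_form_le n hp hδ hδ₂
  obtain ⟨C₂, h₂⟩ := exists_large_form_le n hp hδ
  set K₁ := 2 * Real.exp ((3 + s₁ + s₂) * Real.log (3 * (n + 3) ^ 2))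
  set K₂ := 10 * Real.exp ((1 + s₁ + s₂) * Real.log (3 * (n + 3) ^ 2))
  refine ⟨2 * (K₁.toNNReal ^ 2 * C₁ + K₂.toNNReal ^ 2 * C₂), fun f₀ f hf₀ hf hz => ?_⟩
  specialize h₁ f₀ f hf₀ hf
  specialize h₂ f₀ f hf₀ hf
  set Φ₁ : (Fin (n + 3) → SpaceTime) → ℝ≥0∞ := fun w =>
    (ENNReal.ofReal (kap (∑ j, w j) ^ (1 / 2 : ℝ))
            * decay (p / 2) (modulation (∑ j, w j))
          * ((ENNReal.ofReal (kap (w 0) ^ (1 / 2 : ℝ))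
              + ENNReal.ofReal (|velocity (w 0) - velocity (w 1)| ^ (1 / 2 : ℝ)))
          * (ENNReal.ofReal (kap (w 1) ^ (-(1 + 2 * δ) / 2))
            * (ENNReal.ofReal (kap (w 2) ^ (-(1 + 2 * δ) / 2))
            * ∏ i : Fin n, ENNReal.ofReal (sobolevWeight δ (w i.succ.succ.succ)))))
          * f₀ (∑ j, w j)) * ∏ j, decay (p / 2) (modulation (w j)) * f j (w j) with hΦ₁
  set Φ₂ : (Fin (n + 3) → SpaceTime) → ℝ≥0∞ := fun w =>
    ((fastSet.indicator (fun z => ENNReal.ofReal |freqX z.1|) (w 0, w 1)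
            * ENNReal.ofReal ((1 + |freqY (w 1)|) ^ (-1 : ℝ))
            + ENNReal.ofReal (sobolevWeight δ (w 1)))
          * (ENNReal.ofReal (sobolevWeight δ (w 2))
            * ∏ i : Fin n, ENNReal.ofReal (sobolevWeight δ (w i.succ.succ.succ)))
          * f₀ (∑ j, w j)) * ∏ j, decay (p / 2) (modulation (w j)) * f j (w j) with hΦ₂
  have mΦ₁ : Measurable Φ₁ := by
    have m1 := measurable_velocity
    have m2 := measurable_kap
    have m3 := measurable_modulation
    have m4 := measurable_decay (p / 2)
    have m5 := measurable_sobolevWeight δ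
    have m6 := measurable_sum_apply (m := n + 3)
    fun_prop
  have hs0 : 0 ≤ s₂ := le_trans (by positivity) hs₂
  have hpt : ∀ w, {w : Fin (n + 3) → SpaceTime | Ordered w}.indicator (fun w =>
        (formSymbol s₁ s₂ ε b' w * f₀ (∑ j, w j))
          * ∏ j, decay (p / 2) (modulation (w j)) * f j (w j)) w
      ≤ ENNReal.ofReal K₁ * Φ₁ w + ENNReal.ofReal K₂ * Φ₂ w := by
    intro w
    by_cases hw : Ordered w
    swap
    · rw [Set.indicator_of_notMem (show w ∉ {w | Ordered w} from hw)]
      exact zero_le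
    rw [Set.indicator_of_mem (show w ∈ {w | Ordered w} from hw)]
    by_cases h0 : ∀ j, freqX (w j) ≠ 0
    · rcases hm (lm (∑ j, w j)) (restSize w) (lm_nonneg _) (restSize_bounds w h0).1 with h | h
      · refine le_trans ?_ le_self_add
        have := formSymbol_le_moderate hs₂ hε0 hε₁ hε1 hδ hδ₁ hδε hδn hw h0 h
        simp only [hΦ₁]
        simp only [← mul_assoc] at this ⊢
        gcongr
      · refine le_trans ?_ le_add_self
        have := formSymbol_le_large hs0 hε0 hε₁ hε1 hδ hδ₂ hw h0 h
        simp only [hΦ₂]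
        simp only [← mul_assoc] at this ⊢
        gcongr
    -- Configurations with some `k = 0`, where the velocity is a default value, contribute nothing
    -- because the functions vanish there.
    · push Not at h0
      obtain ⟨j, hj⟩ := h0
      have : ∏ j, decay (p / 2) (modulation (w j)) * f j (w j) = 0 :=
        Finset.prod_eq_zero (Finset.mem_univ j) (by rw [hz j _ hj, mul_zero])
      rw [this, mul_zero]
      exact zero_le
  calc _ ≤ (∫⁻ w, ENNReal.ofReal K₁ * Φ₁ w + ENNReal.ofReal K₂ * Φ₂ w) ^ 2 :=
        pow_le_pow_left₀ zero_le (lintegral_mono hpt) 2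
    _ = (ENNReal.ofReal K₁ * (∫⁻ w, Φ₁ w) + ENNReal.ofReal K₂ * ∫⁻ w, Φ₂ w) ^ 2 := by
        rw [lintegral_add_left (by fun_prop), lintegral_const_mul' _ _ ENNReal.ofReal_ne_top,
          lintegral_const_mul' _ _ ENNReal.ofReal_ne_top]
    _ ≤ 2 * ((ENNReal.ofReal K₁ * ∫⁻ w, Φ₁ w) ^ 2 + (ENNReal.ofReal K₂ * ∫⁻ w, Φ₂ w) ^ 2) :=
        ennreal_add_sq_le _ _
    _ ≤ 2 * (ENNReal.ofReal K₁ ^ 2 * (C₁ * ((∫⁻ x, f₀ x ^ 2) * ∏ j, ∫⁻ x, f j x ^ 2))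
        + ENNReal.ofReal K₂ ^ 2 * (C₂ * ((∫⁻ x, f₀ x ^ 2) * ∏ j, ∫⁻ x, f j x ^ 2))) := by
        rw [mul_pow, mul_pow]
        gcongr
    _ = _ := by
        push_cast
        simp only [ENNReal.ofReal]
        ring

/-- The multilinear estimate in dual form. -/
theorem exists_form_le (hs₁ : 1 / 2 < s₁) (hs₂ : (n : ℝ) / (2 * (n + 2)) ≤ s₂) (hε0 : 0 < ε)
    (hε₁ : ε ≤ 1) (hε1 : ε ≤ s₁) :
    ∃ b' : ℝ, -(1 / 2) < b' ∧ b' ≤ 0 ∧ ∀ b : ℝ, 1 / 2 < b → ∃ C : ℝ≥0,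
      ∀ (f₀ : SpaceTime → ℝ≥0∞) (f : Fin (n + 3) → SpaceTime → ℝ≥0∞), Measurable f₀ →
      (∀ j, Measurable (f j)) → (∀ j x, freqX x = 0 → f j x = 0) →
      (∫⁻ w, (formSymbol s₁ s₂ ε b' w * f₀ (∑ j, w j))
          * ∏ j, decay b (modulation (w j)) * f j (w j)) ^ 2
        ≤ C * ((∫⁻ x, f₀ x ^ 2) * ∏ j, ∫⁻ x, f j x ^ 2) := by
  have hs0 : 0 ≤ s₂ := le_trans (by positivity) hs₂
  -- The three entries are the margin of `s₁` above `1/2`, the velocity weight that pays the excess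
  -- in the Sobolev exponents, and the condition from the transversal case.
  set δ : ℝ := min ((s₁ - 1 / 2) / 2) (min (ε / 3) (1 / (n + 2)))
  have hδ : 0 < δ := lt_min (by linarith) (lt_min (by linarith) (by positivity))
  have hδ₁ : 1 / 2 + 2 * δ ≤ s₁ := by
    linarith [min_le_left ((s₁ - 1 / 2) / 2) (min (ε / 3) (1 / ((n : ℝ) + 2)))]
  have hδ' : δ ≤ min (ε / 3) (1 / ((n : ℝ) + 2)) := min_le_right _ _
  have hδε : 3 * δ ≤ ε := by linarith [hδ'.trans (min_le_left _ _)]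
  have hδn : δ ≤ 1 / (n + 2) := hδ'.trans (min_le_right _ _)
  have hδ₂ : δ ≤ 1 / 2 := by linarith
  -- The modulation counts as large when `lm ≥ R * restSize`; since `b' ≤ -1/4`, it then pays `s₂ +
  -- ε + 3` units of `restSize`.
  set R : ℝ := 4 * (s₂ + ε + 3)
  have hR : 0 < R := by positivity
  -- Below that threshold, replacing `b' = -1/2 + κ` by `-q ≥ -1/2 - κ` costs at most `2κ * lm`,
  -- hence at most `δ * restSize`.
  set κ : ℝ := min (δ / (2 * R)) (1 / 4)
  have hκ : 0 < κ := lt_min (by positivity) (by norm_num)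
  have hκ4 : κ ≤ 1 / 4 := min_le_right _ _
  have hκR : 2 * κ * R ≤ δ := by
    have : κ ≤ δ / (2 * R) := min_le_left _ _
    rw [le_div_iff₀ (by positivity)] at this
    linarith
  refine ⟨-(1 / 2) + κ, by linarith, by linarith, fun b hb => ?_⟩
  -- Lowering `b` to `q` only enlarges the form. This keeps `b'` independent of `b`.
  set q : ℝ := min b (1 / 2 + κ)
  have hq : 1 / 2 < q := lt_min hb (by linarith)
  have hqκ : q ≤ 1 / 2 + κ := min_le_right _ _
  obtain ⟨C, hC⟩ := exists_ordered_form_le (p := 2 * q) (b' := -(1 / 2) + κ) hs₂ hε0 hε₁ hε1 hδ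
    hδ₂ hδ₁ hδε hδn (by linarith) fun m r hm hr => by
      rcases le_total m (R * r) with h | h
      · left
        have h1 : 2 * κ * m ≤ 2 * κ * (R * r) := mul_le_mul_of_nonneg_left h (by linarith)
        have h2 : 2 * κ * R * r ≤ δ * r := mul_le_mul_of_nonneg_right hκR hr
        have h3 : q * m ≤ (1 / 2 + κ) * m := mul_le_mul_of_nonneg_right hqκ hm
        linarith
      · right
        have h1 : κ * m ≤ 1 / 4 * m := mul_le_mul_of_nonneg_right hκ4 hm
        have h2 : 4 * (s₂ + ε + 3) * r ≤ m := h
        linarith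
  rw [show 2 * q / 2 = q by ring] at hC
  set N := Fintype.card (Equiv.Perm (Fin (n + 3)))
  refine ⟨2 ^ N * N * C, fun f₀ f hf₀ hf hz => ?_⟩
  have m3 := measurable_modulation
  have m4 := measurable_decay q
  have hmono : ∫⁻ w, (formSymbol s₁ s₂ ε (-(1 / 2) + κ) w * f₀ (∑ j, w j))
          * ∏ j, decay b (modulation (w j)) * f j (w j)
      ≤ ∫⁻ w, (formSymbol s₁ s₂ ε (-(1 / 2) + κ) w * f₀ (∑ j, w j))
          * ∏ j, decay q (modulation (w j)) * f j (w j) :=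
    lintegral_mono fun w => mul_le_mul_right (Finset.prod_le_prod' fun j _ =>
      mul_le_mul_left (decay_anti_exponent (min_le_left _ _) _) _) _
  refine (pow_le_pow_left₀ zero_le hmono 2).trans ?_
  have mM : Measurable fun w : Fin (n + 3) → SpaceTime =>
      formSymbol s₁ s₂ ε (-(1 / 2) + κ) w * f₀ (∑ j, w j) := by
    have := measurable_sum_apply (m := n + 3)
    have := measurable_formSymbol s₁ s₂ ε (-(1 / 2) + κ) (m := n + 3)
    fun_prop
  refine (sq_lintegral_le_of_perm measurableSet_ordered exists_perm_ordered mM (fun σ w => ?_)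
    (f := fun j x => decay q (modulation x) * f j x) (by fun_prop)
    (B := C * ((∫⁻ x, f₀ x ^ 2) * ∏ j, ∫⁻ x, f j x ^ 2)) fun σ => ?_).trans (le_of_eq ?_)
  · rw [formSymbol_perm, Equiv.sum_comp σ w]
  · have := hC f₀ (fun j => f (σ j)) hf₀ (fun j => hf _) fun j => hz _
    rwa [Equiv.prod_comp σ fun j => ∫⁻ x, f j x ^ 2] at this
  · push_cast
    ring

end MainForm

/-! ### The `L²` bound for a product of `n + 2` factors. -/

section PowerForm

variable {n : ℕ} {s₁ s₂ ε δ : ℝ}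

/-- Without an output weight the two factors of largest `par` contribute their full `s₂` weight, and
`sobolev_balance` applies directly. The `k` and velocity weights of factor 0 are simply dropped. -/
theorem inv_prod_fullWeight_le (hs₂ : (n : ℝ) / (2 * (n + 2)) ≤ s₂) (hε0 : 0 < ε)
    (hδ : 0 < δ) (hδ₁ : 1 / 2 + 2 * δ ≤ s₁) (hδε : 3 * δ ≤ ε) {w : Fin (n + 2) → SpaceTime}
    (hw : ParOrdered w) (h0 : ∀ j, freqX (w j) ≠ 0) :
    ∏ j, (fullWeight s₁ s₂ ε (w j))⁻¹
      ≤ kap (w 0) ^ (1 / 2 : ℝ) * (kap (w 1) ^ (-(1 + 2 * δ) / 2)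
        * ∏ i : Fin n, sobolevWeight δ (w i.succ.succ)) := by
  have hsob := prod_exp_le_sobolevWeight hδ fun i : Fin n => w i.succ.succ
  have hSa : ∑ i : Fin n, lh (w i.succ.succ) ≤ n * lh (w 0) := by
    refine (Finset.sum_le_sum fun i _ => Real.log_le_log (par_pos _)
      (hw.1 i.succ.succ)).trans (le_of_eq ?_)
    simp [lh]
  have hSb : ∑ i : Fin n, lh (w i.succ.succ) ≤ n * lh (w 1) := by
    refine (Finset.sum_le_sum fun i _ => Real.log_le_log (par_pos _) (hw.2 i)).trans
      (le_of_eq ?_)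
    simp [lh]
  have hSn2 : ∑ i : Fin n, lh (w i.succ.succ) ≤ 2 * ∑ i : Fin n, lv (w i.succ.succ) := by
    rw [Finset.mul_sum]
    refine Finset.sum_le_sum fun i _ => ?_
    linarith [lh_le (h0 i.succ.succ), lk_le_lv (w i.succ.succ)]
  have hsum : ∀ f : Fin (n + 2) → ℝ, ∑ j, f j = f 0 + f 1 + ∑ i : Fin n, f i.succ.succ := by
    intro f
    rw [Fin.sum_univ_succ, Fin.sum_univ_succ, ← add_assoc]
    rfl
  rw [Finset.prod_inv_distrib, prod_fullWeight_eq, ← Real.exp_neg, hsum, hsum, hsum]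
  set Sk := ∑ i : Fin n, lk (w i.succ.succ)
  set Sh := ∑ i : Fin n, lh (w i.succ.succ)
  set Sn := ∑ i : Fin n, lv (w i.succ.succ)
  have hSk : 0 ≤ Sk := Finset.sum_nonneg fun i _ => lk_nonneg _
  have hSh : 0 ≤ Sh := Finset.sum_nonneg fun i _ => lh_nonneg _
  have hSn : 0 ≤ Sn := Finset.sum_nonneg fun i _ => lv_nonneg _
  have n0 := lk_nonneg (w 0)
  have n1 := lk_nonneg (w 1)
  have v0 := lv_nonneg (w 0)
  have v1 := lv_nonneg (w 1)
  have m0 := lh_nonneg (w 0)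
  have m1 := lh_nonneg (w 1)
  have hbal := sobolev_balance hs₂ hSa hSb hSh
  calc _ ≤ Real.exp (1 / 2 * lk (w 0) + (-(1 + 2 * δ) / 2 * lk (w 1)
        + -(1 / 2 + δ) * (Sk + Sh))) := by
        refine Real.exp_le_exp.2 ?_
        have e1 : (n : ℝ) / (2 * (n + 2)) * (lh (w 0) + lh (w 1)) ≤ s₂ * (lh (w 0) + lh (w 1)) :=
          mul_le_mul_of_nonneg_right hs₂ (by linarith)
        have e2 : (1 / 2 + δ) * Sk ≤ s₁ * Sk := mul_le_mul_of_nonneg_right (by linarith) hSk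
        have e3 : (1 / 2 + δ) * lk (w 1) ≤ s₁ * lk (w 1) :=
          mul_le_mul_of_nonneg_right (by linarith) n1
        have e4 : 0 ≤ s₁ * lk (w 0) := mul_nonneg (by linarith) n0
        have e5 : δ * Sh ≤ δ * (2 * Sn) := mul_le_mul_of_nonneg_left hSn2 hδ.le
        have e6 : 3 * δ * Sn ≤ ε * Sn := mul_le_mul_of_nonneg_right hδε hSn
        have e7 : 0 ≤ ε * lv (w 0) := mul_nonneg hε0.le v0
        have e8 : 0 ≤ ε * lv (w 1) := mul_nonneg hε0.le v1
        have e9 : 0 ≤ δ * Sn := mul_nonneg hδ.le hSn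
        linarith
    _ = kap (w 0) ^ (1 / 2 : ℝ) * (kap (w 1) ^ (-(1 + 2 * δ) / 2)
        * Real.exp (-(1 / 2 + δ) * (Sk + Sh))) := by
        rw [Real.exp_add, Real.exp_add, kap_rpow, kap_rpow]
    _ ≤ _ := by
        have p0 := kap_pos (w 0)
        have p1 := kap_pos (w 1)
        gcongr

/-- The estimate in dual form for a product of `n + 2` factors in `L²`. -/
theorem exists_power_form_le (hs₁ : 1 / 2 < s₁) (hs₂ : (n : ℝ) / (2 * (n + 2)) ≤ s₂)
    (hε0 : 0 < ε) {b : ℝ} (hb : 1 / 2 < b) :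
    ∃ C : ℝ≥0, ∀ (f₀ : SpaceTime → ℝ≥0∞) (f : Fin (n + 2) → SpaceTime → ℝ≥0∞), Measurable f₀ →
      (∀ j, Measurable (f j)) → (∀ j x, freqX x = 0 → f j x = 0) →
      (∫⁻ w : Fin (n + 2) → SpaceTime, ((∏ j, ENNReal.ofReal (fullWeight s₁ s₂ ε (w j))⁻¹) * f₀ (∑ j, w j))
          * ∏ j, decay b (modulation (w j)) * f j (w j)) ^ 2
        ≤ C * ((∫⁻ x, f₀ x ^ 2) * ∏ j, ∫⁻ x, f j x ^ 2) := by
  set δ : ℝ := min ((s₁ - 1 / 2) / 2) (min (ε / 3) (1 / 2))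
  have hδ : 0 < δ := lt_min (by linarith) (lt_min (by linarith) (by norm_num))
  have hδ₁ : 1 / 2 + 2 * δ ≤ s₁ := by
    linarith [min_le_left ((s₁ - 1 / 2) / 2) (min (ε / 3) (1 / 2))]
  have hδ' : δ ≤ min (ε / 3) (1 / 2) := min_le_right _ _
  have hδε : 3 * δ ≤ ε := by linarith [hδ'.trans (min_le_left _ _)]
  have hδ₂ : δ ≤ 1 / 2 := hδ'.trans (min_le_right _ _)
  have hp : 1 < 2 * b := by linarith
  obtain ⟨C₁, h₁⟩ := exists_convSq_strichartz_le hp (δ := 2 * δ) (by linarith) (by linarith)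
  obtain ⟨C₃, h₃⟩ := exists_lintegral_sobolev_le hp (δ := 2 * δ) (by linarith)
  rw [show 2 * b / 2 = b by ring] at h₁ h₃
  have m2 := measurable_kap
  have m3 := measurable_modulation
  have m4 := measurable_decay b
  have m5 := measurable_sobolevWeight δ
  have m6 := measurable_fullWeight s₁ s₂ ε
  set N := Fintype.card (Equiv.Perm (Fin (n + 2)))
  refine ⟨2 ^ N * N * (C₁ * C₃ ^ n), fun f₀ f hf₀ hf hz => ?_⟩
  have ordered : ∀ f : Fin (n + 2) → SpaceTime → ℝ≥0∞, (∀ j, Measurable (f j)) →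
      (∀ j x, freqX x = 0 → f j x = 0) →
      (∫⁻ w, {w : Fin (n + 2) → SpaceTime | ParOrdered w}.indicator (fun w =>
        ((∏ j, ENNReal.ofReal (fullWeight s₁ s₂ ε (w j))⁻¹) * f₀ (∑ j, w j))
          * ∏ j, decay b (modulation (w j)) * f j (w j)) w) ^ 2
        ≤ C₁ * C₃ ^ n * ((∫⁻ x, f₀ x ^ 2) * ∏ j, ∫⁻ x, f j x ^ 2) := by
    intro f hf hz
    set A : SpaceTime → SpaceTime → ℝ≥0∞ := fun x y =>
      (ENNReal.ofReal (kap x ^ (1 / 2 : ℝ)) * decay b (modulation x) * f 0 x)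
        * (ENNReal.ofReal (kap y ^ (-(1 + 2 * δ) / 2)) * decay b (modulation y) * f 1 y)
    have hA : Measurable (Function.uncurry A) := by
      simp only [A, Function.uncurry_def]
      fun_prop
    set g : Fin n → SpaceTime → ℝ≥0∞ := fun i y =>
      ENNReal.ofReal (sobolevWeight δ y) * decay b (modulation y) * f i.succ.succ y
    have hpt : ∀ w, {w : Fin (n + 2) → SpaceTime | ParOrdered w}.indicator (fun w =>
        ((∏ j, ENNReal.ofReal (fullWeight s₁ s₂ ε (w j))⁻¹) * f₀ (∑ j, w j))
          * ∏ j, decay b (modulation (w j)) * f j (w j)) w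
        ≤ A (w 0) (w 1) * (f₀ (∑ j, w j) * ∏ i : Fin n, g i (w i.succ.succ)) := by
      intro w
      by_cases hw : ParOrdered w
      swap
      · rw [Set.indicator_of_notMem (show w ∉ {w | ParOrdered w} from hw)]
        exact zero_le
      rw [Set.indicator_of_mem (show w ∈ {w | ParOrdered w} from hw)]
      by_cases h0 : ∀ j, freqX (w j) ≠ 0
      · have key := ENNReal.ofReal_le_ofReal (inv_prod_fullWeight_le hs₂ hε0 hδ hδ₁ hδε hw h0)
        have p0 := kap_pos (w 0)
        have p1 := kap_pos (w 1)
        rw [ENNReal.ofReal_prod_of_nonneg fun j _ => (inv_pos.2 (fullWeight_pos _ _ _ _)).le,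
          ENNReal.ofReal_mul (by positivity), ENNReal.ofReal_mul (by positivity),
          ENNReal.ofReal_prod_of_nonneg fun i _ => sobolevWeight_nonneg _ _] at key
        have e1 : ∏ j, decay b (modulation (w j)) * f j (w j)
            = (decay b (modulation (w 0)) * f 0 (w 0))
            * ((decay b (modulation (w 1)) * f 1 (w 1))
            * ∏ i : Fin n, decay b (modulation (w i.succ.succ))
              * f i.succ.succ (w i.succ.succ)) := by
          rw [Fin.prod_univ_succ, Fin.prod_univ_succ]
          rfl
        have e2 : ∏ i : Fin n, g i (w i.succ.succ)
            = (∏ i : Fin n, ENNReal.ofReal (sobolevWeight δ (w i.succ.succ)))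
            * ∏ i : Fin n, decay b (modulation (w i.succ.succ))
              * f i.succ.succ (w i.succ.succ) := by
          rw [← Finset.prod_mul_distrib]
          refine Finset.prod_congr rfl fun i _ => ?_
          simp only [g]
          ring
        rw [e2]
        refine (mul_le_mul_left (mul_le_mul_left key _) _).trans (le_of_eq ?_)
        rw [e1]
        simp only [A]
        ring
      · push Not at h0
        obtain ⟨j, hj⟩ := h0
        have : ∏ j, decay b (modulation (w j)) * f j (w j) = 0 :=
          Finset.prod_eq_zero (Finset.mem_univ j) (by rw [hz j _ hj, mul_zero])
        rw [this, mul_zero]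
        exact zero_le
    refine (pow_le_pow_left₀ zero_le (lintegral_mono hpt) 2).trans ?_
    refine (sq_form_two_le hA hf₀ (g := g) (by fun_prop)).trans ?_
    have k2 : ∏ i, (∫⁻ x, g i x) ^ 2 ≤ C₃ ^ n * ∏ i : Fin n, ∫⁻ x, f i.succ.succ x ^ 2 := by
      calc ∏ i, (∫⁻ x, g i x) ^ 2 ≤ ∏ i : Fin n, C₃ * ∫⁻ x, f i.succ.succ x ^ 2 :=
            Finset.prod_le_prod' fun i _ => h₃ _ (hf _)
        _ = _ := by simp [Finset.prod_mul_distrib]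
    calc _ ≤ C₁ * ((∫⁻ x, f 0 x ^ 2) * ∫⁻ x, f 1 x ^ 2) * (∫⁻ x, f₀ x ^ 2)
          * (C₃ ^ n * ∏ i : Fin n, ∫⁻ x, f i.succ.succ x ^ 2) :=
          mul_le_mul' (mul_le_mul' (h₁ _ _ (hf 0) (hf 1)) le_rfl) k2
      _ = _ := by
          rw [Fin.prod_univ_succ, Fin.prod_univ_succ]
          simp only [Fin.succ_zero_eq_one]
          ring
  have mM : Measurable fun w : Fin (n + 2) → SpaceTime =>
      (∏ j, ENNReal.ofReal (fullWeight s₁ s₂ ε (w j))⁻¹) * f₀ (∑ j, w j) := by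
    have := measurable_sum_apply (m := n + 2)
    fun_prop
  refine (sq_lintegral_le_of_perm measurableSet_parOrdered exists_perm_parOrdered mM
    (fun σ w => ?_) (f := fun j x => decay b (modulation x) * f j x) (by fun_prop)
    (B := C₁ * C₃ ^ n * ((∫⁻ x, f₀ x ^ 2) * ∏ j, ∫⁻ x, f j x ^ 2)) fun σ => ?_).trans
    (le_of_eq ?_)
  · rw [Equiv.sum_comp σ w,
      Equiv.prod_comp σ fun j => ENNReal.ofReal (fullWeight s₁ s₂ ε (w j))⁻¹]
  · have := ordered (fun j => f (σ j)) (fun j => hf _) fun j => hz _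
    rwa [Equiv.prod_comp σ fun j => ∫⁻ x, f j x ^ 2] at this
  · push_cast
    ring

end PowerForm

/-! ### Duality in `L²` and convolutions of nonnegative functions. -/

section Duality

/-- Converse of the Cauchy–Schwarz inequality. -/
theorem lintegral_sq_le_of_dual {α : Type*} [MeasurableSpace α] {μ : Measure α} [SigmaFinite μ]
    {H : α → ℝ≥0∞} (hH : Measurable H) {B : ℝ≥0∞}
    (h : ∀ f : α → ℝ≥0∞, Measurable f → (∫⁻ x, f x * H x ∂μ) ^ 2 ≤ B * ∫⁻ x, f x ^ 2 ∂μ) :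
    ∫⁻ x, H x ^ 2 ∂μ ≤ B := by
  -- The test functions are cut off in height and support, so that their `L²` norms are finite and
  -- may be cancelled; monotone convergence removes the cut-off.
  set F : ℕ → α → ℝ≥0∞ := fun k => (spanningSets μ k).indicator fun x => min (H x) k
  have hF : ∀ k, Measurable (F k) := fun k =>
    (hH.min measurable_const).indicator (measurableSet_spanningSets μ k)
  have hFle : ∀ k x, F k x ≤ H x := fun k x =>
    (Set.indicator_le_self' (fun _ _ => zero_le) x).trans (min_le_left _ _)
  have hfin : ∀ k, ∫⁻ x, F k x ^ 2 ∂μ ≠ ∞ := by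
    intro k
    refine ne_top_of_le_ne_top (b := ((k : ℝ≥0∞) ^ 2 * μ (spanningSets μ k)))
      (ENNReal.mul_ne_top (by finiteness) (measure_spanningSets_lt_top μ k).ne) ?_
    rw [← setLIntegral_const, ← lintegral_indicator (measurableSet_spanningSets μ k)]
    refine lintegral_mono fun x => ?_
    by_cases hx : x ∈ spanningSets μ k
    · simp only [F, Set.indicator_of_mem hx]
      exact pow_le_pow_left₀ zero_le (min_le_right _ _) 2
    · simp [F, hx]
  have hk : ∀ k, ∫⁻ x, F k x ^ 2 ∂μ ≤ B := by
    intro k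
    have h1 : (∫⁻ x, F k x ^ 2 ∂μ) ^ 2 ≤ B * ∫⁻ x, F k x ^ 2 ∂μ := by
      refine le_trans (pow_le_pow_left₀ zero_le (lintegral_mono fun x => ?_) 2) (h _ (hF k))
      rw [sq]
      exact mul_le_mul_right (hFle k x) _
    by_cases h0 : ∫⁻ x, F k x ^ 2 ∂μ = 0
    · rw [h0]
      exact zero_le
    · rw [sq] at h1
      exact (ENNReal.mul_le_mul_iff_left h0 (hfin k)).1 h1
  have hmono : ∀ x, Monotone fun k => F k x ^ 2 := by
    intro x k l hkl
    refine pow_le_pow_left₀ zero_le ?_ 2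
    simp only [F]
    by_cases hx : x ∈ spanningSets μ k
    · rw [Set.indicator_of_mem hx, Set.indicator_of_mem (monotone_spanningSets μ hkl hx)]
      exact min_le_min_left _ (by exact_mod_cast hkl)
    · rw [Set.indicator_of_notMem hx]
      exact zero_le
  have hsup : ∀ x, H x ^ 2 = ⨆ k, F k x ^ 2 := by
    intro x
    refine tendsto_nhds_unique ?_ (tendsto_atTop_iSup (hmono x))
    refine ENNReal.Tendsto.pow (n := 2) ?_
    have h1 : Filter.Tendsto (fun k : ℕ => min (H x) (k : ℝ≥0∞)) Filter.atTop (nhds (min (H x) ⊤)) :=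
      tendsto_const_nhds.min ENNReal.tendsto_nat_nhds_top
    rw [min_top_right] at h1
    refine h1.congr' ?_
    obtain ⟨k, hk⟩ := Set.mem_iUnion.1 ((iUnion_spanningSets μ).symm ▸ Set.mem_univ x :
      x ∈ ⋃ i, spanningSets μ i)
    filter_upwards [Filter.eventually_ge_atTop k] with l hl
    simp only [F]
    rw [Set.indicator_of_mem (monotone_spanningSets μ hl hk)]
  simp only [hsup]
  rw [lintegral_iSup (fun k => (hF k).pow_const 2) fun k l hkl x => hmono x hkl]
  exact iSup_le hk

variable {E : Type*} [AddCommGroup E] [MeasureSpace E] [MeasurableAdd₂ E] [MeasurableNeg E]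
  [SigmaFinite (volume : Measure E)] [(volume : Measure E).IsAddLeftInvariant]
  [(volume : Measure E).IsNegInvariant]

/-- The convolution of nonnegative functions. -/
noncomputable def lconv {m : ℕ} (g : Fin (m + 1) → E → ℝ≥0∞) (ξ : E) : ℝ≥0∞ :=
  ∫⁻ w : Fin m → E, g 0 (ξ - ∑ i, w i) * ∏ i : Fin m, g i.succ (w i)

theorem measurable_pi_sum {m : ℕ} : Measurable fun w : Fin m → E => ∑ j, w j :=
  Finset.measurable_fun_sum _ fun i _ => measurable_pi_apply i

theorem measurable_lconv {m : ℕ} {g : Fin (m + 1) → E → ℝ≥0∞} (hg : ∀ j, Measurable (g j)) :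
    Measurable (lconv g) := by
  refine Measurable.lintegral_prod_right' (f := fun p : E × (Fin m → E) =>
    g 0 (p.1 - ∑ i, p.2 i) * ∏ i : Fin m, g i.succ (p.2 i)) ?_
  have := measurable_pi_sum (E := E) (m := m)
  fun_prop

theorem lintegral_mul_lconv {m : ℕ} {g : Fin (m + 1) → E → ℝ≥0∞} (hg : ∀ j, Measurable (g j))
    {F : E → ℝ≥0∞} (hF : Measurable F) :
    ∫⁻ ξ, F ξ * lconv g ξ = ∫⁻ w : Fin (m + 1) → E, F (∑ j, w j) * ∏ j, g j (w j) := by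
  have hs := measurable_pi_sum (E := E) (m := m)
  have hs' := measurable_pi_sum (E := E) (m := m + 1)
  rw [lintegral_fin_cons _ (by fun_prop), lintegral_lintegral_swap]
  · have h1 : ∀ ξ, F ξ * lconv g ξ
        = ∫⁻ w : Fin m → E, F ξ * (g 0 (ξ - ∑ i, w i) * ∏ i : Fin m, g i.succ (w i)) := fun ξ => by
      rw [lconv, lintegral_const_mul]
      fun_prop
    simp only [h1]
    rw [lintegral_lintegral_swap]
    · refine lintegral_congr fun w => ?_
      rw [← lintegral_add_right_eq_self _ (∑ i, w i)]
      refine lintegral_congr fun x => ?_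
      simp only [Fin.sum_univ_succ, Fin.prod_univ_succ, Fin.cons_zero, Fin.cons_succ,
        add_sub_cancel_right]
    · refine Measurable.aemeasurable ?_
      simp only [Function.uncurry_def]
      fun_prop
  · refine ((by fun_prop : Measurable fun w : Fin (m + 1) → E =>
      F (∑ j, w j) * ∏ j, g j (w j)).comp measurable_fin_cons).aemeasurable

end Duality

/-! ### The form estimates as weighted bounds for convolutions. -/

section ConvolutionEstimates

variable {n : ℕ} {s₁ s₂ ε : ℝ}

theorem decay_mul_decay_neg (b x : ℝ) : decay b x * decay (-b) x = 1 := by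
  rw [decay, decay, ← ENNReal.ofReal_mul (by positivity), ← Real.rpow_add (by positivity)]
  simp

/-- The weight of the function space on the Fourier side. -/
noncomputable def spaceWeight (s₁ s₂ ε b : ℝ) (w : SpaceTime) : ℝ≥0∞ :=
  ENNReal.ofReal (fullWeight s₁ s₂ ε w) * decay (-b) (modulation w)

theorem measurable_spaceWeight (s₁ s₂ ε b : ℝ) : Measurable (spaceWeight s₁ s₂ ε b) := by
  have h2 := measurable_fullWeight s₁ s₂ ε
  have h3 := measurable_modulation
  have h4 := measurable_decay (-b)
  unfold spaceWeight
  fun_prop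

/-- Undoes the substitution of `spaceWeight * g` for the arguments of the multilinear form. -/
theorem spaceWeight_cancel (s₁ s₂ ε b : ℝ) (w : SpaceTime) (a : ℝ≥0∞) :
    ENNReal.ofReal (fullWeight s₁ s₂ ε w)⁻¹
      * (decay b (modulation w) * (spaceWeight s₁ s₂ ε b w * a)) = a := by
  have h1 : ENNReal.ofReal (fullWeight s₁ s₂ ε w)⁻¹ * ENNReal.ofReal (fullWeight s₁ s₂ ε w) = 1 := by
    rw [← ENNReal.ofReal_mul (inv_pos.2 (fullWeight_pos _ _ _ _)).le,
      inv_mul_cancel₀ (fullWeight_pos _ _ _ _).ne', ENNReal.ofReal_one]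
  calc _ = ENNReal.ofReal (fullWeight s₁ s₂ ε w)⁻¹ * ENNReal.ofReal (fullWeight s₁ s₂ ε w)
        * (decay b (modulation w) * decay (-b) (modulation w)) * a := by
        unfold spaceWeight
        ring
    _ = a := by rw [h1, decay_mul_decay_neg, one_mul, one_mul]

/-- The multilinear estimate for convolutions of nonnegative functions. -/
theorem exists_lconv_le (hs₁ : 1 / 2 < s₁) (hs₂ : (n : ℝ) / (2 * (n + 2)) ≤ s₂) (hε0 : 0 < ε)
    (hε₁ : ε ≤ 1) (hε1 : ε ≤ s₁) :
    ∃ b' : ℝ, -(1 / 2) < b' ∧ b' ≤ 0 ∧ ∀ b : ℝ, 1 / 2 < b → ∃ C : ℝ≥0,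
      ∀ g : Fin (n + 3) → SpaceTime → ℝ≥0∞, (∀ j, Measurable (g j)) →
        (∀ j x, freqX x = 0 → g j x = 0) →
        ∫⁻ ξ, (ENNReal.ofReal |freqX ξ| * spaceWeight s₁ s₂ ε b' ξ * lconv g ξ) ^ 2
          ≤ C * ∏ j, ∫⁻ x, (spaceWeight s₁ s₂ ε b x * g j x) ^ 2 := by
  obtain ⟨b', hb'1, hb'2, H⟩ := exists_form_le hs₁ hs₂ hε0 hε₁ hε1
  refine ⟨b', hb'1, hb'2, fun b hb => ?_⟩
  obtain ⟨C, hC⟩ := H b hb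
  refine ⟨C, fun g hg hz => ?_⟩
  have m0 := measurable_lconv hg
  have m1 := measurable_spaceWeight s₁ s₂ ε b'
  have m2 := measurable_spaceWeight s₁ s₂ ε b
  have m3 := measurable_freqX
  refine lintegral_sq_le_of_dual (by fun_prop) fun f hf => ?_
  have h := hC f (fun j x => spaceWeight s₁ s₂ ε b x * g j x) hf (by fun_prop)
    fun j x hx => by rw [hz j x hx, mul_zero]
  refine le_of_eq_of_le ?_ (h.trans (le_of_eq (by ring)))
  congr 1
  have e1 : ∀ ξ, f ξ * (ENNReal.ofReal |freqX ξ| * spaceWeight s₁ s₂ ε b' ξ * lconv g ξ)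
      = (f ξ * ENNReal.ofReal |freqX ξ| * spaceWeight s₁ s₂ ε b' ξ) * lconv g ξ := fun ξ => by ring
  simp only [e1]
  rw [lintegral_mul_lconv hg (by fun_prop)]
  refine lintegral_congr fun w => ?_
  rw [formSymbol, div_eq_mul_inv, ENNReal.ofReal_mul (mul_nonneg (abs_nonneg _)
    (fullWeight_pos _ _ _ _).le), ENNReal.ofReal_mul (abs_nonneg _), ← Finset.prod_inv_distrib,
    ENNReal.ofReal_prod_of_nonneg fun j _ => (inv_pos.2 (fullWeight_pos _ _ _ _)).le]
  calc _ = f (∑ j, w j) * ENNReal.ofReal |freqX (∑ j, w j)| * spaceWeight s₁ s₂ ε b' (∑ j, w j)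
        * ∏ j, ENNReal.ofReal (fullWeight s₁ s₂ ε (w j))⁻¹
          * (decay b (modulation (w j)) * (spaceWeight s₁ s₂ ε b (w j) * g j (w j))) := by
        simp only [spaceWeight_cancel]
    _ = _ := by
        rw [Finset.prod_mul_distrib]
        simp only [spaceWeight]
        ring

/-- The estimate in `L²` for convolutions of `n + 2` nonnegative functions. -/
theorem exists_lconv_power_le (hs₁ : 1 / 2 < s₁) (hs₂ : (n : ℝ) / (2 * (n + 2)) ≤ s₂)
    (hε0 : 0 < ε) {b : ℝ} (hb : 1 / 2 < b) :
    ∃ C : ℝ≥0, ∀ g : Fin (n + 2) → SpaceTime → ℝ≥0∞, (∀ j, Measurable (g j)) →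
        (∀ j x, freqX x = 0 → g j x = 0) →
        ∫⁻ ξ, lconv g ξ ^ 2 ≤ C * ∏ j, ∫⁻ x, (spaceWeight s₁ s₂ ε b x * g j x) ^ 2 := by
  obtain ⟨C, hC⟩ := exists_power_form_le hs₁ hs₂ hε0 hb
  refine ⟨C, fun g hg hz => ?_⟩
  have m0 := measurable_lconv hg
  have m2 := measurable_spaceWeight s₁ s₂ ε b
  refine lintegral_sq_le_of_dual m0 fun f hf => ?_
  have h := hC f (fun j x => spaceWeight s₁ s₂ ε b x * g j x) hf (by fun_prop)
    fun j x hx => by rw [hz j x hx, mul_zero]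
  refine le_of_eq_of_le ?_ (h.trans (le_of_eq (by ring)))
  congr 1
  rw [lintegral_mul_lconv hg hf]
  refine lintegral_congr fun w => ?_
  calc _ = f (∑ j, w j) * ∏ j, ENNReal.ofReal (fullWeight s₁ s₂ ε (w j))⁻¹
          * (decay b (modulation (w j)) * (spaceWeight s₁ s₂ ε b (w j) * g j (w j))) := by
        simp only [spaceWeight_cancel]
    _ = _ := by
        rw [Finset.prod_mul_distrib]
        ring

end ConvolutionEstimates

/-! ### Tempered distributions represented by functions, and their Fourier transforms. -/

section Representation

theorem exists_schwartz_eq_one (x : SpaceTime) :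
    ∃ ψ : 𝓢(SpaceTime, ℂ), ∀ y ∈ Metric.ball x 1, ψ y = 1 := by
  let φ : ContDiffBump x := ⟨1, 2, by norm_num, by norm_num⟩
  have h₁ : HasCompactSupport (Complex.ofRealCLM ∘ φ) := φ.hasCompactSupport.comp_left rfl
  have h₂ : ContDiff ℝ ((⊤ : ℕ∞) : WithTop ℕ∞) (Complex.ofRealCLM ∘ φ) :=
    Complex.ofRealCLM.contDiff.comp φ.contDiff
  refine ⟨h₁.toSchwartzMap h₂, fun y hy => ?_⟩
  simp [φ.one_of_mem_closedBall (Metric.ball_subset_closedBall hy)]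

/-- Test with a Schwartz function that equals one on a ball. -/
theorem Represents.locallyIntegrable {T : 𝓢'(SpaceTime, ℂ)} {f : SpaceTime → ℂ}
    (h : Represents T f) : LocallyIntegrable f := by
  intro x
  obtain ⟨ψ, hψ⟩ := exists_schwartz_eq_one x
  refine ⟨Metric.ball x 1, Metric.ball_mem_nhds x one_pos, ?_⟩
  refine ((h ψ).1.integrableOn (s := Metric.ball x 1)).congr_fun (fun y hy => ?_)
    Metric.isOpen_ball.measurableSet
  simp [hψ y hy]

theorem Represents.ae_eq {T : 𝓢'(SpaceTime, ℂ)} {f g : SpaceTime → ℂ}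
    (hf : Represents T f) (hg : Represents T g) : f =ᵐ[volume] g := by
  refine ae_eq_of_integral_contDiff_smul_eq hf.locallyIntegrable hg.locallyIntegrable
    fun φ h1 h2 => ?_
  have h₁ : HasCompactSupport (Complex.ofRealCLM ∘ φ) := h2.comp_left rfl
  have h₂ : ContDiff ℝ ((⊤ : ℕ∞) : WithTop ℕ∞) (Complex.ofRealCLM ∘ φ) :=
    Complex.ofRealCLM.contDiff.comp h1
  have := (hf (h₁.toSchwartzMap h₂)).2.symm.trans (hg (h₁.toSchwartzMap h₂)).2
  simpa using this

theorem Represents.congr {T : 𝓢'(SpaceTime, ℂ)} {f g : SpaceTime → ℂ}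
    (hf : Represents T f) (h : f =ᵐ[volume] g) : Represents T g := by
  intro ψ
  have e : (fun p => ψ p * f p) =ᵐ[volume] fun p => ψ p * g p := by
    filter_upwards [h] with x hx
    rw [hx]
  exact ⟨(hf ψ).1.congr e, (hf ψ).2.trans (integral_congr_ae e)⟩

theorem Represents.unique {S T : 𝓢'(SpaceTime, ℂ)} {f : SpaceTime → ℂ}
    (hS : Represents S f) (hT : Represents T f) : S = T := by
  ext ψ
  rw [(hS ψ).2, (hT ψ).2]

theorem represents_Lp (f : Lp ℂ 2 (volume : Measure SpaceTime)) :
    Represents (Lp.toTemperedDistribution f) f := by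
  intro ψ
  refine ⟨(ψ.memLp 2 volume).integrable_mul (Lp.memLp f), ?_⟩
  simp [smul_eq_mul]

theorem represents_toLp {f : SpaceTime → ℂ} (hf : MemLp f 2 volume) :
    Represents (Lp.toTemperedDistribution (hf.toLp f)) f :=
  (represents_Lp _).congr hf.coeFn_toLp

theorem integrable_schwartz_mul (ψ : 𝓢(SpaceTime, ℂ)) {f : SpaceTime → ℂ} (hf : Integrable f) :
    Integrable fun p => ψ p * f p := by
  refine hf.bdd_mul ψ.continuous.aestronglyMeasurable (c := SchwartzMap.seminorm ℝ 0 0 ψ) ?_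
  exact Filter.Eventually.of_forall fun x => SchwartzMap.norm_le_seminorm ℝ ψ x

theorem exists_represents_of_integrable {f : SpaceTime → ℂ} (hf : Integrable f) :
    ∃ T : 𝓢'(SpaceTime, ℂ), Represents T f := by
  have h1 : MemLp f 1 volume := memLp_one_iff_integrable.2 hf
  refine ⟨Lp.toTemperedDistribution (h1.toLp f), fun ψ => ⟨integrable_schwartz_mul ψ hf, ?_⟩⟩
  rw [Lp.toTemperedDistribution_apply]
  refine integral_congr_ae ?_
  filter_upwards [h1.coeFn_toLp] with x hx
  rw [hx, smul_eq_mul]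

/-- The Fourier transform of a represented distribution in `L²`. -/
theorem Represents.of_fourier_memLp {u : 𝓢'(SpaceTime, ℂ)} {g : SpaceTime → ℂ}
    (h : Represents (𝓕 u) g) (hg : MemLp g 2 volume) :
    Represents u (𝓕⁻ (hg.toLp g) : Lp ℂ 2 (volume : Measure SpaceTime)) := by
  have h1 : 𝓕 u = Lp.toTemperedDistribution (hg.toLp g) := h.unique (represents_toLp hg)
  have h2 : u = Lp.toTemperedDistribution (𝓕⁻ (hg.toLp g)) := by
    rw [← Lp.fourierInv_toTemperedDistribution_eq, ← h1, FourierTransform.fourierInv_fourier_eq]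
  exact h2 ▸ represents_Lp _

theorem integral_fourier_mul_eq {f g : SpaceTime → ℂ} (hf : Integrable f) (hg : Integrable g) :
    ∫ x, 𝓕 f x * g x = ∫ x, f x * 𝓕 g x := by
  have := VectorFourier.integral_fourierIntegral_smul_eq_flip (L := innerₗ SpaceTime)
    (μ := volume) (ν := volume) Real.continuous_fourierChar continuous_inner hf hg
  rw [flip_innerₗ] at this
  exact this

theorem integrable_fourier_mul (ψ : 𝓢(SpaceTime, ℂ)) {f : SpaceTime → ℂ} (hf : Integrable f) :
    Integrable fun p => ψ p * 𝓕 f p := by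
  have hc : Continuous (𝓕 f) :=
    VectorFourier.fourierIntegral_continuous Real.continuous_fourierChar
      (by exact continuous_inner) hf
  refine ψ.integrable.mul_bdd (c := ∫ x, ‖f x‖) hc.aestronglyMeasurable ?_
  exact Filter.Eventually.of_forall fun x =>
    VectorFourier.norm_fourierIntegral_le_integral_norm _ _ _ _ _

theorem Represents.fourier {T : 𝓢'(SpaceTime, ℂ)} {f : SpaceTime → ℂ} (hf : Integrable f)
    (h : Represents T f) : Represents (𝓕 T) (𝓕 f) := by
  intro ψ
  refine ⟨integrable_fourier_mul ψ hf, ?_⟩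
  rw [TemperedDistribution.fourier_apply, (h _).2, ← integral_fourier_mul_eq ψ.integrable hf]
  rfl

theorem Represents.fourierInv {T : 𝓢'(SpaceTime, ℂ)} {f : SpaceTime → ℂ} (hf : Integrable f)
    (h : Represents T f) : Represents (𝓕⁻ T) (𝓕⁻ f) := by
  intro ψ
  rw [Real.fourierInv_eq_fourier_comp_neg]
  refine ⟨integrable_fourier_mul ψ hf.comp_neg, ?_⟩
  rw [TemperedDistribution.fourierInv_apply, (h _).2,
    ← integral_fourier_mul_eq ψ.integrable hf.comp_neg, ← integral_neg_eq_self]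
  refine integral_congr_ae (Filter.Eventually.of_forall fun x => ?_)
  have : (𝓕⁻ ψ) (-x) = 𝓕 (ψ : SpaceTime → ℂ) x := by
    rw [SchwartzMap.fourierInv_coe, Real.fourierInv_eq_fourier_neg, neg_neg]
  simp only [this]

end Representation

/-! ### Complex convolutions and their inverse Fourier transforms. -/

section Convolution

variable {m : ℕ}

/-- The convolution of complex functions. -/
noncomputable def cconv (g : Fin (m + 1) → SpaceTime → ℂ) (ξ : SpaceTime) : ℂ :=
  ∫ w : Fin m → SpaceTime, g 0 (ξ - ∑ i, w i) * ∏ i : Fin m, g i.succ (w i)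

theorem measurable_convIntegrand {g : Fin (m + 1) → SpaceTime → ℂ} (hg : ∀ j, Measurable (g j)) :
    Measurable fun p : SpaceTime × (Fin m → SpaceTime) =>
      g 0 (p.1 - ∑ i, p.2 i) * ∏ i : Fin m, g i.succ (p.2 i) := by
  have := measurable_pi_sum (E := SpaceTime) (m := m)
  fun_prop

theorem stronglyMeasurable_cconv {g : Fin (m + 1) → SpaceTime → ℂ} (hg : ∀ j, Measurable (g j)) :
    StronglyMeasurable (cconv g) :=
  (measurable_convIntegrand hg).stronglyMeasurable.integral_prod_right'

theorem enorm_prod_eq {ι : Type*} (s : Finset ι) (f : ι → ℂ) : ‖∏ i ∈ s, f i‖ₑ = ∏ i ∈ s, ‖f i‖ₑ := by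
  simp only [enorm_eq_nnnorm]
  rw [nnnorm_prod]
  push_cast
  rfl

theorem enorm_cconv_le (g : Fin (m + 1) → SpaceTime → ℂ) (ξ : SpaceTime) :
    ‖cconv g ξ‖ₑ ≤ lconv (fun j x => ‖g j x‖ₑ) ξ := by
  refine (enorm_integral_le_lintegral_enorm _).trans (le_of_eq ?_)
  refine lintegral_congr fun w => ?_
  rw [enorm_mul, enorm_prod_eq]

theorem lconv_mono {g h : Fin (m + 1) → SpaceTime → ℝ≥0∞} (hgh : ∀ j x, g j x ≤ h j x)
    (ξ : SpaceTime) : lconv g ξ ≤ lconv h ξ :=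
  lintegral_mono fun _ => mul_le_mul' (hgh _ _) (Finset.prod_le_prod' fun _ _ => hgh _ _)

/-- Dominated convergence with the modulus of the limiting integrand as majorant; its integral is
the quantity assumed finite at `ξ`. -/
theorem tendsto_cconv {g : Fin (m + 1) → SpaceTime → ℂ} {G : ℕ → Fin (m + 1) → SpaceTime → ℂ}
    (hg : ∀ j, Measurable (g j)) (hG : ∀ k j, Measurable (G k j))
    (hle : ∀ k j x, ‖G k j x‖ ≤ ‖g j x‖)
    (hlim : ∀ j x, Filter.Tendsto (fun k => G k j x) Filter.atTop (nhds (g j x)))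
    {ξ : SpaceTime} (hξ : lconv (fun j x => ‖g j x‖ₑ) ξ < ∞) :
    Filter.Tendsto (fun k => cconv (G k) ξ) Filter.atTop (nhds (cconv g ξ)) := by
  have hm : ∀ {g : Fin (m + 1) → SpaceTime → ℂ}, (∀ j, Measurable (g j)) →
      Measurable fun w : Fin m → SpaceTime => g 0 (ξ - ∑ i, w i) * ∏ i : Fin m, g i.succ (w i) :=
    fun hg => (measurable_convIntegrand hg).comp measurable_prodMk_left
  refine tendsto_integral_of_dominated_convergence
    (fun w : Fin m → SpaceTime => ‖g 0 (ξ - ∑ i, w i) * ∏ i : Fin m, g i.succ (w i)‖)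
    (fun k => (hm (hG k)).aestronglyMeasurable) ?_ (fun k => ?_) ?_
  · refine ⟨(hm hg).norm.aestronglyMeasurable, ?_⟩
    rw [HasFiniteIntegral]
    refine lt_of_le_of_lt (le_of_eq ?_) hξ
    refine lintegral_congr fun w => ?_
    rw [enorm_norm, enorm_mul, enorm_prod_eq]
  · refine Filter.Eventually.of_forall fun w => ?_
    rw [norm_mul, norm_mul, norm_prod, norm_prod]
    exact mul_le_mul (hle _ _ _) (Finset.prod_le_prod (fun _ _ => norm_nonneg _)
      fun _ _ => hle _ _ _) (Finset.prod_nonneg fun _ _ => norm_nonneg _) (norm_nonneg _)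
  · exact Filter.Eventually.of_forall fun w => (hlim _ _).mul
      (tendsto_finsetProd _ fun i _ => hlim _ _)

theorem integrable_convIntegrand {g : Fin (m + 1) → SpaceTime → ℂ} (hg : ∀ j, Measurable (g j))
    (hi : ∀ j, Integrable (g j)) :
    Integrable (fun p : SpaceTime × (Fin m → SpaceTime) =>
      g 0 (p.1 - ∑ i, p.2 i) * ∏ i : Fin m, g i.succ (p.2 i)) (volume.prod volume) := by
  refine (integrable_prod_iff' (measurable_convIntegrand hg).aestronglyMeasurable).2 ⟨?_, ?_⟩
  · refine Filter.Eventually.of_forall fun w => ?_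
    have h : Integrable fun ξ => g 0 (ξ - ∑ i, w i) := (hi 0).comp_sub_right (∑ i, w i)
    exact h.mul_const (∏ i : Fin m, g i.succ (w i))
  · have h1 : ∀ w : Fin m → SpaceTime, ∫ ξ, ‖g 0 (ξ - ∑ i, w i) * ∏ i : Fin m, g i.succ (w i)‖
        = (∫ ξ, ‖g 0 ξ‖) * ∏ i : Fin m, ‖g i.succ (w i)‖ := fun w => by
      simp only [norm_mul, norm_prod]
      rw [integral_mul_const, integral_sub_right_eq_self fun ξ => ‖g 0 ξ‖]
    simp only [h1]
    exact (Integrable.fintype_prod fun i : Fin m => (hi i.succ).norm).const_mul _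

theorem integrable_cconv {g : Fin (m + 1) → SpaceTime → ℂ} (hg : ∀ j, Measurable (g j))
    (hi : ∀ j, Integrable (g j)) : Integrable (cconv g) :=
  (integrable_convIntegrand hg hi).integral_prod_left

/-- The inverse Fourier transform of a convolution is the product of the inverse transforms. -/
theorem fourierInv_cconv {g : Fin (m + 1) → SpaceTime → ℂ} (hg : ∀ j, Measurable (g j))
    (hi : ∀ j, Integrable (g j)) (x : SpaceTime) : 𝓕⁻ (cconv g) x = ∏ j, 𝓕⁻ (g j) x := by
  set e : SpaceTime → ℂ := fun ξ => (Real.fourierChar (inner ℝ ξ x) : ℂ)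
  have he : ∀ (h : SpaceTime → ℂ), 𝓕⁻ h x = ∫ ξ, e ξ * h ξ := fun h => by
    rw [Real.fourierInv_eq]
    rfl
  have hec : Continuous e := by
    have : Continuous fun ξ : SpaceTime => Real.fourierChar (inner ℝ ξ x) :=
      Real.continuous_fourierChar.comp (by fun_prop)
    exact continuous_induced_dom.comp this
  have hadd : ∀ a b, e (a + b) = e a * e b := fun a b => by
    simp only [e, inner_add_left, AddChar.map_add_eq_mul, Circle.coe_mul]
  have hsum : ∀ w : Fin m → SpaceTime, e (∑ i, w i) = ∏ i, e (w i) := fun w => by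
    have : ∀ s : Finset (Fin m), e (∑ i ∈ s, w i) = ∏ i ∈ s, e (w i) := fun s => by
      induction s using Finset.induction_on with
      | empty => simp [e]
      | insert a s ha ih => rw [Finset.sum_insert ha, Finset.prod_insert ha, hadd, ih]
    exact this _
  have hb : ∀ ξ, ‖e ξ‖ ≤ 1 := fun ξ => (Circle.norm_coe _).le
  have hI := (integrable_convIntegrand hg hi)
  have hI2 : Integrable (fun p : SpaceTime × (Fin m → SpaceTime) =>
      e p.1 * (g 0 (p.1 - ∑ i, p.2 i) * ∏ i : Fin m, g i.succ (p.2 i))) (volume.prod volume) :=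
    hI.bdd_mul (hec.comp continuous_fst).aestronglyMeasurable (c := 1)
      (Filter.Eventually.of_forall fun p => hb _)
  simp only [he]
  calc ∫ ξ, e ξ * cconv g ξ
      = ∫ ξ, ∫ w : Fin m → SpaceTime,
          e ξ * (g 0 (ξ - ∑ i, w i) * ∏ i : Fin m, g i.succ (w i)) := by
        simp only [cconv, integral_const_mul]
    _ = ∫ w : Fin m → SpaceTime, ∫ ξ,
          e ξ * (g 0 (ξ - ∑ i, w i) * ∏ i : Fin m, g i.succ (w i)) := integral_integral_swap hI2
    _ = ∫ w : Fin m → SpaceTime, (∫ ξ, e ξ * g 0 ξ) * ∏ i : Fin m, e (w i) * g i.succ (w i) := by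
        refine integral_congr_ae (Filter.Eventually.of_forall fun w => ?_)
        simp only
        -- After translation the character of the total frequency splits into one factor per
        -- variable, and the integrals decouple.
        rw [← integral_add_right_eq_self _ (∑ i, w i), ← integral_mul_const]
        refine integral_congr_ae (Filter.Eventually.of_forall fun ξ => ?_)
        simp only [add_sub_cancel_right, hadd, hsum, Finset.prod_mul_distrib]
        ring
    _ = _ := by
        rw [integral_const_mul, Fin.prod_univ_succ]
        congr 1
        exact integral_fintype_prod_volume_eq_prod
          fun (i : Fin m) (y : SpaceTime) => e y * g i.succ y

end Convolution

/-! ### Truncation to bounded, compactly supported transforms. -/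

section Truncation

open Classical in
/-- Truncation in frequency and in size. -/
noncomputable def trunc (k : ℕ) (g : SpaceTime → ℂ) (x : SpaceTime) : ℂ :=
  if ‖x‖ ≤ k ∧ ‖g x‖ ≤ k then g x else 0

theorem norm_trunc_le (k : ℕ) (g : SpaceTime → ℂ) (x : SpaceTime) : ‖trunc k g x‖ ≤ ‖g x‖ := by
  unfold trunc
  split_ifs <;> simp

theorem measurable_trunc (k : ℕ) {g : SpaceTime → ℂ} (hg : Measurable g) :
    Measurable (trunc k g) := by
  refine Measurable.ite ?_ hg measurable_const
  exact (measurableSet_le measurable_norm measurable_const).inter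
    (measurableSet_le hg.norm measurable_const)

theorem tendsto_trunc (g : SpaceTime → ℂ) (x : SpaceTime) :
    Filter.Tendsto (fun k => trunc k g x) Filter.atTop (nhds (g x)) := by
  refine tendsto_const_nhds.congr' ?_
  obtain ⟨k, hk⟩ := exists_nat_ge (max ‖x‖ ‖g x‖)
  filter_upwards [Filter.eventually_ge_atTop k] with l hl
  have hl' : (k : ℝ) ≤ l := by exact_mod_cast hl
  rw [trunc, if_pos ⟨(le_max_left _ _).trans (hk.trans hl'), (le_max_right _ _).trans (hk.trans hl')⟩]

theorem integrable_trunc (k : ℕ) {g : SpaceTime → ℂ} (hg : Measurable g) :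
    Integrable (trunc k g) := by
  have h1 : Integrable ((Metric.closedBall (0 : SpaceTime) k).indicator fun _ => (k : ℝ)) :=
    (integrable_indicator_iff Metric.isClosed_closedBall.measurableSet).2
      (integrableOn_const (isCompact_closedBall _ _).measure_lt_top.ne)
  refine h1.mono' (measurable_trunc k hg).aestronglyMeasurable
    (Filter.Eventually.of_forall fun x => ?_)
  unfold trunc
  split_ifs with h
  · rw [Set.indicator_of_mem (by simpa using h.1)]
    exact h.2
  · rw [norm_zero]
    exact Set.indicator_nonneg (fun _ _ => Nat.cast_nonneg k) _

end Truncation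

/-! ### Convergence in `L²` and common almost everywhere convergent subsequences. -/

section Convergence

/-- Dominated convergence in `L²`. -/
theorem tendsto_toLp_of_dominated {h : SpaceTime → ℂ} {H : ℕ → SpaceTime → ℂ}
    {D : SpaceTime → ℝ≥0∞} (hD : ∫⁻ x, D x ^ 2 ≠ ∞) (hDm : Measurable D)
    (hh : MemLp h 2 volume) (hH : ∀ k, MemLp (H k) 2 volume) (hle : ∀ k x, ‖H k x‖ₑ ≤ D x)
    (hlim : ∀ᵐ x, Filter.Tendsto (fun k => H k x) Filter.atTop (nhds (h x))) :
    Filter.Tendsto (fun k => (hH k).toLp (H k)) Filter.atTop (nhds (hh.toLp h)) := by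
  rw [Lp.tendsto_Lp_iff_tendsto_eLpNorm'']
  have h2 : ∀ k, eLpNorm (H k - h) 2 volume = (∫⁻ x, ‖H k x - h x‖ₑ ^ 2) ^ (1 / 2 : ℝ) := by
    intro k
    rw [eLpNorm_eq_lintegral_rpow_enorm_toReal two_ne_zero ENNReal.ofNat_ne_top]
    simp
  simp only [h2]
  have h3 : Filter.Tendsto (fun k => ∫⁻ x, ‖H k x - h x‖ₑ ^ 2) Filter.atTop (nhds 0) := by
    have hzero : (0 : ℝ≥0∞) = ∫⁻ _x : SpaceTime, 0 := by simp
    rw [hzero]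
    have hlimle : ∀ᵐ x, ‖h x‖ₑ ≤ D x := by
      filter_upwards [hlim] with x hx
      exact le_of_tendsto' hx.enorm fun k => hle k x
    refine tendsto_lintegral_of_dominated_convergence' (fun x => 2 * (D x ^ 2 + D x ^ 2))
      (fun k => ?_) (fun k => ?_) ?_ ?_
    · exact (((hH k).1.sub hh.1).enorm).pow_const 2
    · filter_upwards [hlimle] with x hx
      calc ‖H k x - h x‖ₑ ^ 2 ≤ (‖H k x‖ₑ + ‖h x‖ₑ) ^ 2 := by
            gcongr
            exact enorm_sub_le
        _ ≤ (D x + D x) ^ 2 := by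
            gcongr
            exact hle k x
        _ ≤ _ := ennreal_add_sq_le _ _
    · rw [lintegral_const_mul _ (by fun_prop), lintegral_add_left (by fun_prop)]
      finiteness
    · filter_upwards [hlim] with x hx
      have : Filter.Tendsto (fun k => H k x - h x) Filter.atTop (nhds 0) := by
        simpa using hx.sub_const (h x)
      have := this.enorm
      rw [enorm_zero] at this
      simpa using ENNReal.Tendsto.pow (n := 2) this
  have h4 := h3.ennrpow_const (1 / 2 : ℝ)
  simpa using h4

/-- A common almost everywhere convergent subsequence. -/
theorem exists_subseq_tendsto_ae {N : ℕ} {F : Fin N → ℕ → SpaceTime → ℂ} {f : Fin N → SpaceTime → ℂ}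
    (h : ∀ j, TendstoInMeasure volume (F j) Filter.atTop (f j)) :
    ∃ ns : ℕ → ℕ, StrictMono ns ∧ ∀ j, ∀ᵐ x, Filter.Tendsto (fun k => F j (ns k) x)
      Filter.atTop (nhds (f j x)) := by
  induction N with
  | zero => exact ⟨id, strictMono_id, fun j => j.elim0⟩
  | succ N ih =>
    obtain ⟨ns, hns, h1⟩ := ih fun j => h j.succ
    have h2 : TendstoInMeasure volume (fun k => F 0 (ns k)) Filter.atTop (f 0) :=
      (h 0).comp hns.tendsto_atTop
    obtain ⟨ms, hms, h3⟩ := h2.exists_seq_tendsto_ae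
    refine ⟨ns ∘ ms, hns.comp hms, fun j => ?_⟩
    refine Fin.cases h3 (fun i => ?_) j
    filter_upwards [h1 i] with x hx
    exact hx.comp hms.tendsto_atTop

end Convergence

/-! ### Pointwise products of functions with square integrable Fourier transforms. -/

section Product

theorem memLp_two_of_enorm_le {h : SpaceTime → ℂ} (hm : AEStronglyMeasurable h volume)
    {D : SpaceTime → ℝ≥0∞} (hD : ∫⁻ x, D x ^ 2 ≠ ∞) (hle : ∀ x, ‖h x‖ₑ ≤ D x) :
    MemLp h 2 volume := by
  refine ⟨hm, ?_⟩
  rw [eLpNorm_lt_top_iff_lintegral_rpow_enorm_lt_top two_ne_zero ENNReal.ofNat_ne_top]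
  refine lt_of_le_of_lt (lintegral_mono fun x => ?_) hD.lt_top
  simpa using pow_le_pow_left₀ zero_le (hle x) 2

/-- The `L²` transform and the integral transform represent the same tempered distribution. -/
theorem fourierInv_toLp_ae_eq {h : SpaceTime → ℂ} (hi : Integrable h) (h2 : MemLp h 2 volume) :
    ((𝓕⁻ (h2.toLp h) : Lp ℂ 2 (volume : Measure SpaceTime)) : SpaceTime → ℂ) =ᵐ[volume] 𝓕⁻ h := by
  have r1 := (represents_toLp h2).fourierInv hi
  rw [Lp.fourierInv_toTemperedDistribution_eq] at r1
  exact (represents_Lp _).ae_eq r1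

theorem fourier_congr_ae {f g : SpaceTime → ℂ} (h : f =ᵐ[volume] g) : 𝓕 f = 𝓕 g := by
  ext ξ
  rw [Real.fourier_eq, Real.fourier_eq]
  refine integral_congr_ae ?_
  filter_upwards [h] with x hx
  rw [hx]

theorem tendsto_fourier_of_tendsto_L1 {F : ℕ → Lp ℂ 1 (volume : Measure SpaceTime)}
    {f : Lp ℂ 1 (volume : Measure SpaceTime)} (h : Filter.Tendsto F Filter.atTop (nhds f))
    (ξ : SpaceTime) :
    Filter.Tendsto (fun k => 𝓕 (F k : SpaceTime → ℂ) ξ) Filter.atTop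
      (nhds (𝓕 (f : SpaceTime → ℂ) ξ)) := by
  rw [tendsto_iff_norm_sub_tendsto_zero] at h ⊢
  refine squeeze_zero (fun k => norm_nonneg _) (fun k => ?_) h
  have i1 := L1.integrable_coeFn (F k)
  have i2 := L1.integrable_coeFn f
  have e : 𝓕 (F k : SpaceTime → ℂ) ξ - 𝓕 (f : SpaceTime → ℂ) ξ
      = 𝓕 ((F k - f : Lp ℂ 1 (volume : Measure SpaceTime)) : SpaceTime → ℂ) ξ := by
    rw [fourier_congr_ae (Lp.coeFn_sub (F k) f)]
    rw [Real.fourier_eq, Real.fourier_eq, Real.fourier_eq, ← integral_sub]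
    · simp [smul_sub]
    · exact (Real.fourierIntegral_convergent_iff ξ).2 i1
    · exact (Real.fourierIntegral_convergent_iff ξ).2 i2
  rw [e, L1.norm_eq_integral_norm]
  exact VectorFourier.norm_fourierIntegral_le_integral_norm _ _ _ _ _

theorem enorm_trunc_le (k : ℕ) (g : SpaceTime → ℂ) (x : SpaceTime) : ‖trunc k g x‖ₑ ≤ ‖g x‖ₑ :=
  enorm_le_iff_norm_le.2 (norm_trunc_le k g x)

theorem memLp_trunc (k : ℕ) {g : SpaceTime → ℂ} (hg : Measurable g) (hL : MemLp g 2 volume) :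
    MemLp (trunc k g) 2 volume :=
  hL.mono (measurable_trunc k hg).aestronglyMeasurable
    (Filter.Eventually.of_forall fun x => norm_trunc_le k g x)

/-- The inverse Fourier transforms of the truncations converge in `L²`. -/
theorem exists_tendsto_fourierInv_trunc {g : SpaceTime → ℂ} (hg : Measurable g)
    (hL : MemLp g 2 volume) :
    ∃ F : ℕ → Lp ℂ 2 (volume : Measure SpaceTime),
      Filter.Tendsto F Filter.atTop (nhds (𝓕⁻ (hL.toLp g))) ∧
      ∀ k, (F k : SpaceTime → ℂ) =ᵐ[volume] 𝓕⁻ (trunc k g) := by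
  have hfin : ∫⁻ x, ‖g x‖ₑ ^ 2 ≠ ∞ := by
    have := (eLpNorm_lt_top_iff_lintegral_rpow_enorm_lt_top two_ne_zero
      ENNReal.ofNat_ne_top).1 hL.2
    simpa using this.ne
  have h := tendsto_toLp_of_dominated hfin hg.enorm hL (fun k => memLp_trunc k hg hL)
    (fun k => enorm_trunc_le k g) (Filter.Eventually.of_forall fun x => tendsto_trunc g x)
  exact ⟨_, (FourierTransform.continuous_fourierInv.tendsto _).comp h, fun k =>
    fourierInv_toLp_ae_eq (integrable_trunc k hg) (memLp_trunc k hg hL)⟩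

/-- The products of the inverse Fourier transforms of the truncations converge in `L²`. -/
theorem exists_tendsto_prod_fourierInv_trunc {m : ℕ} {g : Fin (m + 1) → SpaceTime → ℂ}
    (hg : ∀ j, Measurable (g j)) (hconv : ∫⁻ ξ, lconv (fun j x => ‖g j x‖ₑ) ξ ^ 2 ≠ ∞) :
    ∃ (P : ℕ → Lp ℂ 2 (volume : Measure SpaceTime)) (Φ : Lp ℂ 2 (volume : Measure SpaceTime)),
      Filter.Tendsto P Filter.atTop (nhds Φ) ∧
      ∀ k, (P k : SpaceTime → ℂ) =ᵐ[volume] fun x => ∏ j, 𝓕⁻ (trunc k (g j)) x := by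
  have ti : ∀ k j, Integrable (trunc k (g j)) := fun k j => integrable_trunc k (hg j)
  have tm : ∀ k j, Measurable (trunc k (g j)) := fun k j => measurable_trunc k (hg j)
  have hDm : Measurable (lconv fun j x => ‖g j x‖ₑ) := measurable_lconv fun j => (hg j).enorm
  have hDfin : ∀ᵐ ξ, lconv (fun j x => ‖g j x‖ₑ) ξ < ∞ := by
    filter_upwards [ae_lt_top (hDm.pow_const 2) hconv] with ξ hξ
    by_contra h
    rw [not_lt, top_le_iff] at h
    simp [h] at hξ
  have hΓle : ∀ k ξ, ‖cconv (fun j => trunc k (g j)) ξ‖ₑ ≤ lconv (fun j x => ‖g j x‖ₑ) ξ :=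
    fun k ξ => (enorm_cconv_le _ ξ).trans (lconv_mono (fun j x => enorm_trunc_le k (g j) x) ξ)
  have hΓL : ∀ k, MemLp (cconv fun j => trunc k (g j)) 2 volume := fun k => memLp_two_of_enorm_le
    (stronglyMeasurable_cconv (tm k)).aestronglyMeasurable hconv (hΓle k)
  have hΓlim : MemLp (cconv g) 2 volume := memLp_two_of_enorm_le
    (stronglyMeasurable_cconv hg).aestronglyMeasurable hconv (enorm_cconv_le _)
  have h := tendsto_toLp_of_dominated hconv hDm hΓlim hΓL hΓle (by
    filter_upwards [hDfin] with ξ hξ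
    exact tendsto_cconv hg tm (fun k j x => norm_trunc_le k (g j) x)
      (fun j x => tendsto_trunc (g j) x) hξ)
  refine ⟨_, _, (FourierTransform.continuous_fourierInv.tendsto _).comp h, fun k => ?_⟩
  filter_upwards [fourierInv_toLp_ae_eq (integrable_cconv (tm k) (ti k)) (hΓL k)] with x hx
  rw [← fourierInv_cconv (tm k) (ti k)]
  exact hx

/-- The limit of products is the product of the limits. -/
theorem ae_eq_prod_of_tendsto {N : ℕ} {F : Fin N → ℕ → Lp ℂ 2 (volume : Measure SpaceTime)}
    {f : Fin N → Lp ℂ 2 (volume : Measure SpaceTime)} {P : ℕ → Lp ℂ 2 (volume : Measure SpaceTime)}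
    {Φ : Lp ℂ 2 (volume : Measure SpaceTime)}
    (hF : ∀ j, Filter.Tendsto (F j) Filter.atTop (nhds (f j)))
    (hP : Filter.Tendsto P Filter.atTop (nhds Φ))
    (h : ∀ k, (P k : SpaceTime → ℂ) =ᵐ[volume] fun x => ∏ j, F j k x) :
    (Φ : SpaceTime → ℂ) =ᵐ[volume] fun x => ∏ j, f j x := by
  obtain ⟨ns, -, hns⟩ := exists_subseq_tendsto_ae (N := N + 1)
    (F := Fin.cons (fun k => (P k : SpaceTime → ℂ)) fun j k => (F j k : SpaceTime → ℂ))
    (f := Fin.cons (Φ : SpaceTime → ℂ) fun j => (f j : SpaceTime → ℂ)) (by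
      refine Fin.cases ?_ fun j => ?_
      · simpa using tendstoInMeasure_of_tendsto_Lp hP
      · simpa using tendstoInMeasure_of_tendsto_Lp (hF j))
  have h0 := hns 0
  have h1 := ae_all_iff.2 fun j : Fin N => hns j.succ
  simp only [Fin.cons_zero, Fin.cons_succ] at h0 h1
  filter_upwards [h0, h1, ae_all_iff.2 h] with x x0 x1 x2
  refine tendsto_nhds_unique x0 ?_
  simp only [x2]
  exact tendsto_finsetProd _ fun j _ => x1 j

/-- The Fourier transform of a product of two limits in `L²` is dominated if it is for the
approximating products. -/
theorem enorm_fourier_mul_le_of_tendsto {F P : ℕ → Lp ℂ 2 (volume : Measure SpaceTime)}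
    {f Φ : Lp ℂ 2 (volume : Measure SpaceTime)} (hF : Filter.Tendsto F Filter.atTop (nhds f))
    (hP : Filter.Tendsto P Filter.atTop (nhds Φ)) {D : SpaceTime → ℝ≥0∞}
    {H : ℕ → SpaceTime → ℂ} (hi : ∀ k, Integrable (H k)) (hle : ∀ k ξ, ‖H k ξ‖ₑ ≤ D ξ)
    (hH : ∀ k, 𝓕⁻ (H k) =ᵐ[volume] fun x => F k x * P k x) :
    ∀ᵐ ξ, ‖𝓕 (fun x => f x * Φ x) ξ‖ₑ ≤ D ξ := by
  -- Hölder's inequality as a bounded bilinear map from `L² × L²` to `L¹`: the products converge in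
  -- `L¹`, so their Fourier transforms converge at every point.
  obtain ⟨B, hB⟩ : ∃ B : Lp ℂ 2 (volume : Measure SpaceTime) →L[ℂ]
      Lp ℂ 2 (volume : Measure SpaceTime) →L[ℂ] Lp ℂ 1 (volume : Measure SpaceTime),
      ∀ a b, (B a b : SpaceTime → ℂ) =ᵐ[volume] fun x => a x * b x :=
    ⟨(ContinuousLinearMap.mul ℂ ℂ).holderL volume 2 2 1, fun a b =>
      ContinuousLinearMap.coeFn_holder (r := 1) (ContinuousLinearMap.mul ℂ ℂ) a b⟩
  have hBlim : Filter.Tendsto (fun k => B (F k) (P k)) Filter.atTop (nhds (B f Φ)) :=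
    (B.continuous₂.tendsto (f, Φ)).comp (hF.prodMk_nhds hP)
  have hae : ∀ k, 𝓕 (B (F k) (P k) : SpaceTime → ℂ) =ᵐ[volume] H k := by
    intro k
    obtain ⟨T, hT⟩ := exists_represents_of_integrable (hi k)
    have h1 : 𝓕⁻ (H k) =ᵐ[volume] (B (F k) (P k) : SpaceTime → ℂ) :=
      (hH k).trans (hB _ _).symm
    have h2 := ((hT.fourierInv (hi k)).congr h1).fourier (L1.integrable_coeFn _)
    rw [FourierTransform.fourier_fourierInv_eq] at h2
    exact h2.ae_eq hT
  rw [← fourier_congr_ae (hB f Φ)]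
  filter_upwards [ae_all_iff.2 hae] with ξ hξ
  refine le_of_tendsto' (tendsto_fourier_of_tendsto_L1 hBlim ξ).enorm fun k => ?_
  rw [hξ k]
  exact hle k ξ

/-- A product of inverse Fourier transforms of square integrable functions is integrable, and its
Fourier transform is dominated by the convolution, if the product of all factors but one is
square integrable. -/
theorem integrable_prod_and_enorm_fourier_le {m : ℕ} {g : Fin (m + 2) → SpaceTime → ℂ}
    (hg : ∀ j, Measurable (g j)) (hL : ∀ j, MemLp (g j) 2 volume)
    (hconv : ∫⁻ ξ, lconv (fun (j : Fin (m + 1)) x => ‖g j.succ x‖ₑ) ξ ^ 2 ≠ ∞)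
    {f : Fin (m + 2) → Lp ℂ 2 (volume : Measure SpaceTime)}
    (hf : ∀ j, f j = 𝓕⁻ ((hL j).toLp (g j))) :
    Integrable (fun p => ∏ j, f j p) ∧
      ∀ᵐ ξ, ‖𝓕 (fun p => ∏ j, f j p) ξ‖ₑ ≤ lconv (fun j x => ‖g j x‖ₑ) ξ := by
  choose F hF hFae using fun j => exists_tendsto_fourierInv_trunc (hg j) (hL j)
  simp only [← hf] at hF
  -- Only the product of the factors other than 0 is known to converge in `L²`; factor 0 is
  -- multiplied in afterwards, and the result lies in `L¹`.
  obtain ⟨P, Φ, hP, hPae⟩ := exists_tendsto_prod_fourierInv_trunc (fun j => hg j.succ) hconv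
  have hPae' : ∀ k, (P k : SpaceTime → ℂ) =ᵐ[volume]
      fun x => ∏ j : Fin (m + 1), F j.succ k x := by
    intro k
    filter_upwards [hPae k, ae_all_iff.2 fun j : Fin (m + 1) => hFae j.succ k] with x h1 h2
    rw [h1]
    exact Finset.prod_congr rfl fun j _ => (h2 j).symm
  have hΦ := ae_eq_prod_of_tendsto (fun j => hF j.succ) hP hPae'
  have hprod : (fun p => ∏ j, f j p) =ᵐ[volume] fun p => f 0 p * Φ p := by
    filter_upwards [hΦ] with x hx
    rw [Fin.prod_univ_succ, hx]
  have hint : Integrable fun p => f 0 p * Φ p := (Lp.memLp (f 0)).integrable_mul (Lp.memLp Φ)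
  refine ⟨hint.congr hprod.symm, ?_⟩
  rw [fourier_congr_ae hprod]
  have ti : ∀ k j, Integrable (trunc k (g j)) := fun k j => integrable_trunc k (hg j)
  have tm : ∀ k j, Measurable (trunc k (g j)) := fun k j => measurable_trunc k (hg j)
  refine enorm_fourier_mul_le_of_tendsto (hF 0) hP
    (H := fun k => cconv fun j => trunc k (g j)) (fun k => integrable_cconv (tm k) (ti k))
    (fun k ξ => (enorm_cconv_le _ ξ).trans (lconv_mono (fun j x => enorm_trunc_le k (g j) x) ξ))
    fun k => ?_
  filter_upwards [hPae k, hFae 0 k] with x h1 h2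
  rw [h1, h2, fourierInv_cconv (tm k) (ti k), Fin.prod_univ_succ]

end Product

/-! ### Comparison of the weights of the space with the combined weight. -/

section WeightComparison

theorem bracket_nonneg (x s : ℝ) : 0 ≤ bracket x s := by
  unfold bracket
  positivity

theorem bracket_zero (x : ℝ) : bracket x 0 = 1 := by simp [bracket]

theorem one_add_abs_sq_rpow (x s : ℝ) : ((1 + |x|) ^ 2) ^ (s / 2) = (1 + |x|) ^ s := by
  rw [← Real.rpow_natCast, ← Real.rpow_mul (by positivity)]
  congr 1
  push_cast
  ring

theorem bracket_le {s : ℝ} (hs : 0 ≤ s) (x : ℝ) : bracket x s ≤ (1 + |x|) ^ s := by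
  rw [← one_add_abs_sq_rpow, bracket]
  refine Real.rpow_le_rpow (by positivity) ?_ (by positivity)
  nlinarith [sq_abs x, abs_nonneg x]

theorem le_bracket {s : ℝ} (hs : 0 ≤ s) (x : ℝ) : (1 + |x|) ^ s ≤ 2 ^ (s / 2) * bracket x s := by
  rw [← one_add_abs_sq_rpow, bracket, ← Real.mul_rpow (by positivity) (by positivity)]
  refine Real.rpow_le_rpow (by positivity) ?_ (by positivity)
  nlinarith [sq_abs x, sq_nonneg (|x| - 1)]

theorem bracket_le_of_nonpos {s : ℝ} (hs : s ≤ 0) (x : ℝ) :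
    bracket x s ≤ 2 ^ (-s / 2) * (1 + |x|) ^ s := by
  have h : 2 ^ (-s / 2) * (1 + |x|) ^ s = ((1 + |x|) ^ 2 / 2) ^ (s / 2) := by
    rw [Real.div_rpow (by positivity) (by positivity), one_add_abs_sq_rpow, neg_div,
      Real.rpow_neg (by positivity)]
    field_simp
  rw [h, bracket]
  refine Real.rpow_le_rpow_of_nonpos (by positivity) ?_ (by linarith)
  nlinarith [sq_abs x, sq_nonneg (|x| - 1)]

theorem weight_smul_eq (σ₁ σ₂ σ₃ b : ℝ) (w : SpaceTime) :
    weight σ₁ σ₂ σ₃ b ((2 * Real.pi) • w) = bracket (freqX w) σ₁ * bracket (freqY w) σ₂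
      * bracket (velocity w) σ₃ * bracket (modulation w) b := by
  simp [weight, velocity, modulation, freqX, freqY, freqT]

variable {s₁ s₂ ε : ℝ}

/-- The exponent `s₁ + 2 s₂ + ε` is distributed by means of `kap² ≤ 2 par` and `kap ≤ vel`. The
constant also covers `weight_high_le`, so that both parts of the norm are handled with one constant.
-/
theorem weight_low_le (hs₁ : 0 ≤ s₁) (hs₂ : 0 ≤ s₂) (hε : 0 ≤ ε) {b' : ℝ} (hb' : b' ≤ 0)
    (w : SpaceTime) :
    weight (s₁ + 2 * s₂ + ε) 0 0 b' ((2 * Real.pi) • w)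
      ≤ 2 ^ (s₂ - b' / 2) * (fullWeight s₁ s₂ ε w * (1 + |modulation w|) ^ b') := by
  rw [weight_smul_eq, bracket_zero, bracket_zero, mul_one, mul_one]
  have hk := kap_pos w
  have hp := par_pos w
  have h1 : bracket (freqX w) (s₁ + 2 * s₂ + ε) ≤ 2 ^ s₂ * fullWeight s₁ s₂ ε w := by
    calc _ ≤ kap w ^ (s₁ + 2 * s₂ + ε) := bracket_le (by positivity) _
      _ = kap w ^ s₁ * (kap w ^ 2) ^ s₂ * kap w ^ ε := by
          rw [Real.rpow_add hk, Real.rpow_add hk, ← Real.rpow_natCast, ← Real.rpow_mul hk.le]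
          norm_num
      _ ≤ kap w ^ s₁ * (2 * par w) ^ s₂ * vel w ^ ε := by
          have := kap_sq_le w
          have := kap_le_vel w
          gcongr
      _ = _ := by
          rw [Real.mul_rpow (by norm_num) hp.le, fullWeight]
          ring
  have h2 := bracket_le_of_nonpos hb' (modulation w)
  have hW := fullWeight_pos s₁ s₂ ε w
  calc _ ≤ (2 ^ s₂ * fullWeight s₁ s₂ ε w) * (2 ^ (-b' / 2) * (1 + |modulation w|) ^ b') :=
        mul_le_mul h1 h2 (bracket_nonneg _ _) (by positivity)
    _ = _ := by
        rw [show s₂ - b' / 2 = s₂ + -b' / 2 by ring, Real.rpow_add (by norm_num)]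
        ring

theorem weight_high_le (hs₁ : 0 ≤ s₁) (hs₂ : 0 ≤ s₂) (hε : 0 ≤ ε) {b' : ℝ} (hb' : b' ≤ 0)
    (w : SpaceTime) :
    weight s₁ s₂ ε b' ((2 * Real.pi) • w)
      ≤ 2 ^ (s₂ - b' / 2) * (fullWeight s₁ s₂ ε w * (1 + |modulation w|) ^ b') := by
  rw [weight_smul_eq]
  have hk := kap_pos w
  have hp := par_pos w
  have hv := vel_pos w
  have hW := fullWeight_pos s₁ s₂ ε w
  have h1 : bracket (freqX w) s₁ * bracket (freqY w) s₂ * bracket (velocity w) ε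
      ≤ fullWeight s₁ s₂ ε w := by
    have e1 : bracket (freqX w) s₁ ≤ kap w ^ s₁ := bracket_le hs₁ _
    have e2 : bracket (freqY w) s₂ ≤ par w ^ s₂ := (bracket_le hs₂ _).trans
      (Real.rpow_le_rpow (by positivity) (one_add_freqY_le w) hs₂)
    have e3 : bracket (velocity w) ε ≤ vel w ^ ε := (bracket_le hε _).trans
      (Real.rpow_le_rpow (by positivity) (by unfold vel; linarith [abs_nonneg (freqX w)]) hε)
    exact mul_le_mul (mul_le_mul e1 e2 (bracket_nonneg _ _) (by positivity)) e3
      (bracket_nonneg _ _) (by positivity)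
  have h2 := bracket_le_of_nonpos hb' (modulation w)
  have h3 : (1 : ℝ) ≤ 2 ^ s₂ := Real.one_le_rpow (by norm_num) hs₂
  calc _ ≤ fullWeight s₁ s₂ ε w * (2 ^ (-b' / 2) * (1 + |modulation w|) ^ b') :=
        mul_le_mul h1 h2 (bracket_nonneg _ _) hW.le
    _ ≤ 2 ^ s₂ * (fullWeight s₁ s₂ ε w * (2 ^ (-b' / 2) * (1 + |modulation w|) ^ b')) :=
        le_mul_of_one_le_left (by positivity) h3
    _ = _ := by
        rw [show s₂ - b' / 2 = s₂ + -b' / 2 by ring, Real.rpow_add (by norm_num)]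
        ring

/-- If `|η/k| ≤ |k|`, then `|η| ≤ k²` and everything is a power of `1 + |k|`. Otherwise `|η| ≥ k²`,
and the weights in `η` and `η/k` dominate. This explains the two parts of the norm. -/
theorem fullWeight_le (hs₂ : 0 ≤ s₂) (hε : 0 ≤ ε) {w : SpaceTime}
    (hw : freqX w ≠ 0) :
    fullWeight s₁ s₂ ε w ≤ 2 ^ (s₂ + ε) * (kap w ^ (s₁ + 2 * s₂ + ε)
      + kap w ^ s₁ * (1 + |freqY w|) ^ s₂ * (1 + |velocity w|) ^ ε) := by
  have hk := kap_pos w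
  have hp := par_pos w
  have hv := vel_pos w
  have hx := abs_nonneg (freqX w)
  have hq := abs_nonneg (velocity w)
  have hη := abs_freqX_mul_velocity hw
  have hsq := sq_abs (freqX w)
  have key : ∀ A B : ℝ, 0 < A → 0 < B → par w ≤ 2 * A → vel w ≤ 2 * B →
      fullWeight s₁ s₂ ε w ≤ 2 ^ (s₂ + ε) * (kap w ^ s₁ * A ^ s₂ * B ^ ε) := by
    intro A B hA hB h1 h2
    calc fullWeight s₁ s₂ ε w ≤ kap w ^ s₁ * (2 * A) ^ s₂ * (2 * B) ^ ε := by
          unfold fullWeight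
          gcongr
      _ = _ := by
          rw [Real.mul_rpow (by norm_num) hA.le, Real.mul_rpow (by norm_num) hB.le,
            Real.rpow_add (by norm_num)]
          ring
  rcases le_total |velocity w| |freqX w| with h | h
  · refine (key (kap w ^ 2) (kap w) (by positivity) hk ?_ ?_).trans ?_
    · unfold par kap
      nlinarith
    · unfold vel kap
      linarith
    · have e : kap w ^ s₁ * (kap w ^ 2) ^ s₂ * kap w ^ ε = kap w ^ (s₁ + 2 * s₂ + ε) := by
        rw [Real.rpow_add hk, Real.rpow_add hk, ← Real.rpow_natCast, ← Real.rpow_mul hk.le]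
        norm_num
      rw [e]
      exact mul_le_mul_of_nonneg_left (le_add_of_nonneg_right (by positivity)) (by positivity)
  · refine (key (1 + |freqY w|) (1 + |velocity w|) (by positivity) (by positivity) ?_ ?_).trans ?_
    · unfold par
      nlinarith
    · unfold vel
      linarith
    · exact mul_le_mul_of_nonneg_left (le_add_of_nonneg_left (by positivity)) (by positivity)

theorem fullWeight_mul_le_weight (hs₁ : 0 ≤ s₁) (hs₂ : 0 ≤ s₂) (hε : 0 ≤ ε) {b : ℝ} (hb : 0 ≤ b)
    {w : SpaceTime} (hw : freqX w ≠ 0) :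
    fullWeight s₁ s₂ ε w * (1 + |modulation w|) ^ b
      ≤ 2 ^ (s₂ + ε) * 2 ^ ((s₁ + 2 * s₂ + ε) / 2) * 2 ^ (b / 2)
        * (weight (s₁ + 2 * s₂ + ε) 0 0 b ((2 * Real.pi) • w)
          + weight s₁ s₂ ε b ((2 * Real.pi) • w)) := by
  rw [weight_smul_eq, weight_smul_eq, bracket_zero, bracket_zero, mul_one, mul_one]
  set c : ℝ := 2 ^ ((s₁ + 2 * s₂ + ε) / 2)
  have e1 : kap w ^ (s₁ + 2 * s₂ + ε) ≤ c * bracket (freqX w) (s₁ + 2 * s₂ + ε) :=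
    le_bracket (by positivity) _
  have n1 := bracket_nonneg (freqX w) s₁
  have n2 := bracket_nonneg (freqY w) s₂
  have n3 := bracket_nonneg (velocity w) ε
  have n4 := bracket_nonneg (freqX w) (s₁ + 2 * s₂ + ε)
  have n5 := bracket_nonneg (modulation w) b
  have hk := kap_pos w
  have e2 : kap w ^ s₁ * (1 + |freqY w|) ^ s₂ * (1 + |velocity w|) ^ ε
      ≤ c * (bracket (freqX w) s₁ * bracket (freqY w) s₂ * bracket (velocity w) ε) := by
    calc _ ≤ (2 ^ (s₁ / 2) * bracket (freqX w) s₁) * (2 ^ (s₂ / 2) * bracket (freqY w) s₂)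
          * (2 ^ (ε / 2) * bracket (velocity w) ε) :=
          mul_le_mul (mul_le_mul (le_bracket hs₁ _) (le_bracket hs₂ _) (by positivity)
            (by positivity)) (le_bracket hε _) (by positivity) (by positivity)
      _ = 2 ^ (s₁ / 2 + s₂ / 2 + ε / 2)
          * (bracket (freqX w) s₁ * bracket (freqY w) s₂ * bracket (velocity w) ε) := by
          rw [Real.rpow_add (by norm_num), Real.rpow_add (by norm_num)]
          ring
      _ ≤ _ := by
          refine mul_le_mul_of_nonneg_right ?_ (by positivity)
          exact Real.rpow_le_rpow_of_exponent_le (by norm_num) (by linarith)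
  calc _ ≤ (2 ^ (s₂ + ε) * (c * bracket (freqX w) (s₁ + 2 * s₂ + ε)
          + c * (bracket (freqX w) s₁ * bracket (freqY w) s₂ * bracket (velocity w) ε)))
          * (2 ^ (b / 2) * bracket (modulation w) b) :=
        mul_le_mul ((fullWeight_le hs₂ hε hw).trans (mul_le_mul_of_nonneg_left
          (add_le_add e1 e2) (by positivity))) (le_bracket hb _) (by positivity) (by positivity)
    _ = _ := by ring

theorem spaceWeight_eq (s₁ s₂ ε b : ℝ) (w : SpaceTime) :
    spaceWeight s₁ s₂ ε b w
      = ENNReal.ofReal (fullWeight s₁ s₂ ε w * (1 + |modulation w|) ^ b) := by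
  rw [spaceWeight, decay, neg_neg, ENNReal.ofReal_mul (fullWeight_pos _ _ _ _).le]

theorem one_le_spaceWeight (hs₁ : 0 ≤ s₁) (hs₂ : 0 ≤ s₂) (hε : 0 ≤ ε) {b : ℝ} (hb : 0 ≤ b)
    (w : SpaceTime) : 1 ≤ spaceWeight s₁ s₂ ε b w := by
  rw [spaceWeight_eq, ENNReal.one_le_ofReal]
  have h1 : 1 ≤ fullWeight s₁ s₂ ε w := by
    rw [fullWeight_eq, Real.one_le_exp_iff]
    have := lk_nonneg w
    have := lh_nonneg w
    have := lv_nonneg w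
    positivity
  exact one_le_mul_of_one_le_of_one_le h1
    (Real.one_le_rpow (by linarith [abs_nonneg (modulation w)]) hb)

theorem weight_nonneg (σ₁ σ₂ σ₃ b : ℝ) (ζ : SpaceTime) : 0 ≤ weight σ₁ σ₂ σ₃ b ζ :=
  mul_nonneg (mul_nonneg (mul_nonneg (bracket_nonneg _ _) (bracket_nonneg _ _))
    (bracket_nonneg _ _)) (bracket_nonneg _ _)

end WeightComparison

/-! ### The norms of distributions in terms of the weighted integrals. -/

section Norms

theorem eLpNorm_two_sq (f : SpaceTime → ℂ) :
    eLpNorm f 2 volume ^ 2 = ∫⁻ x, ‖f x‖ₑ ^ 2 := by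
  rw [eLpNorm_eq_lintegral_rpow_enorm_toReal two_ne_zero ENNReal.ofNat_ne_top,
    ← ENNReal.rpow_natCast, ← ENNReal.rpow_mul]
  simp

theorem xNorm_eq {u : 𝓢'(SpaceTime, ℂ)} {g : SpaceTime → ℂ} (h : Represents (𝓕 u) g)
    (σ₁ σ₂ σ₃ b : ℝ) :
    xNorm σ₁ σ₂ σ₃ b u
      = eLpNorm (fun w => (weight σ₁ σ₂ σ₃ b ((2 * Real.pi) • w) : ℂ) * g w) 2 volume := by
  refine le_antisymm (iInf₂_le g h) (le_iInf₂ fun g' h' => (eLpNorm_congr_ae ?_).le)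
  filter_upwards [h.ae_eq h'] with x hx
  rw [hx]

/-- Without a representing function the infimum in `xNorm` runs over an empty family and equals `∞`.
-/
theorem exists_represents_of_mem {s₁ s₂ ε b : ℝ} {u : 𝓢'(SpaceTime, ℂ)}
    (hu : u ∈ xsSpace s₁ s₂ ε b) : ∃ g, Represents (𝓕 u) g := by
  by_contra h
  push Not at h
  have h1 : xsNorm s₁ s₂ ε b u < ∞ := hu
  have h2 : xNorm s₁ s₂ ε b u = ∞ := by
    simp only [xNorm, iInf_eq_top]
    exact fun g hg => absurd hg (h g)
  rw [xsNorm, h2, add_top] at h1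
  exact lt_irrefl _ h1

theorem ae_freqX_ne_zero : ∀ᵐ w : SpaceTime, freqX w ≠ 0 := by
  set L : SpaceTime →ₗ[ℝ] ℝ := (EuclideanSpace.proj (0 : Fin 3) : SpaceTime →L[ℝ] ℝ).toLinearMap
  have hL : LinearMap.ker L ≠ ⊤ := by
    intro h
    have : (EuclideanSpace.single 0 1 : SpaceTime) ∈ LinearMap.ker L := h ▸ Submodule.mem_top
    simp [L] at this
  have h0 := Measure.addHaar_submodule (volume : Measure SpaceTime) _ hL
  rw [ae_iff]
  refine measure_mono_null (fun w hw => ?_) h0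
  have : freqX w = 0 := by simpa using hw
  simpa [L, freqX, Real.pi_ne_zero] using this

/-- A measurable representative which vanishes at zero frequency. -/
theorem Represents.exists_measurable {T : 𝓢'(SpaceTime, ℂ)} {g : SpaceTime → ℂ}
    (h : Represents T g) :
    ∃ g', Represents T g' ∧ Measurable g' ∧ ∀ x, freqX x = 0 → g' x = 0 := by
  have hm := h.locallyIntegrable.aestronglyMeasurable
  have hS : MeasurableSet {x : SpaceTime | freqX x ≠ 0} :=
    measurable_freqX (measurableSet_singleton 0).compl
  refine ⟨{x | freqX x ≠ 0}.indicator (hm.mk g), h.congr ?_,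
    hm.stronglyMeasurable_mk.measurable.indicator hS, fun x hx => ?_⟩
  · filter_upwards [hm.ae_eq_mk, ae_freqX_ne_zero] with x h1 h2
    rw [Set.indicator_of_mem (show x ∈ {x | freqX x ≠ 0} from h2), h1]
  · exact Set.indicator_of_notMem (show x ∉ {x | freqX x ≠ 0} from fun h => h hx) _

variable {s₁ s₂ ε : ℝ}

theorem measurable_weight_smul (σ₁ σ₂ σ₃ b : ℝ) :
    Measurable fun w => weight σ₁ σ₂ σ₃ b ((2 * Real.pi) • w) := by
  have m (f : SpaceTime → ℝ) (hf : Measurable f) (s : ℝ) : Measurable fun w => bracket (f w) s :=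
    ((hf.pow_const 2).const_add 1).pow_const _
  simp only [weight_smul_eq]
  exact (((m _ measurable_freqX _).mul (m _ measurable_freqY _)).mul
    (m _ measurable_velocity _)).mul (m _ measurable_modulation _)

/-- The pointwise comparison of weights needs `k ≠ 0`; on the null set `k = 0` the representative is
assumed to vanish. -/
theorem lintegral_spaceWeight_le (hs₁ : 0 ≤ s₁) (hs₂ : 0 ≤ s₂) (hε : 0 ≤ ε) {b : ℝ} (hb : 0 ≤ b)
    {u : 𝓢'(SpaceTime, ℂ)} {g : SpaceTime → ℂ} (h : Represents (𝓕 u) g)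
    (hz : ∀ x, freqX x = 0 → g x = 0) :
    ∫⁻ x, (spaceWeight s₁ s₂ ε b x * ‖g x‖ₑ) ^ 2
      ≤ 2 * ENNReal.ofReal (2 ^ (s₂ + ε) * 2 ^ ((s₁ + 2 * s₂ + ε) / 2) * 2 ^ (b / 2)) ^ 2
        * xsNorm s₁ s₂ ε b u ^ 2 := by
  set K : ℝ := 2 ^ (s₂ + ε) * 2 ^ ((s₁ + 2 * s₂ + ε) / 2) * 2 ^ (b / 2)
  have hK : 0 ≤ K := by positivity
  rw [xsNorm, xNorm_eq h, xNorm_eq h]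
  set A : SpaceTime → ℂ := fun w =>
    (weight (s₁ + 2 * s₂ + ε) 0 0 b ((2 * Real.pi) • w) : ℂ) * g w with hA
  set B : SpaceTime → ℂ := fun w => (weight s₁ s₂ ε b ((2 * Real.pi) • w) : ℂ) * g w with hB
  have hAe : ∀ x, ‖A x‖ₑ
      = ENNReal.ofReal (weight (s₁ + 2 * s₂ + ε) 0 0 b ((2 * Real.pi) • x)) * ‖g x‖ₑ := fun x => by
    rw [hA, enorm_mul, ← ofReal_norm, Complex.norm_real,
      Real.norm_of_nonneg (weight_nonneg _ _ _ _ _)]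
  have hBe : ∀ x, ‖B x‖ₑ
      = ENNReal.ofReal (weight s₁ s₂ ε b ((2 * Real.pi) • x)) * ‖g x‖ₑ := fun x => by
    rw [hB, enorm_mul, ← ofReal_norm, Complex.norm_real,
      Real.norm_of_nonneg (weight_nonneg _ _ _ _ _)]
  have hAm : AEMeasurable (fun x => ‖A x‖ₑ ^ 2) := by
    simp only [hAe]
    exact ((measurable_weight_smul _ _ _ _).ennreal_ofReal.aemeasurable.mul
      h.locallyIntegrable.aestronglyMeasurable.enorm).pow_const 2
  have hpt : ∀ x, (spaceWeight s₁ s₂ ε b x * ‖g x‖ₑ) ^ 2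
      ≤ ENNReal.ofReal K ^ 2 * (2 * (‖A x‖ₑ ^ 2 + ‖B x‖ₑ ^ 2)) := by
    intro x
    by_cases hx : freqX x = 0
    · simp [hz x hx]
    · calc (spaceWeight s₁ s₂ ε b x * ‖g x‖ₑ) ^ 2 ≤ (ENNReal.ofReal K * (‖A x‖ₑ + ‖B x‖ₑ)) ^ 2 := by
            refine pow_le_pow_left₀ zero_le ?_ 2
            rw [spaceWeight_eq, hAe, hBe, ← add_mul, ← mul_assoc,
              ← ENNReal.ofReal_add (weight_nonneg _ _ _ _ _) (weight_nonneg _ _ _ _ _),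
              ← ENNReal.ofReal_mul hK]
            exact mul_le_mul_left (ENNReal.ofReal_le_ofReal
              (fullWeight_mul_le_weight hs₁ hs₂ hε hb hx)) _
        _ ≤ _ := by
            rw [mul_pow]
            exact mul_le_mul_right (ennreal_add_sq_le _ _) _
  calc _ ≤ ∫⁻ x, ENNReal.ofReal K ^ 2 * (2 * (‖A x‖ₑ ^ 2 + ‖B x‖ₑ ^ 2)) := lintegral_mono hpt
    _ = ENNReal.ofReal K ^ 2 * (2 * (eLpNorm A 2 volume ^ 2 + eLpNorm B 2 volume ^ 2)) := by
        rw [lintegral_const_mul' _ _ (by finiteness), lintegral_const_mul' _ _ (by finiteness),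
          lintegral_add_left' hAm, eLpNorm_two_sq, eLpNorm_two_sq]
    _ ≤ ENNReal.ofReal K ^ 2 * (2 * (eLpNorm A 2 volume + eLpNorm B 2 volume) ^ 2) := by
        have : eLpNorm A 2 volume ^ 2 + eLpNorm B 2 volume ^ 2
            ≤ (eLpNorm A 2 volume + eLpNorm B 2 volume) ^ 2 := by
          rw [add_sq]
          refine add_le_add_left le_self_add _
        gcongr
    _ = _ := by ring

theorem memLp_of_spaceWeight (hs₁ : 0 ≤ s₁) (hs₂ : 0 ≤ s₂) (hε : 0 ≤ ε) {b : ℝ} (hb : 0 ≤ b)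
    {g : SpaceTime → ℂ} (hg : Measurable g)
    (h : ∫⁻ x, (spaceWeight s₁ s₂ ε b x * ‖g x‖ₑ) ^ 2 ≠ ∞) : MemLp g 2 volume :=
  memLp_two_of_enorm_le hg.aestronglyMeasurable h fun x =>
    le_mul_of_one_le_left zero_le (one_le_spaceWeight hs₁ hs₂ hε hb x)

/-- The Fourier transform of the derivative. -/
theorem Represents.fourier_dx {P : 𝓢'(SpaceTime, ℂ)} {G : SpaceTime → ℂ}
    (h : Represents (𝓕 P) G) : Represents (𝓕 (dx P)) fun w => Complex.I * (freqX w : ℂ) * G w := by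
  intro ψ
  set m : SpaceTime := EuclideanSpace.single 0 1
  have hin : ∀ w : SpaceTime, inner ℝ w m = w 0 := fun w => by
    simp [m, EuclideanSpace.inner_single_right]
  have htg : Function.HasTemperateGrowth fun w : SpaceTime => ((inner ℝ w m : ℝ) : ℂ) := by
    fun_prop
  -- With the kernel `exp (-2πi⟨p, w⟩)` the derivative has symbol `2πi w₀`, which is `i k` for the
  -- frequency `k = 2π w₀`.
  set χ : 𝓢(SpaceTime, ℂ) := (2 * Real.pi * Complex.I : ℂ) •
    SchwartzMap.smulLeftCLM ℂ (fun w : SpaceTime => ((inner ℝ w m : ℝ) : ℂ)) ψ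
  have hχ : ∀ w, χ w * G w = ψ w * (Complex.I * (freqX w : ℂ) * G w) := fun w => by
    have e : χ w = (2 * Real.pi * Complex.I : ℂ) * (((inner ℝ w m : ℝ) : ℂ) * ψ w) := by
      simp only [χ, smul_apply, SchwartzMap.smulLeftCLM_apply_apply htg, smul_eq_mul]
    rw [e, hin, freqX]
    push_cast
    ring
  have h1 := h χ
  simp only [hχ] at h1
  refine ⟨h1.1, ?_⟩
  rw [← h1.2, dx, TemperedDistribution.fourier_lineDerivOp_eq]
  simp [χ, m]

theorem xNorm_dx_sq_le {σ₁ σ₂ σ₃ b' K : ℝ} (hK : 0 ≤ K) {P : 𝓢'(SpaceTime, ℂ)}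
    {G : SpaceTime → ℂ} (h : Represents (𝓕 P) G) {D : SpaceTime → ℝ≥0∞} (hD : ∀ᵐ ξ, ‖G ξ‖ₑ ≤ D ξ)
    (hw : ∀ w, weight σ₁ σ₂ σ₃ b' ((2 * Real.pi) • w)
      ≤ K * (fullWeight s₁ s₂ ε w * (1 + |modulation w|) ^ b')) :
    xNorm σ₁ σ₂ σ₃ b' (dx P) ^ 2 ≤ ENNReal.ofReal K ^ 2
      * ∫⁻ ξ, (ENNReal.ofReal |freqX ξ| * spaceWeight s₁ s₂ ε b' ξ * D ξ) ^ 2 := by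
  rw [xNorm_eq h.fourier_dx, eLpNorm_two_sq, ← lintegral_const_mul' _ _ (by finiteness)]
  refine lintegral_mono_ae ?_
  filter_upwards [hD] with ξ hξ
  rw [← mul_pow]
  refine pow_le_pow_left₀ zero_le ?_ 2
  have e : ‖(weight σ₁ σ₂ σ₃ b' ((2 * Real.pi) • ξ) : ℂ) * (Complex.I * (freqX ξ : ℂ) * G ξ)‖ₑ
      = ENNReal.ofReal (weight σ₁ σ₂ σ₃ b' ((2 * Real.pi) • ξ))
        * (ENNReal.ofReal |freqX ξ| * ‖G ξ‖ₑ) := by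
    rw [enorm_mul, enorm_mul, enorm_mul, ← ofReal_norm, ← ofReal_norm Complex.I,
      ← ofReal_norm (freqX ξ : ℂ), Complex.norm_real, Complex.norm_real, Complex.norm_I,
      Real.norm_of_nonneg (weight_nonneg _ _ _ _ _), Real.norm_eq_abs]
    simp
  rw [e]
  calc _ ≤ ENNReal.ofReal (K * (fullWeight s₁ s₂ ε ξ * (1 + |modulation ξ|) ^ b'))
        * (ENNReal.ofReal |freqX ξ| * D ξ) :=
        mul_le_mul' (ENNReal.ofReal_le_ofReal (hw ξ)) (mul_le_mul_right hξ _)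
    _ = _ := by
        rw [ENNReal.ofReal_mul hK, ← spaceWeight_eq]
        ring

end Norms

/-! ### The estimate for distributions. -/

theorem exists_product_estimate {n : ℕ} {s₁ s₂ ε : ℝ} (hs₁ : 1 / 2 < s₁)
    (hs₂ : (n : ℝ) / (2 * (n + 2)) ≤ s₂) (hε : 0 < ε) (hε₁ : ε ≤ 1) (hεs : ε ≤ s₁) :
    ∃ b' : ℝ, -(1 / 2) < b' ∧ ∀ b : ℝ, 1 / 2 < b → ∃ C : ℝ≥0,
      ∀ u : Fin (n + 3) → 𝓢'(SpaceTime, ℂ), (∀ j, u j ∈ xsSpace s₁ s₂ ε b) →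
        ∃ P : 𝓢'(SpaceTime, ℂ), IsProduct u P ∧
          xsNorm s₁ s₂ ε b' (dx P) ≤ C * ∏ j, xsNorm s₁ s₂ ε b (u j) := by
  have hs₂' : 0 ≤ s₂ := le_trans (by positivity) hs₂
  have hs₁' : 0 ≤ s₁ := by linarith
  obtain ⟨b', hb', hb'0, H⟩ := exists_lconv_le hs₁ hs₂ hε hε₁ hεs
  refine ⟨b', hb', fun b hb => ?_⟩
  have hb0 : 0 ≤ b := by linarith
  obtain ⟨C₁, hC₁⟩ := H b hb
  obtain ⟨C₂, hC₂⟩ := exists_lconv_power_le (n := n) hs₁ hs₂ hε hb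
  set K : ℝ := 2 ^ (s₂ - b' / 2)
  have hK : 0 ≤ K := by positivity
  set Q : ℝ≥0 := 2 * Real.toNNReal (2 ^ (s₂ + ε) * 2 ^ ((s₁ + 2 * s₂ + ε) / 2) * 2 ^ (b / 2)) ^ 2
    with hQ
  set M : ℝ≥0 := NNReal.sqrt (K.toNNReal ^ 2 * (C₁ * Q ^ (n + 3)))
  have hM : (M : ℝ≥0∞) ^ 2 = ENNReal.ofReal K ^ 2 * (C₁ * (Q : ℝ≥0∞) ^ (n + 3)) := by
    rw [← ENNReal.coe_pow, NNReal.sq_sqrt]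
    push_cast
    rfl
  -- The constant `M` bounds each of the two parts of the norm; it is a square root because the
  -- convolution estimate is one for squares.
  refine ⟨2 * M, fun u hu => ?_⟩
  have hg : ∀ j, ∃ g, Represents (𝓕 (u j)) g ∧ Measurable g ∧ ∀ x, freqX x = 0 → g x = 0 :=
    fun j => (exists_represents_of_mem (hu j)).elim fun _ h => h.exists_measurable
  choose g hgr hgm hgz using hg
  have hbd : ∀ j, ∫⁻ x, (spaceWeight s₁ s₂ ε b x * ‖g j x‖ₑ) ^ 2
      ≤ Q * xsNorm s₁ s₂ ε b (u j) ^ 2 := fun j => by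
    refine (lintegral_spaceWeight_le hs₁' hs₂' hε.le hb0 (hgr j) (hgz j)).trans_eq ?_
    rw [hQ]
    push_cast
    rfl
  have hfin : ∀ j, ∫⁻ x, (spaceWeight s₁ s₂ ε b x * ‖g j x‖ₑ) ^ 2 ≠ ∞ := fun j =>
    ((hbd j).trans_lt (ENNReal.mul_lt_top ENNReal.coe_lt_top (ENNReal.pow_lt_top (hu j)))).ne
  have hL : ∀ j, MemLp (g j) 2 volume := fun j =>
    memLp_of_spaceWeight hs₁' hs₂' hε.le hb0 (hgm j) (hfin j)
  have hz : ∀ j x, freqX x = 0 → ‖g j x‖ₑ = 0 := fun j x hx => by rw [hgz j x hx, enorm_zero]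
  -- Square integrability for the `n + 2` factors other than 0, which makes the full product
  -- integrable.
  have hconv : ∫⁻ ξ, lconv (fun (j : Fin (n + 2)) x => ‖g j.succ x‖ₑ) ξ ^ 2 ≠ ∞ :=
    ((hC₂ _ (fun j => (hgm j.succ).enorm) fun j => hz j.succ).trans_lt (ENNReal.mul_lt_top
      ENNReal.coe_lt_top (ENNReal.prod_lt_top fun j _ => (hfin j.succ).lt_top))).ne
  set f : Fin (n + 3) → Lp ℂ 2 (volume : Measure SpaceTime) := fun j => 𝓕⁻ ((hL j).toLp (g j))
    with hf
  obtain ⟨hint, hD⟩ := integrable_prod_and_enorm_fourier_le hgm hL hconv (fun j => congrFun hf j)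
  obtain ⟨P, hP⟩ := exists_represents_of_integrable hint
  refine ⟨P, ⟨fun j => f j, fun j => (hgr j).of_fourier_memLp (hL j), hP⟩, ?_⟩
  have hbound : ENNReal.ofReal K ^ 2 * ∫⁻ ξ, (ENNReal.ofReal |freqX ξ| * spaceWeight s₁ s₂ ε b' ξ
      * lconv (fun j x => ‖g j x‖ₑ) ξ) ^ 2 ≤ (M * ∏ j, xsNorm s₁ s₂ ε b (u j)) ^ 2 := by
    calc _ ≤ ENNReal.ofReal K ^ 2 * (C₁ * ∏ j, (Q * xsNorm s₁ s₂ ε b (u j) ^ 2)) :=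
          mul_le_mul_right ((hC₁ _ (fun j => (hgm j).enorm) hz).trans
            (mul_le_mul_right (Finset.prod_le_prod' fun j _ => hbd j) _)) _
      _ = _ := by
          rw [mul_pow, hM, Finset.prod_mul_distrib, Finset.prod_const, Finset.card_fin,
            Finset.prod_pow]
          ring
  have hest : ∀ {σ₁ σ₂ σ₃ : ℝ}, (∀ w, weight σ₁ σ₂ σ₃ b' ((2 * Real.pi) • w)
      ≤ K * (fullWeight s₁ s₂ ε w * (1 + |modulation w|) ^ b')) →
      xNorm σ₁ σ₂ σ₃ b' (dx P) ≤ M * ∏ j, xsNorm s₁ s₂ ε b (u j) := fun hw =>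
    le_of_sq_le ((xNorm_dx_sq_le hK (hP.fourier hint) hD hw).trans hbound)
  calc xsNorm s₁ s₂ ε b' (dx P)
      ≤ M * ∏ j, xsNorm s₁ s₂ ε b (u j) + M * ∏ j, xsNorm s₁ s₂ ε b (u j) :=
        add_le_add (hest (weight_low_le hs₁' hs₂' hε.le hb'0))
          (hest (weight_high_le hs₁' hs₂' hε.le hb'0))
    _ = _ := by
        push_cast
        ring

end KP

theorem theorem2 (l : ℕ) (hl : 3 ≤ l) (s₁ s₂ ε : ℝ) (hs₁ : 1 / 2 < s₁)
    (hs₂ : ((l : ℝ) - 3) / (2 * ((l : ℝ) - 1)) ≤ s₂) (hε : 0 < ε) (hε' : ε ≤ min s₁ 1) :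
    ∃ b' : ℝ, -(1 / 2) < b' ∧ ∀ b : ℝ, 1 / 2 < b → ∃ C : ℝ≥0,
      ∀ u : Fin l → 𝓢'(KP.SpaceTime, ℂ),
        (∀ j, u j ∈ KP.xsSpace s₁ s₂ ε b) →
        (∀ j, Distribution.dsupport (u j) ⊆ KP.timeSlab) →
        ∃ P : 𝓢'(KP.SpaceTime, ℂ), KP.IsProduct u P ∧
          KP.xsNorm s₁ s₂ ε b' (KP.dx P) ≤ C * ∏ j, KP.xsNorm s₁ s₂ ε b (u j) := by
  obtain ⟨n, rfl⟩ := Nat.exists_eq_add_of_le' hl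
  -- With `l = n + 3` the threshold `(l - 3) / (2 (l - 1))` takes the form used in
  -- `sobolev_balance`.
  have hs₂' : (n : ℝ) / (2 * (n + 2)) ≤ s₂ := by
    convert hs₂ using 2 <;> push_cast <;> ring
  obtain ⟨b', hb', H⟩ := KP.exists_product_estimate hs₁ hs₂' hε (hε'.trans (min_le_right _ _))
    (hε'.trans (min_le_left _ _))
  refine ⟨b', hb', fun b hb => ?_⟩
  obtain ⟨C, hC⟩ := H b hb
  exact ⟨C, fun u hu _ => hC u hu⟩
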